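/- **Definitions.** An *acute triangulation* of a 3-dimensional convex polytope $P\subset\mathbb R^3$ is a finite simplicial complex with underlying space $P$, consisting of 3-simplices and their faces, such that all dihedral angles of its 3-simplices are less than $\pi/2$. Two simplicial complexes are *combinatorially equivalent* if there is a bijection between their vertex sets under which simplices correspond to simplices. Let $X_{600}$ be the boundary complex of the 600-cell (120 vertices, 600 three-dimensional simplices), and let $X_{543}$ be the subcomplex of $X_{600}$ obtained by removing the interiors of all simplices intersecting a fixed 3-simplex; it has 543 three-dimensional simplices, and up to isomorphism it does not depend on the fixed 3-simplex. The *special subdivision* of a simplicial complex of dimension at most $3$ is obtained by 1. subdividing each edge into two by an extra vertex in its interior; 2. subdividing each 2-simplex, with corners $a,b,c$ and added edge vertices $m_{ab},m_{bc},m_{ca}$, into ten 2-simplices by means of three interior vertices $q_a,q_b,q_c$, namely $$a\,m_{ab}\,q_a,\; a\,m_{ca}\,q_a,\; b\,m_{ab}\,q_b,\; b\,m_{bc}\,q_b,\; c\,m_{bc}\,q_c,\; c\,m_{ca}\,q_c,\; m_{ab}\,q_a\,q_b,\; m_{bc}\,q_b\,q_c,\; m_{ca}\,q_c\,q_a,\;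 q_a\,q_b\,q_c;$$ 3. subdividing each 3-simplex so that it becomes isomorphic to $X_{543}$, its boundary being subdivided as in 1 and 2. This determines the special subdivision up to combinatorial equivalence. Let $W$ be the triangulation of the cube $[-1,1]^3$ into five 3-simplices: the regular one with vertices $(1,1,1),(-1,-1,1),(-1,1,-1),(1,-1,-1)$, and the closures of the four components of its complement in the cube. Let $Y$ be the triangulation of the regular octahedron $\{x\in\mathbb R^3: |x_1|+|x_2|+|x_3|\le 1\}$ into the eight 3-simplices that are the cones from its center over its faces. Let $W^*$ and $Y^*$ be the special subdivisions of $W$ and $Y$. **Theorem.** 1. There is an acute triangulation of the cube $[-1,1]^3$ that is combinatorially equivalent to $W^*$. 2. There is an acute triangulation of the regular octahedron $\{x\in\mathbb R^3:|x_1|+|x_2|+|x_3|\le 1\}$ that is combinatorially equivalent to $Y^*$. -/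

import Mathlib

/-! ### Combinatorial simplicial complexes -/

/-- The complex generated by a family `F` of finite sets: its simplices are the nonempty subsets of
members of `F`. -/
def generatedComplex {α : Type*} (F : Set (Finset α)) : PreAbstractSimplicialComplex α where
  faces := {s | s.Nonempty ∧ ∃ t ∈ F, s ⊆ t}
  isRelLowerSet_faces := by
    rintro s ⟨hs, t, ht, hst⟩
    exact ⟨hs, fun r hr hne => ⟨hne, t, ht, Finset.Subset.trans hr hst⟩⟩

/-- Two complexes are combinatorially equivalent if there is a bijection between their vertex sets
under which simplices correspond to simplices. -/
def CombinatoriallyEquivalent {α β : Type*} (K : PreAbstractSimplicialComplex α)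
    (L : PreAbstractSimplicialComplex β) : Prop :=
  ∃ e : {v : α // {v} ∈ K.faces} ≃ {w : β // {w} ∈ L.faces},
    ∀ s : Finset {v : α // {v} ∈ K.faces},
      s.map (Function.Embedding.subtype _) ∈ K.faces ↔
        (s.map e.toEmbedding).map (Function.Embedding.subtype _) ∈ L.faces

/-- The boundary faces of a pure 3-dimensional complex: the faces of those 2-simplices that lie in
exactly one 3-simplex. -/
def boundaryFaces {α : Type*} (K : PreAbstractSimplicialComplex α) : Set (Finset α) :=
  {s | s ∈ K.faces ∧ ∃ r ∈ K.faces, r.card = 3 ∧ s ⊆ r ∧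
    ∃! t : Finset α, t ∈ K.faces ∧ t.card = 4 ∧ r ⊆ t}

/-! ### The 600-cell -/

/-- The 120 vertices of the 600-cell (of circumradius 1): the points `±eᵢ`, the points
`(±1/2, ±1/2, ±1/2, ±1/2)`, and the even permutations of `(±φ/2, ±1/2, ±φ⁻¹/2, 0)`, where `φ` is
the golden ratio. -/
def cell600Vertices : Set (EuclideanSpace ℝ (Fin 4)) :=
  {x | (∃ i : Fin 4, (x i = 1 ∨ x i = -1) ∧ ∀ j, j ≠ i → x j = 0) ∨
    (∀ i : Fin 4, x i = 1 / 2 ∨ x i = -(1 / 2)) ∨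
    (∃ p : Equiv.Perm (Fin 4), Equiv.Perm.sign p = 1 ∧
      (x (p 0) = Real.goldenRatio / 2 ∨ x (p 0) = -(Real.goldenRatio / 2)) ∧
      (x (p 1) = 1 / 2 ∨ x (p 1) = -(1 / 2)) ∧
      (x (p 2) = Real.goldenRatio⁻¹ / 2 ∨ x (p 2) = -(Real.goldenRatio⁻¹ / 2)) ∧
      x (p 3) = 0)}

/-- The 600-cell, a convex regular 4-polytope. -/
def cell600 : Set (EuclideanSpace ℝ (Fin 4)) :=
  convexHull ℝ cell600Vertices

/-- The simplicial complex `X₆₀₀` given by the boundary of the 600-cell: its simplices are the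
nonempty sets of vertices of the 600-cell that lie in a common supporting hyperplane, that is, in a
common proper face of this (simplicial) polytope. -/
def X600 : PreAbstractSimplicialComplex (EuclideanSpace ℝ (Fin 4)) where
  faces := {s | s.Nonempty ∧ (∀ x ∈ s, x ∈ cell600Vertices) ∧
    ∃ (u : EuclideanSpace ℝ (Fin 4)) (c : ℝ), u ≠ 0 ∧
      (∀ x ∈ cell600, inner ℝ u x ≤ c) ∧ ∀ x ∈ s, inner ℝ u x = c}
  isRelLowerSet_faces := by
    rintro s ⟨hs, hV, u, c, hu, hle, heq⟩
    exact ⟨hs, fun r hr hne =>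
      ⟨hne, fun x hx => hV x (hr hx), u, c, hu, hle, fun x hx => heq x (hr hx)⟩⟩

/-- The subcomplex `X₅₄₃` of `X₆₀₀` left after removing the interiors of all simplices that
intersect the simplex `σ`. For a 3-simplex `σ` it has 543 3-simplices, and by the symmetry of the
600-cell its isomorphism type does not depend on `σ`. -/
def X543 (σ : Finset (EuclideanSpace ℝ (Fin 4))) :
    PreAbstractSimplicialComplex (EuclideanSpace ℝ (Fin 4)) where
  faces := {s | s ∈ X600.faces ∧ Disjoint s σ}
  isRelLowerSet_faces := by
    rintro s ⟨hs, hd⟩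
    exact ⟨(X600.isRelLowerSet_faces hs).1, fun r hr hne =>
      ⟨(X600.isRelLowerSet_faces hs).2 hr hne, Finset.disjoint_of_subset_left hr hd⟩⟩

/-! ### Special subdivisions -/

/-- Given a map `carrier` from the vertices of a subdivision `B` to the simplices of the subdivided
complex, the part of `B` that subdivides the simplex `t`. -/
def subdivisionOf {α β : Type*} (B : PreAbstractSimplicialComplex β) (carrier : β → Finset α)
    (t : Finset α) : PreAbstractSimplicialComplex β where
  faces := {s | s ∈ B.faces ∧ ∀ v ∈ s, carrier v ⊆ t}
  isRelLowerSet_faces := by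
    rintro s ⟨hs, hc⟩
    exact ⟨(B.isRelLowerSet_faces hs).1, fun r hr hne =>
      ⟨(B.isRelLowerSet_faces hs).2 hr hne, fun v hv => hc v (hr hv)⟩⟩

/-- The subdivision of a 2-simplex with corners `a, b, c` into ten 2-simplices: `mab, mbc, mca` are
the vertices added on the edges, and `qa, qb, qc` are three vertices in the interior of the
2-simplex, which span a central triangle, where `qa` is joined to the corner `a`, to the two edge
vertices next to `a`, and similarly for `qb`, `qc`. -/
def subdividedTriangle {β : Type*} [DecidableEq β] (a b c mab mbc mca qa qb qc : β) :
    PreAbstractSimplicialComplex β :=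
  generatedComplex
    {{a, mab, qa}, {a, mca, qa}, {b, mab, qb}, {b, mbc, qb}, {c, mbc, qc}, {c, mca, qc},
      {mab, qa, qb}, {mbc, qb, qc}, {mca, qc, qa}, {qa, qb, qc}}

/-- `B` is the special subdivision of the complex `A` of dimension at most 3, where `carrier v` is
the simplex of `A` whose interior contains the vertex `v` of `B`. -/
structure IsSpecialSubdivisionWith {α β : Type*} [DecidableEq α] [DecidableEq β]
    (A : PreAbstractSimplicialComplex α) (B : PreAbstractSimplicialComplex β)
    (carrier : β → Finset α) : Prop where
  /-- `A` has dimension at most 3. -/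
  dim_le : ∀ t ∈ A.faces, t.card ≤ 4
  /-- Every vertex of `B` lies in the interior of a simplex of `A`. -/
  carrier_mem : ∀ v, {v} ∈ B.faces → carrier v ∈ A.faces
  /-- Every simplex of `B` lies in a simplex of `A`. -/
  subordinate : ∀ s ∈ B.faces, ∃ t ∈ A.faces, ∀ v ∈ s, carrier v ⊆ t
  /-- Vertices of `A` are not subdivided. -/
  vertex : ∀ a, {a} ∈ A.faces → ∃ v, (subdivisionOf B carrier {a}).faces = {{v}}
  /-- Each edge of `A` is subdivided into two, by a vertex `m` in its interior. -/
  edge : ∀ a b, a ≠ b → {a, b} ∈ A.faces → ∃ v m w : β,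
    carrier v = {a} ∧ carrier w = {b} ∧ carrier m = {a, b} ∧
      subdivisionOf B carrier {a, b} = generatedComplex {{v, m}, {m, w}}
  /-- Each 2-simplex of `A` is subdivided into ten 2-simplices in the prescribed pattern. -/
  triangle : ∀ a b c, a ≠ b → b ≠ c → a ≠ c → {a, b, c} ∈ A.faces →
    ∃ va vb vc mab mbc mca qa qb qc : β,
      carrier va = {a} ∧ carrier vb = {b} ∧ carrier vc = {c} ∧
      carrier mab = {a, b} ∧ carrier mbc = {b, c} ∧ carrier mca = {c, a} ∧
      carrier qa = {a, b, c} ∧ carrier qb = {a, b, c} ∧ carrier qc = {a, b, c} ∧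
      qa ≠ qb ∧ qb ≠ qc ∧ qa ≠ qc ∧
      subdivisionOf B carrier {a, b, c} = subdividedTriangle va vb vc mab mbc mca qa qb qc
  /-- Each 3-simplex of `A` is subdivided so that it becomes isomorphic to `X₅₄₃`. -/
  tetrahedron : ∀ t ∈ A.faces, t.card = 4 → ∃ σ ∈ X600.faces, σ.card = 4 ∧
    CombinatoriallyEquivalent (subdivisionOf B carrier t) (X543 σ)
  /-- The boundary of the subdivided 3-simplex is the subdivision of its boundary. -/
  boundary : ∀ t ∈ A.faces, t.card = 4 →
    boundaryFaces (subdivisionOf B carrier t) = ⋃ f ∈ {f | f ⊂ t}, (subdivisionOf B carrier f).faces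

/-- `B` is the special subdivision of the complex `A` of dimension at most 3. This determines `B`
up to combinatorial equivalence, since every automorphism of the boundary of `X₅₄₃` is induced by
a symmetry of the 3-simplex, and extends to `X₅₄₃`. -/
def IsSpecialSubdivision {α β : Type*} [DecidableEq α] [DecidableEq β]
    (A : PreAbstractSimplicialComplex α) (B : PreAbstractSimplicialComplex β) : Prop :=
  ∃ carrier : β → Finset α, IsSpecialSubdivisionWith A B carrier

/-! ### The triangulations of the cube and of the octahedron that are subdivided -/

/-- The vertices `(1,1,1), (-1,-1,1), (-1,1,-1), (1,-1,-1)` of the regular 3-simplex inscribed in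
the cube with vertices `(±1,±1,±1)`. -/
def innerTetrahedron : Finset (Fin 3 → ℤ) :=
  {![1, 1, 1], ![-1, -1, 1], ![-1, 1, -1], ![1, -1, -1]}

/-- The complex `W` of the triangulation of the cube with vertices `(±1,±1,±1)` into five
3-simplices: the inscribed regular 3-simplex, and the four 3-simplices each spanned by one of the
remaining vertices `-x` of the cube and the three vertices adjacent to it, which are the vertices
of the inscribed 3-simplex other than its antipode `x`. -/
def cubeComplex : PreAbstractSimplicialComplex (Fin 3 → ℤ) :=
  generatedComplex
    ({innerTetrahedron} ∪ {t | ∃ x ∈ innerTetrahedron, t = insert (-x) (innerTetrahedron.erase x)})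

/-- The complex `Y` of the triangulation of the octahedron with vertices `±eᵢ` into the eight
3-simplices that are the cones from the center over its faces. -/
def octahedronComplex : PreAbstractSimplicialComplex (Fin 3 → ℤ) :=
  generatedComplex
    {t | ∃ ε : Fin 3 → ℤ, (∀ i, ε i = 1 ∨ ε i = -1) ∧
      t = {0, Pi.single 0 (ε 0), Pi.single 1 (ε 1), Pi.single 2 (ε 2)}}

/-! ### Acute triangulations -/

/-- The 3-cube with vertices `(±1,±1,±1)`. -/
def cube3 : Set (EuclideanSpace ℝ (Fin 3)) :=
  {x | ∀ i, |x i| ≤ 1}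

/-- The regular octahedron with vertices `±eᵢ`. -/
def octahedron3 : Set (EuclideanSpace ℝ (Fin 3)) :=
  {x | ∑ i, |x i| ≤ 1}

/-- The component of `x` orthogonal to `u`. -/
noncomputable def orthogonalComponent (u x : EuclideanSpace ℝ (Fin 3)) :
    EuclideanSpace ℝ (Fin 3) :=
  x - (inner ℝ u x / inner ℝ u u) • u

/-- The dihedral angle of the 3-simplex `abcd` at the edge `ab`: the angle between the components
of `c - a` and `d - a` orthogonal to the edge. -/
noncomputable def dihedralAngle (a b c d : EuclideanSpace ℝ (Fin 3)) : ℝ :=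
  InnerProductGeometry.angle (orthogonalComponent (b - a) (c - a))
    (orthogonalComponent (b - a) (d - a))

/-- `K` is an acute triangulation of `P`: a finite simplicial complex with underlying space `P`,
which consists of 3-simplices and their faces, such that all dihedral angles of the 3-simplices are
acute. -/
structure IsAcuteTriangulation (K : Geometry.SimplicialComplex ℝ (EuclideanSpace ℝ (Fin 3)))
    (P : Set (EuclideanSpace ℝ (Fin 3))) : Prop where
  finite : K.faces.Finite
  space_eq : K.space = P
  pure : ∀ s ∈ K.faces, ∃ t ∈ K.faces, s ⊆ t ∧ t.card = 4
  acute : ∀ t ∈ K.faces, t.card = 4 → ∀ a ∈ t, ∀ b ∈ t, ∀ c ∈ t, ∀ d ∈ t,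
    a ≠ b → a ≠ c → a ≠ d → b ≠ c → b ≠ d → c ≠ d → dihedralAngle a b c d < Real.pi / 2

/-!
The coarse triangulations of the cube and of the octahedron have 3-simplices of two shapes only:
the regular 3-simplex, and the corner 3-simplex, which has three orthogonal edges of equal length at
one vertex. So it is enough to place the vertices of `X₅₄₃` in each of these two shapes, in such a
way that the placements agree on common 2-faces. The positions are given by barycentric coordinates
in `regularTable` and `cornerTable`, as integers divided by 1000. The coarse triangulations are
coloured with four colours such that each 3-simplex has one vertex of each colour; vertices of the
subdivision in a common coarse face are identified by means of their barycentric coordinates with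
respect to the colours. For the cube, `cornerTable` describes a corner 3-simplex whose right angles
are at the colour 0, and the other ones are obtained by combinatorial involutions of `X₅₄₃` that
induce transpositions of the corners (`cornerSymmetry`). On the 2-face opposite to the right angles,
which is a regular triangle, the two tables agree (`coordinate_cornerTable`).

That such a placement is a triangulation follows from regularity: both placements are Delaunay
triangulations, so that the squared lengths, taken as heights, have for each cell a linear support
functional on the cone over the 3-simplex that agrees with the heights at the vertices of the cell,
and is strictly below at all other vertices (`IsRegularFan`). Two such support functionals force
cells to intersect in common faces (`IsRegularFan.mem_of_sum_eq`), and a cell with the largest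
support functional at a point contains this point, provided that the facets without a neighbour lie
in the boundary (`IsRegularFan.exists_nonneg`). Positivity of determinants, the inequalities for
the support functionals, and acuteness of all dihedral angles are inequalities between integers,
which are verified by the kernel (`isBlock_regularTable`, `isBlock_cornerTable`). The blocks are put
together by `IsAssembly.exists_acuteTriangulation`.

The identification of the listed complex with the complement of a 3-simplex in the boundary complex
of the 600-cell uses the same notion: the cones over the 600 cells form a regular fan with constant
heights, since different vertices have scalar product at most `φ / 2`, with equality for the
vertices of a cell. A supporting hyperplane can therefore meet the vertices in a face of one of the
600 cells only (`mem_X600`), which gives `exists_X543`. The subdivision pattern of the faces of the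
3-simplex is checked on the list of cells (`isSpecialSubdivisionWith_numberedComplex`).
-/

/-! ### Regular fans of simplicial cones -/

/-- A family `C` of 4-tuples of labels, each spanning a simplicial cone in the vector space `V` by
means of the vectors `b`. The functionals `L c i` are the coordinates with respect to the tuple `c`,
and the heights `h` certify regularity: the linear functional with the values `h` on the tuple `c`
lies strictly below `h` at all other vectors `b w` with `w ∈ W`. -/
structure IsRegularFan {ι V : Type*} [AddCommGroup V] [Module ℝ V] (C : Set (Fin 4 → ι))
    (W : Set ι) (b : ι → V) (h : ι → ℝ) (L : (Fin 4 → ι) → Fin 4 → V →ₗ[ℝ] ℝ) : Prop where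
  mem : ∀ c ∈ C, ∀ i, c i ∈ W
  dual : ∀ c ∈ C, ∀ i j, L c i (b (c j)) = if i = j then 1 else 0
  expand : ∀ c ∈ C, ∀ y, ∑ i, L c i y • b (c i) = y
  lt : ∀ c ∈ C, ∀ w ∈ W, w ∉ Set.range c → ∑ i, h (c i) * L c i (b w) < h w

namespace IsRegularFan

variable {ι V : Type*} [AddCommGroup V] [Module ℝ V] {C : Set (Fin 4 → ι)}
  {W : Set ι} {b : ι → V} {h : ι → ℝ} {L : (Fin 4 → ι) → Fin 4 → V →ₗ[ℝ] ℝ}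

/-- The linear functional that takes the values `h` on the tuple `c`. -/
def support (h : ι → ℝ) (L : (Fin 4 → ι) → Fin 4 → V →ₗ[ℝ] ℝ) (c : Fin 4 → ι) : V →ₗ[ℝ] ℝ :=
  ∑ i, h (c i) • L c i

lemma support_apply (c : Fin 4 → ι) (y : V) : support h L c y = ∑ i, h (c i) * L c i y := by
  simp [support, LinearMap.sum_apply]

lemma support_vertex (F : IsRegularFan C W b h L) {c : Fin 4 → ι} (hc : c ∈ C) (j : Fin 4) :
    support h L c (b (c j)) = h (c j) := by
  simp [support_apply, F.dual c hc]

lemma support_le (F : IsRegularFan C W b h L) {c : Fin 4 → ι} (hc : c ∈ C) {w : ι} (hw : w ∈ W) :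
    support h L c (b w) ≤ h w := by
  by_cases hr : w ∈ Set.range c
  · obtain ⟨j, rfl⟩ := hr
    exact (F.support_vertex hc j).le
  · rw [support_apply]
    exact (F.lt c hc w hw hr).le

lemma linearIndependent (F : IsRegularFan C W b h L) {c : Fin 4 → ι} (hc : c ∈ C) :
    LinearIndependent ℝ (b ∘ c) := by
  rw [Fintype.linearIndependent_iff]
  intro g hg i
  have := congrArg (L c i) hg
  simpa [F.dual c hc] using this

lemma injective (F : IsRegularFan C W b h L) {c : Fin 4 → ι} (hc : c ∈ C) :
    Function.Injective c :=
  Function.Injective.of_comp (F.linearIndependent hc).injective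

/-- Half of the intersection property: of two nonnegative combinations with the same value, the
second one is supported in the tuple that carries the first one, since otherwise the two support
functionals would contradict each other. -/
lemma mem_range_of_sum_eq (F : IsRegularFan C W b h L) {c c' : Fin 4 → ι} (hc : c ∈ C)
    (hc' : c' ∈ C) {s s' : Finset ι} (hs : ↑s ⊆ Set.range c) (hs' : ↑s' ⊆ Set.range c')
    {a a' : ι → ℝ} (ha : ∀ v ∈ s, 0 ≤ a v) (ha' : ∀ v ∈ s', 0 ≤ a' v)
    (heq : ∑ v ∈ s, a v • b v = ∑ v ∈ s', a' v • b v) :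
    ∀ w ∈ s', a' w ≠ 0 → w ∈ Set.range c := by
  have mW : ∀ v ∈ s, v ∈ W := fun v hv => by
    obtain ⟨j, rfl⟩ := hs hv; exact F.mem c hc j
  have mW' : ∀ v ∈ s', v ∈ W := fun v hv => by
    obtain ⟨j, rfl⟩ := hs' hv; exact F.mem c' hc' j
  have e : ∀ v ∈ s, support h L c (b v) = h v := fun v hv => by
    obtain ⟨j, rfl⟩ := hs hv; exact F.support_vertex hc j
  have e' : ∀ v ∈ s', support h L c' (b v) = h v := fun v hv => by
    obtain ⟨j, rfl⟩ := hs' hv; exact F.support_vertex hc' j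
  have h1 : ∑ v ∈ s', a' v * support h L c (b v) = ∑ v ∈ s, a v * h v := by
    have := congrArg (support h L c) heq
    simp only [map_sum, map_smul, smul_eq_mul] at this
    rw [← this]
    exact Finset.sum_congr rfl fun v hv => by rw [e v hv]
  have h2 : ∑ v ∈ s, a v * support h L c' (b v) = ∑ v ∈ s', a' v * h v := by
    have := congrArg (support h L c') heq
    simp only [map_sum, map_smul, smul_eq_mul] at this
    rw [this]
    exact Finset.sum_congr rfl fun v hv => by rw [e' v hv]
  have h3 : ∑ v ∈ s, a v * support h L c' (b v) ≤ ∑ v ∈ s, a v * h v :=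
    Finset.sum_le_sum fun v hv =>
      mul_le_mul_of_nonneg_left (F.support_le hc' (mW v hv)) (ha v hv)
  have h4 : ∑ v ∈ s', a' v * support h L c (b v) = ∑ v ∈ s', a' v * h v := by
    refine le_antisymm (Finset.sum_le_sum fun v hv =>
      mul_le_mul_of_nonneg_left (F.support_le hc (mW' v hv)) (ha' v hv)) ?_
    linarith
  have h5 := (Finset.sum_eq_sum_iff_of_le fun v hv =>
    mul_le_mul_of_nonneg_left (F.support_le hc (mW' v hv)) (ha' v hv)).1 h4
  intro w hw hne
  by_contra hr
  have := mul_left_cancel₀ hne (h5 w hw)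
  rw [support_apply] at this
  exact (F.lt c hc w (mW' w hw) hr).ne this

/-- The simplicial cones of a regular fan intersect in common faces. -/
lemma mem_of_sum_eq (F : IsRegularFan C W b h L) {c c' : Fin 4 → ι} (hc : c ∈ C)
    (hc' : c' ∈ C) {s s' : Finset ι} (hs : ↑s ⊆ Set.range c) (hs' : ↑s' ⊆ Set.range c')
    {a a' : ι → ℝ} (ha : ∀ v ∈ s, 0 ≤ a v) (ha' : ∀ v ∈ s', 0 ≤ a' v)
    (heq : ∑ v ∈ s, a v • b v = ∑ v ∈ s', a' v • b v) :
    ∀ w ∈ s', a' w ≠ 0 → w ∈ s := by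
  have key := F.mem_range_of_sum_eq hc hc' hs hs' ha ha' heq
  intro w hw hne
  obtain ⟨i, rfl⟩ := key w hw hne
  by_contra hns
  have h1 := congrArg (L c i) heq
  simp only [map_sum, map_smul, smul_eq_mul] at h1
  rw [Finset.sum_eq_zero, Finset.sum_eq_single_of_mem (c i) hw] at h1
  · rw [F.dual c hc, if_pos rfl, mul_one] at h1
    exact hne h1.symm
  · intro v hv hvne
    by_cases h0 : a' v = 0
    · simp [h0]
    · obtain ⟨j, rfl⟩ := key v hv h0
      rw [F.dual c hc, if_neg (fun hij => hvne (by rw [hij])), mul_zero]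
  · intro v hv
    obtain ⟨j, rfl⟩ := hs hv
    rw [F.dual c hc, if_neg (fun hij => hns (by rw [hij]; exact hv)), mul_zero]

/-- The cones of a regular fan cover every vector `y` that lies on the inner side of those facets
which have no neighbour: at a cone whose support functional is maximal at `y`, a negative coordinate
of `y` would lead to a neighbouring cone with a larger support functional. -/
lemma exists_nonneg (F : IsRegularFan C W b h L) (hfin : C.Finite) (hne : C.Nonempty) (y : V)
    (hy : ∀ c ∈ C, ∀ i, 0 ≤ L c i y ∨
      ∃ c' ∈ C, (∀ j, j ≠ i → c j ∈ Set.range c') ∧ c i ∉ Set.range c') :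
    ∃ c ∈ C, ∀ i, 0 ≤ L c i y := by
  obtain ⟨c, hc, hmax⟩ := hfin.exists_maximalFor (fun c => support h L c y) C hne
  refine ⟨c, hc, fun i => ?_⟩
  rcases hy c hc i with h0 | ⟨c', hc', hr, hn⟩
  · exact h0
  by_contra hneg
  push Not at hneg
  have hlt : support h L c' (b (c i)) < h (c i) := by
    rw [support_apply]; exact F.lt c' hc' _ (F.mem c hc i) hn
  have e1 : support h L c' y = ∑ j, L c j y * support h L c' (b (c j)) := by
    conv_lhs => rw [← F.expand c hc y]
    simp
  have e2 : support h L c y = ∑ j, L c j y * h (c j) := by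
    rw [support_apply]; exact Finset.sum_congr rfl fun j _ => mul_comm _ _
  have : support h L c y < support h L c' y := by
    rw [e1, e2]
    refine Finset.sum_lt_sum (fun j _ => ?_) ⟨i, Finset.mem_univ _, ?_⟩
    · by_cases hj : j = i
      · subst hj; exact (mul_lt_mul_of_neg_left hlt hneg).le
      · obtain ⟨m, hm⟩ := hr j hj
        rw [← hm, F.support_vertex hc' m]
    · exact mul_lt_mul_of_neg_left hlt hneg
  exact absurd (hmax hc' this.le) (not_le.2 this)

end IsRegularFan

/-! ### Acuteness -/

lemma dihedralAngle_lt_pi_div_two {a b c d : EuclideanSpace ℝ (Fin 3)}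
    (h : inner ℝ (b - a) (c - a) * inner ℝ (b - a) (d - a) <
      inner ℝ (b - a) (b - a) * (inner ℝ (c - a) (d - a) : ℝ)) :
    dihedralAngle a b c d < Real.pi / 2 := by
  unfold dihedralAngle orthogonalComponent
  set u := b - a
  set x := c - a
  set y := d - a
  have hu : (0 : ℝ) < inner ℝ u u := by
    refine lt_of_le_of_ne real_inner_self_nonneg fun h0 => ?_
    rw [eq_comm, inner_self_eq_zero] at h0
    simp [h0] at h
  have hpos : (0 : ℝ) < inner ℝ (x - (inner ℝ u x / inner ℝ u u) • u)
      (y - (inner ℝ u y / inner ℝ u u) • u) := by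
    have : inner ℝ (x - (inner ℝ u x / inner ℝ u u) • u) (y - (inner ℝ u y / inner ℝ u u) • u) =
        (inner ℝ u u * inner ℝ x y - inner ℝ u x * inner ℝ u y) / (inner ℝ u u : ℝ) := by
      simp only [inner_sub_left, inner_sub_right, real_inner_smul_left, real_inner_smul_right]
      rw [real_inner_comm u x]
      field_simp
      ring
    rw [this]
    exact div_pos (by linarith) hu
  rw [InnerProductGeometry.angle, Real.arccos_lt_pi_div_two]
  refine div_pos hpos (mul_pos ?_ ?_) <;> refine norm_pos_iff.2 fun h0 => ?_
  · rw [h0, inner_zero_left] at hpos; exact hpos.false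
  · rw [h0, inner_zero_right] at hpos; exact hpos.false

/-- The diagonal bilinear form with the entries `g`. -/
def diagForm (g x y : Fin 4 → ℝ) : ℝ := ∑ k, g k * x k * y k

/-! ### Blocks: subdivisions of a 3-simplex in barycentric coordinates -/

/-- The complex `X` on the vertex set `ℕ`, with the vertices placed in a 3-simplex by their
barycentric coordinates `β`, is a triangulation of the 3-simplex, and it is acute for the metric
whose restriction to vectors of coordinate sum `0` is the diagonal form `g`. The vertex `v` lies in
the interior of the face of the 3-simplex that is spanned by the corners in `supp v`. -/
structure IsBlock (X : PreAbstractSimplicialComplex ℕ) (supp : ℕ → Finset (Fin 4))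
    (β : ℕ → Fin 4 → ℝ) (g : Fin 4 → ℝ) : Prop where
  nonneg : ∀ v, {v} ∈ X.faces → ∀ k, 0 ≤ β v k
  sum_one : ∀ v, {v} ∈ X.faces → ∑ k, β v k = 1
  ne_zero_iff : ∀ v, {v} ∈ X.faces → ∀ k, β v k ≠ 0 ↔ k ∈ supp v
  indep : ∀ s ∈ X.faces, LinearIndepOn ℝ β (s : Set ℕ)
  inter : ∀ s ∈ X.faces, ∀ s' ∈ X.faces, ∀ a a' : ℕ → ℝ, (∀ v ∈ s, 0 ≤ a v) →
    (∀ v ∈ s', 0 ≤ a' v) → ∑ v ∈ s, a v • β v = ∑ v ∈ s', a' v • β v →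
    ∀ w ∈ s', a' w ≠ 0 → w ∈ s
  cover : ∀ y : Fin 4 → ℝ, (∀ k, 0 ≤ y k) → ∃ s ∈ X.faces, ∃ a : ℕ → ℝ, (∀ v ∈ s, 0 ≤ a v) ∧
    ∑ v ∈ s, a v • β v = y
  acute : ∀ s ∈ X.faces, ∀ a ∈ s, ∀ b ∈ s, ∀ c ∈ s, ∀ d ∈ s,
    a ≠ b → a ≠ c → a ≠ d → b ≠ c → b ≠ d → c ≠ d →
    diagForm g (β b - β a) (β c - β a) * diagForm g (β b - β a) (β d - β a) <
      diagForm g (β b - β a) (β b - β a) * diagForm g (β c - β a) (β d - β a)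

lemma singleton_mem_faces {α : Type*} {X : PreAbstractSimplicialComplex α} {s : Finset α} {v : α}
    (hs : s ∈ X.faces) (hv : v ∈ s) : {v} ∈ X.faces :=
  (X.isRelLowerSet_faces hs).2 (Finset.singleton_subset_iff.2 hv) (Finset.singleton_nonempty v)

/-- Symmetries of the combinatorial structure turn blocks into blocks. -/
lemma IsBlock.comp {X : PreAbstractSimplicialComplex ℕ} {supp : ℕ → Finset (Fin 4)}
    {β : ℕ → Fin 4 → ℝ} {g : Fin 4 → ℝ} (H : IsBlock X supp β g) (τ : ℕ → ℕ)
    (π : Equiv.Perm (Fin 4)) (hinv : ∀ v, {v} ∈ X.faces → τ (τ v) = v)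
    (hτ : ∀ s ∈ X.faces, s.image τ ∈ X.faces)
    (hsupp : ∀ v, {v} ∈ X.faces → ∀ k, k ∈ supp v ↔ π k ∈ supp (τ v)) :
    IsBlock X supp (fun v k => β (τ v) (π k)) (g ∘ π) := by
  have hv : ∀ v, {v} ∈ X.faces → {τ v} ∈ X.faces := fun v h => by simpa using hτ _ h
  have hinj : ∀ s ∈ X.faces, Set.InjOn τ s := fun s hs v h w h' e => by
    rw [← hinv v (singleton_mem_faces hs h), e, hinv w (singleton_mem_faces hs h')]
  have hsum : ∀ s ∈ X.faces, ∀ a : ℕ → ℝ, ∑ v ∈ s.image τ, a (τ v) • β v =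
      fun k => (∑ v ∈ s, a v • fun k => β (τ v) (π k)) (π.symm k) := fun s hs a => by
    rw [Finset.sum_image (hinj s hs)]
    funext k
    simp only [Finset.sum_apply, Pi.smul_apply, Equiv.apply_symm_apply]
    exact Finset.sum_congr rfl fun v h => by rw [hinv v (singleton_mem_faces hs h)]
  have hform : ∀ x y : Fin 4 → ℝ, diagForm (g ∘ π) (fun k => x (π k)) (fun k => y (π k)) =
      diagForm g x y := fun x y =>
    Equiv.sum_comp π (fun k => g k * x k * y k)
  refine ⟨fun v h k => H.nonneg _ (hv v h) _, fun v h => ?_, fun v h k => ?_, fun s hs => ?_,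
    fun s hs s' hs' a a' ha ha' heq w hw hne => ?_, fun y hy => ?_, ?_⟩
  · rw [Equiv.sum_comp π (β (τ v))]
    exact H.sum_one _ (hv v h)
  · rw [H.ne_zero_iff _ (hv v h), hsupp v h]
  · have h1 := H.indep _ (hτ s hs)
    rw [Finset.coe_image] at h1
    have h2 := LinearIndepOn.of_comp (LinearMap.funLeft ℝ ℝ π.symm)
      (v := fun v k => β (τ v) (π k)) (s := (s : Set ℕ)) (R := ℝ)
    refine h2 ?_
    have h3 := h1.comp_of_image (hinj s hs)
    convert h3 using 1
    funext v k
    simp [LinearMap.funLeft]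
  · have := H.inter _ (hτ s hs) _ (hτ s' hs') (a ∘ τ) (a' ∘ τ) ?_ ?_ ?_ (τ w)
      (Finset.mem_image_of_mem _ hw) ?_
    · obtain ⟨v, h, e⟩ := Finset.mem_image.1 this
      rw [← hinv w (singleton_mem_faces hs' hw), ← e, hinv v (singleton_mem_faces hs h)]
      exact h
    · intro v h
      obtain ⟨u, hu, rfl⟩ := Finset.mem_image.1 h
      simpa [hinv u (singleton_mem_faces hs hu)] using ha u hu
    · intro v h
      obtain ⟨u, hu, rfl⟩ := Finset.mem_image.1 h
      simpa [hinv u (singleton_mem_faces hs' hu)] using ha' u hu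
    · have h1 := hsum s hs a
      have h2 := hsum s' hs' a'
      simp only [Function.comp_apply]
      rw [h1, h2, heq]
    · simpa [hinv w (singleton_mem_faces hs' hw)] using hne
  · obtain ⟨s, hs, a, ha, he⟩ := H.cover (fun k => y (π.symm k)) fun k => hy _
    refine ⟨s.image τ, hτ s hs, a ∘ τ, fun v h => ?_, ?_⟩
    · obtain ⟨u, hu, rfl⟩ := Finset.mem_image.1 h
      simpa [hinv u (singleton_mem_faces hs hu)] using ha u hu
    · rw [Finset.sum_image (hinj s hs)]
      funext k
      have := congrFun he (π k)
      simp only [Finset.sum_apply, Pi.smul_apply, Equiv.symm_apply_apply] at this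
      simp only [Finset.sum_apply, Pi.smul_apply, Function.comp_apply]
      rw [← this]
      exact Finset.sum_congr rfl fun v h => by rw [hinv v (singleton_mem_faces hs h)]
  · intro s hs a ha b hb c hc d hd hab hac had hbc hbd hcd
    have hi := hinj s hs
    have := H.acute _ (hτ s hs) (τ a) (Finset.mem_image_of_mem _ ha) (τ b)
      (Finset.mem_image_of_mem _ hb) (τ c) (Finset.mem_image_of_mem _ hc) (τ d)
      (Finset.mem_image_of_mem _ hd) (hi.ne ha hb hab) (hi.ne ha hc hac) (hi.ne ha hd had)
      (hi.ne hb hc hbc) (hi.ne hb hd hbd) (hi.ne hc hd hcd)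
    simp only [← hform] at this
    exact this

/-! ### Coloured triangulations and the subdivision of their 3-simplices by blocks -/

/-- The point of Euclidean space with the given integer coordinates. -/
noncomputable def point (x : Fin 3 → ℤ) : EuclideanSpace ℝ (Fin 3) :=
  WithLp.toLp 2 fun i => (x i : ℝ)

/-- The 3-simplices with the vertices `p i 0, …, p i 3` form a triangulation of `P`, and the vertices
are coloured with the colours `0, …, 3` in such a way that `p i k` has the colour `k`. The
intersection of two 3-simplices is required to be their common face in terms of barycentric
coordinates. -/
structure IsColouredTriangulation {ι : Type*} (p : ι → Fin 4 → Fin 3 → ℤ)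
    (P : Set (EuclideanSpace ℝ (Fin 3))) : Prop where
  colour : ∀ i j k l, p i k = p j l → k = l
  injective : Function.Injective p
  indep : ∀ i (y : Fin 4 → ℝ), ∑ k, y k = 0 → ∑ k, y k • point (p i k) = 0 → y = 0
  inter : ∀ i j (a a' : Fin 4 → ℝ), (∀ k, 0 ≤ a k) → (∀ k, 0 ≤ a' k) → ∑ k, a k = 1 →
    ∑ k, a' k = 1 → ∑ k, a k • point (p i k) = ∑ k, a' k • point (p j k) →
    ∀ k, p i k ≠ p j k → a' k = 0
  mem_iff : ∀ x, x ∈ P ↔ ∃ i, ∃ a : Fin 4 → ℝ, (∀ k, 0 ≤ a k) ∧ ∑ k, a k = 1 ∧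
    ∑ k, a k • point (p i k) = x

/-- The point with the barycentric coordinates `β v` in the 3-simplex with the vertices `q k`. -/
noncomputable def blockPoint (q : Fin 4 → Fin 3 → ℤ) (β : ℕ → Fin 4 → ℝ) (v : ℕ) :
    EuclideanSpace ℝ (Fin 3) :=
  ∑ k, β v k • point (q k)

lemma sum_smul_blockPoint (q : Fin 4 → Fin 3 → ℤ) (β : ℕ → Fin 4 → ℝ) (s : Finset ℕ) (a : ℕ → ℝ) :
    ∑ v ∈ s, a v • blockPoint q β v = ∑ k, (∑ v ∈ s, a v • β v) k • point (q k) := by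
  simp only [blockPoint, Finset.smul_sum, Finset.sum_apply, Pi.smul_apply, Finset.sum_smul,
    smul_eq_mul, smul_smul]
  exact Finset.sum_comm

/-- The data from which a subdivided triangulation is assembled: a coloured triangulation `p` of `P`,
and for each of its 3-simplices a block, such that blocks agree on common faces. The forms `g i`
are the metrics of the 3-simplices up to scaling. -/
structure IsAssembly {ι : Type*} (p : ι → Fin 4 → Fin 3 → ℤ) (P : Set (EuclideanSpace ℝ (Fin 3)))
    (X : PreAbstractSimplicialComplex ℕ) (supp : ℕ → Finset (Fin 4))
    (β : ι → ℕ → Fin 4 → ℝ) (g : ι → Fin 4 → ℝ) : Prop where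
  coarse : IsColouredTriangulation p P
  block : ∀ i, IsBlock X supp (β i) (g i)
  compat : ∀ i j v, {v} ∈ X.faces → (∀ k ∈ supp v, p i k = p j k) → β i v = β j v
  metric : ∀ i, ∃ κ : ℝ, 0 < κ ∧ ∀ u u' : Fin 4 → ℝ, ∑ k, u k = 0 → ∑ k, u' k = 0 →
    inner ℝ (∑ k, u k • point (p i k)) (∑ k, u' k • point (p i k)) = κ * diagForm (g i) u u'

namespace IsAssembly

variable {ι : Type*} {p : ι → Fin 4 → Fin 3 → ℤ} {P : Set (EuclideanSpace ℝ (Fin 3))}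
  {X : PreAbstractSimplicialComplex ℕ} {supp : ℕ → Finset (Fin 4)} {β : ι → ℕ → Fin 4 → ℝ}
  {g : ι → Fin 4 → ℝ}

lemma sum_coord (A : IsAssembly p P X supp β g) (i : ι) {s : Finset ℕ} (hs : s ∈ X.faces)
    (a : ℕ → ℝ) : ∑ k, (∑ v ∈ s, a v • β i v) k = ∑ v ∈ s, a v := by
  simp only [Finset.sum_apply, Pi.smul_apply, smul_eq_mul]
  rw [Finset.sum_comm]
  refine Finset.sum_congr rfl fun v hv => ?_
  rw [← Finset.mul_sum, (A.block i).sum_one v (singleton_mem_faces hs hv), mul_one]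

lemma coord_nonneg (A : IsAssembly p P X supp β g) (i : ι) {s : Finset ℕ} (hs : s ∈ X.faces)
    {a : ℕ → ℝ} (ha : ∀ v ∈ s, 0 ≤ a v) (k : Fin 4) : 0 ≤ (∑ v ∈ s, a v • β i v) k := by
  simp only [Finset.sum_apply, Pi.smul_apply, smul_eq_mul]
  exact Finset.sum_nonneg fun v hv =>
    mul_nonneg (ha v hv) ((A.block i).nonneg v (singleton_mem_faces hs hv) k)

lemma blockPoint_congr (A : IsAssembly p P X supp β g) {i j : ι} {v : ℕ} (hv : {v} ∈ X.faces)
    (h : ∀ k ∈ supp v, p i k = p j k) : blockPoint (p i) (β i) v = blockPoint (p j) (β j) v := by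
  unfold blockPoint
  refine Finset.sum_congr rfl fun k _ => ?_
  rw [A.compat i j v hv h]
  by_cases hk : k ∈ supp v
  · rw [h k hk]
  · rw [not_ne_iff.1 (mt ((A.block j).ne_zero_iff v hv k).1 hk), zero_smul, zero_smul]

/-- If a point lies in a simplex `s` of the block `i` and in a simplex `s'` of the block `j`, then
the vertices of `s'` that carry it lie in the common face of the two blocks, and belong to `s`. -/
lemma inter_blocks (A : IsAssembly p P X supp β g) {i j : ι} {s s' : Finset ℕ} (hs : s ∈ X.faces)
    (hs' : s' ∈ X.faces) {a a' : ℕ → ℝ} (ha : ∀ v ∈ s, 0 ≤ a v) (ha' : ∀ v ∈ s', 0 ≤ a' v)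
    (h1 : ∑ v ∈ s, a v = 1) (h1' : ∑ v ∈ s', a' v = 1)
    (heq : ∑ v ∈ s, a v • blockPoint (p i) (β i) v =
      ∑ v ∈ s', a' v • blockPoint (p j) (β j) v) :
    ∀ w ∈ s', a' w ≠ 0 → w ∈ s ∧ ∀ k ∈ supp w, p i k = p j k := by
  have hcommon : ∀ w ∈ s', a' w ≠ 0 → ∀ k ∈ supp w, p i k = p j k := by
    intro w hw hne k hk
    by_contra hpk
    have h0 : (∑ v ∈ s', a' v • β j v) k = 0 := by
      refine A.coarse.inter i j (∑ v ∈ s, a v • β i v) (∑ v ∈ s', a' v • β j v)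
        (A.coord_nonneg i hs ha) (A.coord_nonneg j hs' ha') ?_ ?_ ?_ k hpk
      · rw [A.sum_coord i hs, h1]
      · rw [A.sum_coord j hs', h1']
      · rw [← sum_smul_blockPoint, ← sum_smul_blockPoint, heq]
    simp only [Finset.sum_apply, Pi.smul_apply, smul_eq_mul] at h0
    rw [Finset.sum_eq_zero_iff_of_nonneg fun v hv =>
      mul_nonneg (ha' v hv) ((A.block j).nonneg v (singleton_mem_faces hs' hv) k)] at h0
    exact mul_ne_zero hne (((A.block j).ne_zero_iff w (singleton_mem_faces hs' hw) k).2 hk)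
      (h0 w hw)
  have hsum : ∑ v ∈ s, a v • β i v = ∑ v ∈ s', a' v • β i v := by
    rw [← sub_eq_zero]
    refine A.coarse.indep i _ ?_ ?_
    · simp only [Pi.sub_apply, Finset.sum_sub_distrib]
      rw [A.sum_coord i hs, A.sum_coord i hs', h1, h1', sub_self]
    · simp only [Pi.sub_apply, sub_smul, Finset.sum_sub_distrib]
      rw [← sum_smul_blockPoint, ← sum_smul_blockPoint, heq, sub_eq_zero]
      refine Finset.sum_congr rfl fun w hw => ?_
      by_cases h0 : a' w = 0
      · rw [h0, zero_smul, zero_smul]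
      · rw [A.blockPoint_congr (singleton_mem_faces hs' hw) (hcommon w hw h0)]
  exact fun w hw hne => ⟨(A.block i).inter s hs s' hs' a a' ha ha' hsum w hw hne,
    hcommon w hw hne⟩

lemma eq_of_blockPoint_eq (A : IsAssembly p P X supp β g) {i j : ι} {v w : ℕ} (hv : {v} ∈ X.faces)
    (hw : {w} ∈ X.faces) (h : blockPoint (p i) (β i) v = blockPoint (p j) (β j) w) :
    v = w ∧ ∀ k ∈ supp w, p i k = p j k := by
  have := A.inter_blocks (i := i) (j := j) hv hw (a := fun _ => 1) (a' := fun _ => 1)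
    (fun _ _ => zero_le_one) (fun _ _ => zero_le_one) (by simp) (by simp) (by simpa using h) w
    (Finset.mem_singleton_self w) one_ne_zero
  exact ⟨(Finset.mem_singleton.1 this.1).symm, this.2⟩

lemma injOn_blockPoint (A : IsAssembly p P X supp β g) (i : ι) :
    Set.InjOn (blockPoint (p i) (β i)) {v | {v} ∈ X.faces} :=
  fun _ hv _ hw h => (A.eq_of_blockPoint_eq hv hw h).1

lemma injOn_blockPoint_face (A : IsAssembly p P X supp β g) (i : ι) {s : Finset ℕ}
    (hs : s ∈ X.faces) : Set.InjOn (blockPoint (p i) (β i)) s :=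
  (A.injOn_blockPoint i).mono fun _ hv => singleton_mem_faces hs hv

open Classical in
lemma exists_weights (A : IsAssembly p P X supp β g) (i : ι) {s : Finset ℕ} (hs : s ∈ X.faces)
    {x : EuclideanSpace ℝ (Fin 3)}
    (hx : x ∈ convexHull ℝ (s.image (blockPoint (p i) (β i)) : Set (EuclideanSpace ℝ (Fin 3)))) :
    ∃ a : ℕ → ℝ, (∀ v ∈ s, 0 ≤ a v) ∧ ∑ v ∈ s, a v = 1 ∧
      ∑ v ∈ s, a v • blockPoint (p i) (β i) v = x := by
  obtain ⟨w, hw, h1, he⟩ := Finset.mem_convexHull'.1 hx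
  rw [Finset.sum_image (A.injOn_blockPoint_face i hs)] at h1 he
  exact ⟨fun v => w (blockPoint (p i) (β i) v), fun v hv => hw _ (Finset.mem_image_of_mem _ hv),
    h1, he⟩

open Classical in
/-- The subdivided triangulation: the union of the images of the blocks. -/
noncomputable def faces (_ : IsAssembly p P X supp β g) : Set (Finset (EuclideanSpace ℝ (Fin 3))) :=
  {s | ∃ i, ∃ s₀ ∈ X.faces, s = s₀.image (blockPoint (p i) (β i))}

open Classical in
lemma affineIndependent (A : IsAssembly p P X supp β g) (i : ι) {s : Finset ℕ} (hs : s ∈ X.faces) :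
    AffineIndependent ℝ ((↑) : (s.image (blockPoint (p i) (β i)) : Finset _) →
      EuclideanSpace ℝ (Fin 3)) := by
  have h : AffineIndependent ℝ fun v : s => blockPoint (p i) (β i) v := by
    rw [affineIndependent_iff_of_fintype]
    intro w hw h0
    rw [Finset.weightedVSub_eq_linear_combination _ hw] at h0
    have hz : ∑ v : s, w v • β i v = 0 := by
      refine A.coarse.indep i _ ?_ ?_
      · simp only [Finset.sum_apply, Pi.smul_apply, smul_eq_mul]
        rw [Finset.sum_comm, ← hw]
        refine Finset.sum_congr rfl fun v _ => ?_
        rw [← Finset.mul_sum, (A.block i).sum_one v (singleton_mem_faces hs v.2), mul_one]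
      · rw [← h0]
        simp only [blockPoint, Finset.smul_sum, Finset.sum_apply, Pi.smul_apply, Finset.sum_smul,
          smul_eq_mul, smul_smul]
        exact Finset.sum_comm
    exact Fintype.linearIndependent_iff.1 ((A.block i).indep s hs) w hz
  have h2 := h.range
  have hrange : (Set.range fun v : s => blockPoint (p i) (β i) v) =
      (s.image (blockPoint (p i) (β i)) : Finset (EuclideanSpace ℝ (Fin 3))) := by
    ext x
    simp
  rw [hrange] at h2
  exact h2

open Classical in
/-- The subdivided triangulation as a geometric simplicial complex. -/
noncomputable def complex (A : IsAssembly p P X supp β g) :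
    Geometry.SimplicialComplex ℝ (EuclideanSpace ℝ (Fin 3)) where
  faces := A.faces
  isRelLowerSet_faces := by
    rintro s ⟨i, s₀, hs, rfl⟩
    refine ⟨(X.isRelLowerSet_faces hs).1.image _, fun t ht hne => ?_⟩
    obtain ⟨t₀, ht₀, rfl⟩ := Finset.subset_image_iff.1 ht
    exact ⟨i, t₀, (X.isRelLowerSet_faces hs).2 ht₀ (Finset.image_nonempty.1 hne), rfl⟩
  indep := by
    rintro s ⟨i, s₀, hs, rfl⟩
    exact A.affineIndependent i hs
  inter_subset_convexHull := by
    rintro s t ⟨i, s, hs, rfl⟩ ⟨j, s', hs', rfl⟩ x ⟨hx, hx'⟩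
    obtain ⟨a, ha, h1, he⟩ := A.exists_weights i hs hx
    obtain ⟨a', ha', h1', he'⟩ := A.exists_weights j hs' hx'
    have key := A.inter_blocks hs hs' ha ha' h1 h1' (he.trans he'.symm)
    rw [← he', ← Finset.sum_filter_of_ne (p := fun v => a' v ≠ 0)
      (fun v _ h h0 => h (by rw [h0, zero_smul]))]
    refine (convex_convexHull ℝ _).sum_mem (fun v hv => ha' v (Finset.mem_filter.1 hv).1) ?_ ?_
    · rw [Finset.sum_filter_ne_zero, h1']
    · intro v hv
      obtain ⟨hv, hne⟩ := Finset.mem_filter.1 hv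
      refine subset_convexHull ℝ _ ⟨?_, Finset.mem_image_of_mem _ hv⟩
      rw [← A.blockPoint_congr (singleton_mem_faces hs' hv) (key v hv hne).2]
      exact Finset.mem_image_of_mem _ (key v hv hne).1

lemma mem_of_mem_convexHull (A : IsAssembly p P X supp β g) {s : Finset (EuclideanSpace ℝ (Fin 3))}
    (hs : s ∈ A.faces) {x : EuclideanSpace ℝ (Fin 3)}
    (hx : x ∈ convexHull ℝ (s : Set (EuclideanSpace ℝ (Fin 3)))) : x ∈ P := by
  obtain ⟨i, s, hs, rfl⟩ := hs
  obtain ⟨a, ha, h1, he⟩ := A.exists_weights i hs hx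
  refine (A.coarse.mem_iff x).2 ⟨i, _, A.coord_nonneg i hs ha, by rw [A.sum_coord i hs, h1], ?_⟩
  rw [← sum_smul_blockPoint, he]

lemma exists_mem_convexHull (A : IsAssembly p P X supp β g) {x : EuclideanSpace ℝ (Fin 3)}
    (hx : x ∈ P) : ∃ s ∈ A.faces, x ∈ convexHull ℝ (s : Set (EuclideanSpace ℝ (Fin 3))) := by
  classical
  obtain ⟨i, y, hy, h1, rfl⟩ := (A.coarse.mem_iff x).1 hx
  obtain ⟨s, hs, a, ha, rfl⟩ := (A.block i).cover y hy
  refine ⟨_, ⟨i, s, hs, rfl⟩, ?_⟩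
  rw [← sum_smul_blockPoint]
  rw [A.sum_coord i hs] at h1
  refine (convex_convexHull ℝ _).sum_mem ha h1 fun v hv => subset_convexHull ℝ _ ?_
  simpa using ⟨v, hv, rfl⟩

lemma acute (A : IsAssembly p P X supp β g) (i : ι) {s : Finset ℕ} (hs : s ∈ X.faces) {a b c d : ℕ}
    (ha : a ∈ s) (hb : b ∈ s) (hc : c ∈ s) (hd : d ∈ s) (hab : a ≠ b) (hac : a ≠ c) (had : a ≠ d)
    (hbc : b ≠ c) (hbd : b ≠ d) (hcd : c ≠ d) :
    dihedralAngle (blockPoint (p i) (β i) a) (blockPoint (p i) (β i) b)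
      (blockPoint (p i) (β i) c) (blockPoint (p i) (β i) d) < Real.pi / 2 := by
  obtain ⟨κ, hκ, hm⟩ := A.metric i
  have hsub : ∀ v, blockPoint (p i) (β i) v - blockPoint (p i) (β i) a =
      ∑ k, (β i v - β i a) k • point (p i k) := fun v => by
    simp [blockPoint, sub_smul]
  have hzero : ∀ v ∈ s, ∑ k, (β i v - β i a) k = 0 := fun v hv => by
    simp [(A.block i).sum_one v (singleton_mem_faces hs hv),
      (A.block i).sum_one a (singleton_mem_faces hs ha)]
  refine dihedralAngle_lt_pi_div_two ?_
  rw [hsub b, hsub c, hsub d, hm _ _ (hzero b hb) (hzero c hc), hm _ _ (hzero b hb) (hzero d hd),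
    hm _ _ (hzero b hb) (hzero b hb), hm _ _ (hzero c hc) (hzero d hd)]
  have := mul_lt_mul_of_pos_left
    ((A.block i).acute s hs a ha b hb c hc d hd hab hac had hbc hbd hcd) (mul_pos hκ hκ)
  linarith

lemma isAcuteTriangulation [Finite ι] (A : IsAssembly p P X supp β g) (hfin : X.faces.Finite)
    (hpure : ∀ s ∈ X.faces, ∃ t ∈ X.faces, s ⊆ t ∧ t.card = 4) :
    IsAcuteTriangulation A.complex P := by
  classical
  refine ⟨?_, ?_, ?_, ?_⟩
  · have : A.faces ⊆ ⋃ i, (fun s : Finset ℕ => s.image (blockPoint (p i) (β i))) '' X.faces := by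
      rintro s ⟨i, s, hs, rfl⟩
      exact Set.mem_iUnion.2 ⟨i, s, hs, by congr⟩
    exact (Set.finite_iUnion fun i => hfin.image _).subset this
  · ext x
    rw [Geometry.SimplicialComplex.mem_space_iff]
    exact ⟨fun ⟨s, hs, hx⟩ => A.mem_of_mem_convexHull hs hx, A.exists_mem_convexHull⟩
  · rintro s ⟨i, s, hs, rfl⟩
    obtain ⟨t, ht, hst, hcard⟩ := hpure s hs
    exact ⟨_, ⟨i, t, ht, rfl⟩, Finset.image_subset_image hst, by
      rw [Finset.card_image_of_injOn (A.injOn_blockPoint_face i ht), hcard]⟩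
  · rintro t ⟨i, s, hs, rfl⟩ - a ha b hb c hc d hd hab hac had hbc hbd hcd
    simp only [Finset.mem_image] at ha hb hc hd
    obtain ⟨a, ha, rfl⟩ := ha
    obtain ⟨b, hb, rfl⟩ := hb
    obtain ⟨c, hc, rfl⟩ := hc
    obtain ⟨d, hd, rfl⟩ := hd
    exact A.acute i hs ha hb hc hd (ne_of_apply_ne _ hab) (ne_of_apply_ne _ hac)
      (ne_of_apply_ne _ had) (ne_of_apply_ne _ hbc) (ne_of_apply_ne _ hbd) (ne_of_apply_ne _ hcd)

end IsAssembly

/-! ### Images of complexes under maps that are injective on vertices -/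

lemma CombinatoriallyEquivalent.refl {α : Type*} (K : PreAbstractSimplicialComplex α) :
    CombinatoriallyEquivalent K K :=
  ⟨Equiv.refl _, fun s => by
    have : s.map (Equiv.refl {v : α // {v} ∈ K.faces}).toEmbedding = s := Finset.map_refl
    rw [this]⟩

lemma CombinatoriallyEquivalent.symm {α β : Type*} {K : PreAbstractSimplicialComplex α}
    {L : PreAbstractSimplicialComplex β} (h : CombinatoriallyEquivalent K L) :
    CombinatoriallyEquivalent L K := by
  obtain ⟨e, he⟩ := h
  refine ⟨e.symm, fun s => ?_⟩
  rw [he, Finset.map_map (f := e.symm.toEmbedding)]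
  have : e.symm.toEmbedding.trans e.toEmbedding = Function.Embedding.refl _ := by
    ext x; simp
  rw [this, Finset.map_refl]

lemma CombinatoriallyEquivalent.trans {α β γ : Type*} {K : PreAbstractSimplicialComplex α}
    {L : PreAbstractSimplicialComplex β} {M : PreAbstractSimplicialComplex γ}
    (h : CombinatoriallyEquivalent K L) (h' : CombinatoriallyEquivalent L M) :
    CombinatoriallyEquivalent K M := by
  obtain ⟨e, he⟩ := h
  obtain ⟨e', he'⟩ := h'
  refine ⟨e.trans e', fun s => ?_⟩
  rw [he, he', Finset.map_map (f := e.toEmbedding)]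
  rfl

section Image

variable {α β : Type*} [DecidableEq β] {K : PreAbstractSimplicialComplex α}
  {L : PreAbstractSimplicialComplex β} {f : α → β}

lemma image_subset_image_iff_of_faces (hf : Set.InjOn f {v | {v} ∈ K.faces}) {s t : Finset α}
    (hs : s ∈ K.faces) (ht : t ∈ K.faces) : s.image f ⊆ t.image f ↔ s ⊆ t := by
  refine ⟨fun h v hv => ?_, Finset.image_subset_image⟩
  obtain ⟨w, hw, he⟩ := Finset.mem_image.1 (h (Finset.mem_image_of_mem f hv))
  rwa [← hf (singleton_mem_faces ht hw) (singleton_mem_faces hs hv) he]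

lemma card_image_of_faces (hf : Set.InjOn f {v | {v} ∈ K.faces}) {s : Finset α}
    (hs : s ∈ K.faces) : (s.image f).card = s.card :=
  Finset.card_image_of_injOn (hf.mono fun _ hv => singleton_mem_faces hs hv)

lemma combinatoriallyEquivalent_of_image (hf : Set.InjOn f {v | {v} ∈ K.faces})
    (h : L.faces = (fun s : Finset α => s.image f) '' K.faces) : CombinatoriallyEquivalent K L := by
  have hv : ∀ v, {v} ∈ K.faces → {f v} ∈ L.faces := fun v hv => by
    rw [h]; exact ⟨{v}, hv, by simp⟩
  let F : {v : α // {v} ∈ K.faces} → {w : β // {w} ∈ L.faces} := fun v => ⟨f v, hv v v.2⟩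
  have hF : Function.Bijective F := by
    refine ⟨fun v w e => Subtype.ext (hf v.2 w.2 (congrArg Subtype.val e)), fun ⟨w, hw⟩ => ?_⟩
    have hw' := hw
    rw [h] at hw'
    obtain ⟨s, hs, e⟩ := hw'
    obtain ⟨v, hvs⟩ := (K.isRelLowerSet_faces hs).1
    refine ⟨⟨v, singleton_mem_faces hs hvs⟩, Subtype.ext ?_⟩
    have : f v ∈ s.image f := Finset.mem_image_of_mem f hvs
    rw [show s.image f = {w} from e] at this
    exact Finset.mem_singleton.1 this
  refine ⟨Equiv.ofBijective F hF, fun s => ?_⟩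
  have hmap : (s.map (Equiv.ofBijective F hF).toEmbedding).map (Function.Embedding.subtype _) =
      (s.map (Function.Embedding.subtype _)).image f := by
    ext x
    simp only [Finset.mem_map, Finset.mem_image]
    constructor
    · rintro ⟨_, ⟨v, hv, rfl⟩, rfl⟩
      exact ⟨v, ⟨v, hv, rfl⟩, rfl⟩
    · rintro ⟨_, ⟨v, hv, rfl⟩, rfl⟩
      exact ⟨_, ⟨v, hv, rfl⟩, rfl⟩
  rw [hmap, h]
  refine ⟨fun hs => ⟨_, hs, rfl⟩, fun ⟨t, ht, e⟩ => ?_⟩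
  convert ht using 1
  ext v
  constructor
  · intro hvs
    have : f v ∈ t.image f := by
      rw [show t.image f = _ from e]
      exact Finset.mem_image_of_mem f hvs
    obtain ⟨v, -, rfl⟩ := Finset.mem_map.1 hvs
    obtain ⟨w, hw, he⟩ := Finset.mem_image.1 this
    rwa [hf (singleton_mem_faces ht hw) v.2 he] at hw
  · intro hvt
    have : f v ∈ (s.map (Function.Embedding.subtype _)).image f := by
      rw [← show t.image f = _ from e]
      exact Finset.mem_image_of_mem f hvt
    obtain ⟨w, hw, he⟩ := Finset.mem_image.1 this
    have hw' : {w} ∈ K.faces := by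
      obtain ⟨w, -, rfl⟩ := Finset.mem_map.1 hw
      exact w.2
    rwa [hf hw' (singleton_mem_faces ht hvt) he] at hw

lemma boundaryFaces_of_image (hf : Set.InjOn f {v | {v} ∈ K.faces})
    (h : L.faces = (fun s : Finset α => s.image f) '' K.faces) :
    boundaryFaces L = (fun s : Finset α => s.image f) '' boundaryFaces K := by
  have hex : ∀ r ∈ K.faces, (∃! t : Finset β, t ∈ L.faces ∧ t.card = 4 ∧ r.image f ⊆ t) ↔
      ∃! t : Finset α, t ∈ K.faces ∧ t.card = 4 ∧ r ⊆ t := by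
    intro r hr
    rw [h]
    constructor
    · rintro ⟨_, ⟨⟨t, ht, rfl⟩, hc, hrt⟩, hu⟩
      refine ⟨t, ⟨ht, by rwa [← card_image_of_faces hf ht],
        (image_subset_image_iff_of_faces hf hr ht).1 hrt⟩, fun t' ⟨ht', hc', hrt'⟩ => ?_⟩
      have := hu (t'.image f) ⟨⟨t', ht', rfl⟩, by rwa [card_image_of_faces hf ht'],
        Finset.image_subset_image hrt'⟩
      exact Finset.Subset.antisymm ((image_subset_image_iff_of_faces hf ht' ht).1 this.le)
        ((image_subset_image_iff_of_faces hf ht ht').1 this.ge)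
    · rintro ⟨t, ⟨ht, hc, hrt⟩, hu⟩
      refine ⟨t.image f, ⟨⟨t, ht, rfl⟩, by rwa [card_image_of_faces hf ht],
        Finset.image_subset_image hrt⟩, ?_⟩
      rintro _ ⟨⟨t', ht', rfl⟩, hc', hrt'⟩
      have := hu t' ⟨ht', by rwa [← card_image_of_faces hf ht'],
        (image_subset_image_iff_of_faces hf hr ht').1 hrt'⟩
      simp only [this]
  ext s
  constructor
  · rintro ⟨hs, r, hr, hc, hsr, hu⟩
    rw [h] at hs hr
    obtain ⟨s, hs, rfl⟩ := hs
    obtain ⟨r, hr, rfl⟩ := hr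
    exact ⟨s, ⟨hs, r, hr, by rwa [← card_image_of_faces hf hr],
      (image_subset_image_iff_of_faces hf hs hr).1 hsr, (hex r hr).1 hu⟩, rfl⟩
  · rintro ⟨s, ⟨hs, r, hr, hc, hsr, hu⟩, rfl⟩
    exact ⟨by rw [h]; exact ⟨s, hs, rfl⟩, r.image f, by rw [h]; exact ⟨r, hr, rfl⟩,
      by rwa [card_image_of_faces hf hr], Finset.image_subset_image hsr, (hex r hr).2 hu⟩

lemma image_generatedComplex_faces (F : Set (Finset α)) :
    (fun s : Finset α => s.image f) '' (generatedComplex F).faces =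
      (generatedComplex ((fun s : Finset α => s.image f) '' F)).faces := by
  ext s
  constructor
  · rintro ⟨s, ⟨hs, t, ht, hst⟩, rfl⟩
    exact ⟨hs.image f, _, ⟨t, ht, rfl⟩, Finset.image_subset_image hst⟩
  · rintro ⟨hs, _, ⟨t, ht, rfl⟩, hst⟩
    obtain ⟨s', hst', rfl⟩ := Finset.subset_image_iff.1 hst
    exact ⟨s', ⟨Finset.image_nonempty.1 hs, t, ht, hst'⟩, rfl⟩

end Image

/-! ### The assembled complex is a special subdivision -/

namespace IsAssembly

variable {ι : Type*} {p : ι → Fin 4 → Fin 3 → ℤ} {P : Set (EuclideanSpace ℝ (Fin 3))}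
  {X : PreAbstractSimplicialComplex ℕ} {supp : ℕ → Finset (Fin 4)} {β : ι → ℕ → Fin 4 → ℝ}
  {g : ι → Fin 4 → ℝ}

open Classical in
/-- The vertices of the simplex of the coarse triangulation whose interior contains the vertex `x`
of the subdivision. -/
noncomputable def carrier (_ : IsAssembly p P X supp β g) (x : EuclideanSpace ℝ (Fin 3)) :
    Finset (Fin 3 → ℤ) :=
  if h : ∃ q : ι × ℕ, {q.2} ∈ X.faces ∧ blockPoint (p q.1) (β q.1) q.2 = x then
    (supp h.choose.2).image (p h.choose.1) else ∅

open Classical in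
lemma carrier_blockPoint (A : IsAssembly p P X supp β g) (i : ι) {v : ℕ} (hv : {v} ∈ X.faces) :
    A.carrier (blockPoint (p i) (β i) v) = (supp v).image (p i) := by
  have h : ∃ q : ι × ℕ, {q.2} ∈ X.faces ∧
      blockPoint (p q.1) (β q.1) q.2 = blockPoint (p i) (β i) v := ⟨(i, v), hv, rfl⟩
  unfold carrier
  rw [dif_pos h]
  obtain ⟨h1, h2⟩ := A.eq_of_blockPoint_eq h.choose_spec.1 hv h.choose_spec.2
  rw [h1]
  exact Finset.image_congr h2

open Classical in
/-- The part of the subdivision that lies in a face of the `i`-th 3-simplex is the image of the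
corresponding part of the model `X`. -/
lemma subdivisionOf_faces (A : IsAssembly p P X supp β g) (i : ι) (J : Finset (Fin 4)) :
    (subdivisionOf A.complex.toPreAbstractSimplicialComplex A.carrier (J.image (p i))).faces =
      (fun s : Finset ℕ => s.image (blockPoint (p i) (β i))) '' (subdivisionOf X supp J).faces := by
  ext s
  constructor
  · rintro ⟨⟨j, s, hs, rfl⟩, hc⟩
    have key : ∀ v ∈ s, ∀ k ∈ supp v, k ∈ J ∧ p i k = p j k := by
      intro v hv k hk
      have h1 := hc _ (Finset.mem_image_of_mem _ hv)
      rw [A.carrier_blockPoint j (singleton_mem_faces hs hv)] at h1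
      obtain ⟨l, hl, e⟩ := Finset.mem_image.1 (h1 (Finset.mem_image_of_mem _ hk))
      obtain rfl := A.coarse.colour _ _ _ _ e
      exact ⟨hl, e⟩
    refine ⟨s, ⟨hs, fun v hv k hk => (key v hv k hk).1⟩, ?_⟩
    refine Finset.image_congr fun v hv => ?_
    exact A.blockPoint_congr (singleton_mem_faces hs hv) fun k hk => (key v hv k hk).2
  · rintro ⟨s, ⟨hs, hJ⟩, rfl⟩
    refine ⟨⟨i, s, hs, rfl⟩, fun x hx => ?_⟩
    obtain ⟨v, hv, rfl⟩ := Finset.mem_image.1 hx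
    rw [A.carrier_blockPoint i (singleton_mem_faces hs hv)]
    exact Finset.image_subset_image (hJ v hv)

open Classical in
theorem isSpecialSubdivision (A : IsAssembly p P X supp β g)
    (hX : IsSpecialSubdivisionWith (generatedComplex {(Finset.univ : Finset (Fin 4))}) X supp) :
    IsSpecialSubdivision (generatedComplex {t | ∃ i, t = Finset.univ.image (p i)})
      A.complex.toPreAbstractSimplicialComplex := by
  have hpi : ∀ i, Function.Injective (p i) := fun i k l h => A.coarse.colour i i k l h
  have hΔ : ∀ J : Finset (Fin 4), J.Nonempty →
      J ∈ (generatedComplex {(Finset.univ : Finset (Fin 4))}).faces :=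
    fun J hJ => ⟨hJ, Finset.univ, rfl, Finset.subset_univ J⟩
  have hinj : ∀ i, Set.InjOn (blockPoint (p i) (β i)) {v | {v} ∈ X.faces} := A.injOn_blockPoint
  have hinj' : ∀ i J, Set.InjOn (blockPoint (p i) (β i))
      {v | {v} ∈ (subdivisionOf X supp J).faces} := fun i J => (hinj i).mono fun v hv => hv.1
  have hgen : ∀ i (J : Finset (Fin 4)) (F : Set (Finset ℕ)), subdivisionOf X supp J =
      generatedComplex F → subdivisionOf A.complex.toPreAbstractSimplicialComplex A.carrier
        (J.image (p i)) = generatedComplex ((fun s => s.image (blockPoint (p i) (β i))) '' F) := by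
    intro i J F h
    apply PreAbstractSimplicialComplex.ext
    rw [A.subdivisionOf_faces, h, image_generatedComplex_faces]
  have hvert : ∀ (J : Finset (Fin 4)) (F : Set (Finset ℕ)), subdivisionOf X supp J =
      generatedComplex F → ∀ s ∈ F, ∀ v ∈ s, {v} ∈ X.faces := by
    intro J F h s hs v hv
    have : {v} ∈ (generatedComplex F).faces :=
      ⟨Finset.singleton_nonempty v, s, hs, Finset.singleton_subset_iff.2 hv⟩
    rw [← h] at this
    exact this.1
  have htop : ∀ t ∈ (generatedComplex {t | ∃ i, t = Finset.univ.image (p i)}).faces, t.card = 4 →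
      ∃ i, t = Finset.univ.image (p i) := by
    rintro t ⟨-, _, ⟨i, rfl⟩, ht⟩ hcard
    refine ⟨i, Finset.eq_of_subset_of_card_le ht ?_⟩
    rw [Finset.card_image_of_injective _ (hpi i), hcard]
    simp
  refine ⟨A.carrier, ?_, ?_, ?_, ?_, ?_, ?_, ?_, ?_⟩
  · rintro t ⟨-, _, ⟨i, rfl⟩, ht⟩
    refine (Finset.card_le_card ht).trans (Finset.card_image_le.trans ?_)
    simp
  · rintro x ⟨i, s, hs, e⟩
    obtain ⟨v, hv, rfl⟩ := Finset.mem_image.1 (e ▸ Finset.mem_singleton_self x)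
    rw [A.carrier_blockPoint i (singleton_mem_faces hs hv)]
    exact ⟨(hX.carrier_mem v (singleton_mem_faces hs hv)).1.image _, _, ⟨i, rfl⟩,
      Finset.image_subset_image (Finset.subset_univ _)⟩
  · rintro s ⟨i, s, hs, rfl⟩
    refine ⟨Finset.univ.image (p i), ⟨Finset.univ_nonempty.image _, _, ⟨i, rfl⟩, subset_rfl⟩,
      fun x hx => ?_⟩
    obtain ⟨v, hv, rfl⟩ := Finset.mem_image.1 hx
    rw [A.carrier_blockPoint i (singleton_mem_faces hs hv)]
    exact Finset.image_subset_image (Finset.subset_univ _)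
  · rintro a ⟨-, _, ⟨i, rfl⟩, ha⟩
    obtain ⟨k, -, rfl⟩ := Finset.mem_image.1 (Finset.singleton_subset_iff.1 ha)
    obtain ⟨v, hv⟩ := hX.vertex k (hΔ _ (Finset.singleton_nonempty k))
    refine ⟨blockPoint (p i) (β i) v, ?_⟩
    have := A.subdivisionOf_faces i {k}
    rw [hv, Finset.image_singleton] at this
    simpa using this
  · rintro a b hab ⟨-, _, ⟨i, rfl⟩, h⟩
    simp only [Finset.insert_subset_iff, Finset.singleton_subset_iff, Finset.mem_image,
      Finset.mem_univ, true_and] at h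
    obtain ⟨⟨k, rfl⟩, ⟨l, rfl⟩⟩ := h
    obtain ⟨v, m, w, hv, hw, hm, he⟩ := hX.edge k l (ne_of_apply_ne _ hab)
      (hΔ _ (Finset.insert_nonempty _ _))
    have hx := hvert _ _ he
    refine ⟨blockPoint (p i) (β i) v, blockPoint (p i) (β i) m, blockPoint (p i) (β i) w,
      ?_, ?_, ?_, ?_⟩
    · rw [A.carrier_blockPoint i (hx {v, m} (by simp) v (by simp)), hv, Finset.image_singleton]
    · rw [A.carrier_blockPoint i (hx {m, w} (by simp) w (by simp)), hw, Finset.image_singleton]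
    · rw [A.carrier_blockPoint i (hx {v, m} (by simp) m (by simp)), hm, Finset.image_insert,
        Finset.image_singleton]
    · have := hgen i _ _ he
      simpa only [Finset.image_insert, Finset.image_singleton, Set.image_insert_eq,
        Set.image_singleton] using this
  · rintro a b c hab hbc hac ⟨-, _, ⟨i, rfl⟩, h⟩
    simp only [Finset.insert_subset_iff, Finset.singleton_subset_iff, Finset.mem_image,
      Finset.mem_univ, true_and] at h
    obtain ⟨⟨ka, rfl⟩, ⟨kb, rfl⟩, ⟨kc, rfl⟩⟩ := h
    obtain ⟨va, vb, vc, mab, mbc, mca, qa, qb, qc, ha, hb, hc, hmab, hmbc, hmca, hqa, hqb, hqc,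
      nab, nbc, nac, he⟩ := hX.triangle ka kb kc (ne_of_apply_ne _ hab) (ne_of_apply_ne _ hbc)
      (ne_of_apply_ne _ hac) (hΔ _ (Finset.insert_nonempty _ _))
    have hx := hvert _ _ he
    have xa := hx {va, mab, qa} (by simp) va (by simp)
    have xb := hx {vb, mbc, qb} (by simp) vb (by simp)
    have xc := hx {vc, mca, qc} (by simp) vc (by simp)
    have xmab := hx {va, mab, qa} (by simp) mab (by simp)
    have xmbc := hx {vb, mbc, qb} (by simp) mbc (by simp)
    have xmca := hx {vc, mca, qc} (by simp) mca (by simp)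
    have xqa := hx {va, mab, qa} (by simp) qa (by simp)
    have xqb := hx {vb, mbc, qb} (by simp) qb (by simp)
    have xqc := hx {vc, mca, qc} (by simp) qc (by simp)
    refine ⟨blockPoint (p i) (β i) va, blockPoint (p i) (β i) vb, blockPoint (p i) (β i) vc,
      blockPoint (p i) (β i) mab, blockPoint (p i) (β i) mbc, blockPoint (p i) (β i) mca,
      blockPoint (p i) (β i) qa, blockPoint (p i) (β i) qb, blockPoint (p i) (β i) qc,
      ?_, ?_, ?_, ?_, ?_, ?_, ?_, ?_, ?_, (hinj i).ne xqa xqb nab, (hinj i).ne xqb xqc nbc,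
      (hinj i).ne xqa xqc nac, ?_⟩
    · rw [A.carrier_blockPoint i xa, ha, Finset.image_singleton]
    · rw [A.carrier_blockPoint i xb, hb, Finset.image_singleton]
    · rw [A.carrier_blockPoint i xc, hc, Finset.image_singleton]
    · rw [A.carrier_blockPoint i xmab, hmab, Finset.image_insert, Finset.image_singleton]
    · rw [A.carrier_blockPoint i xmbc, hmbc, Finset.image_insert, Finset.image_singleton]
    · rw [A.carrier_blockPoint i xmca, hmca, Finset.image_insert, Finset.image_singleton]
    · rw [A.carrier_blockPoint i xqa, hqa, Finset.image_insert, Finset.image_insert,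
        Finset.image_singleton]
    · rw [A.carrier_blockPoint i xqb, hqb, Finset.image_insert, Finset.image_insert,
        Finset.image_singleton]
    · rw [A.carrier_blockPoint i xqc, hqc, Finset.image_insert, Finset.image_insert,
        Finset.image_singleton]
    · have := hgen i _ _ he
      simpa only [subdividedTriangle, Finset.image_insert, Finset.image_singleton,
        Set.image_insert_eq, Set.image_singleton] using this
  · intro t ht hcard
    obtain ⟨i, rfl⟩ := htop t ht hcard
    obtain ⟨σ, hσ, hc, he⟩ := hX.tetrahedron Finset.univ (hΔ _ Finset.univ_nonempty) rfl
    exact ⟨σ, hσ, hc, (combinatoriallyEquivalent_of_image (hinj' i _)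
      (A.subdivisionOf_faces i _)).symm.trans he⟩
  · intro t ht hcard
    obtain ⟨i, rfl⟩ := htop t ht hcard
    rw [boundaryFaces_of_image (hinj' i _) (A.subdivisionOf_faces i _),
      hX.boundary Finset.univ (hΔ _ Finset.univ_nonempty) rfl, Set.image_iUnion₂]
    ext s
    simp only [Set.mem_iUnion, Set.mem_ofPred_eq]
    constructor
    · rintro ⟨J, hJ, hs⟩
      refine ⟨J.image (p i), Finset.image_ssubset_image (hpi i) |>.2 hJ, ?_⟩
      rwa [A.subdivisionOf_faces]
    · rintro ⟨f, hf, hs⟩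
      obtain ⟨J, -, rfl⟩ := Finset.subset_image_iff.1 hf.1
      exact ⟨J, (Finset.image_ssubset_image (hpi i)).1 hf, by rwa [A.subdivisionOf_faces] at hs⟩

/-- An assembly of blocks provides the acute triangulation that is asked for. -/
theorem exists_acuteTriangulation [Finite ι] (A : IsAssembly p P X supp β g)
    (hX : IsSpecialSubdivisionWith (generatedComplex {(Finset.univ : Finset (Fin 4))}) X supp)
    (hfin : X.faces.Finite) (hpure : ∀ s ∈ X.faces, ∃ t ∈ X.faces, s ⊆ t ∧ t.card = 4) :
    ∃ K : Geometry.SimplicialComplex ℝ (EuclideanSpace ℝ (Fin 3)), IsAcuteTriangulation K P ∧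
      ∃ (V : Type) (_ : DecidableEq V) (Xstar : PreAbstractSimplicialComplex V),
        IsSpecialSubdivision (generatedComplex {t | ∃ i, t = Finset.univ.image (p i)}) Xstar ∧
        CombinatoriallyEquivalent K.toPreAbstractSimplicialComplex Xstar :=
  ⟨A.complex, A.isAcuteTriangulation hfin hpure, _, inferInstance,
    A.complex.toPreAbstractSimplicialComplex, A.isSpecialSubdivision hX,
    CombinatoriallyEquivalent.refl _⟩

end IsAssembly

/-! ### The coloured triangulation of the cube -/

lemma sum_smul_point_apply (a : Fin 4 → ℝ) (q : Fin 4 → Fin 3 → ℤ) (j : Fin 3) :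
    (∑ k, a k • point (q k)) j = ∑ k, a k * q k j := by
  simp [point]

lemma sum_smul_point_eq_iff (a : Fin 4 → ℝ) (q : Fin 4 → Fin 3 → ℤ)
    (x : EuclideanSpace ℝ (Fin 3)) :
    ∑ k, a k • point (q k) = x ↔ ∀ j, ∑ k, a k * q k j = x j := by
  refine ⟨fun h j => by rw [← h, sum_smul_point_apply], fun h => ?_⟩
  ext j
  rw [sum_smul_point_apply, h]

lemma inner_sum_smul_point (u u' : Fin 4 → ℝ) (q : Fin 4 → Fin 3 → ℤ) :
    inner ℝ (∑ k, u k • point (q k)) (∑ k, u' k • point (q k)) =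
      ∑ j : Fin 3, (∑ k, u' k * q k j) * (∑ k, u k * q k j : ℝ) := by
  rw [PiLp.inner_apply]
  refine Finset.sum_congr rfl fun j _ => ?_
  rw [sum_smul_point_apply, sum_smul_point_apply]
  rfl

/-- The vertices of the inscribed regular 3-simplex of the cube. -/
def innerVertex : Fin 4 → Fin 3 → ℤ :=
  ![![1, 1, 1], ![-1, -1, 1], ![-1, 1, -1], ![1, -1, -1]]

/-- The coloured triangulation of the cube: the index `none` stands for the inscribed regular
3-simplex, and `some i` for the corner 3-simplex which has `-innerVertex i` in the place of
`innerVertex i`. -/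
def cubeCell : Option (Fin 4) → Fin 4 → Fin 3 → ℤ
  | none => innerVertex
  | some i => Function.update innerVertex i (-innerVertex i)

lemma innerTetrahedron_eq : innerTetrahedron = Finset.univ.image innerVertex := by decide

lemma cubeComplex_eq :
    cubeComplex = generatedComplex {t | ∃ i, t = Finset.univ.image (cubeCell i)} := by
  unfold cubeComplex
  congr 1
  have h : ∀ i : Fin 4, insert (-innerVertex i) (innerTetrahedron.erase (innerVertex i)) =
      Finset.univ.image (cubeCell (some i)) := by decide
  ext t
  constructor
  · rintro (rfl | ⟨x, hx, rfl⟩)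
    · exact ⟨none, innerTetrahedron_eq⟩
    · rw [innerTetrahedron_eq] at hx
      obtain ⟨i, -, rfl⟩ := Finset.mem_image.1 hx
      exact ⟨some i, h i⟩
  · rintro ⟨_ | i, rfl⟩
    · exact Or.inl innerTetrahedron_eq.symm
    · refine Or.inr ⟨innerVertex i, ?_, (h i).symm⟩
      rw [innerTetrahedron_eq]
      exact Finset.mem_image_of_mem _ (Finset.mem_univ i)

lemma exists_cubeCell {x : EuclideanSpace ℝ (Fin 3)} (hx : x ∈ cube3) :
    ∃ i, ∃ a : Fin 4 → ℝ, (∀ k, 0 ≤ a k) ∧ ∑ k, a k = 1 ∧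
      ∑ k, a k • point (cubeCell i k) = x := by
  have hb : ∀ j, -1 ≤ x j ∧ x j ≤ 1 := fun j => abs_le.1 (hx j)
  have h0 := hb 0
  have h1 := hb 1
  have h2 := hb 2
  -- The corner opposite to `innerVertex i` is cut off by the plane on which the product with
  -- `innerVertex i` is `-1`.
  by_cases c0 : x 0 + x 1 + x 2 < -1
  · refine ⟨some 0, ![-(1 + x 0 + x 1 + x 2) / 2, (1 + x 2) / 2, (1 + x 1) / 2, (1 + x 0) / 2],
      ?_, ?_, ?_⟩
    · intro k; fin_cases k <;> simp <;> linarith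
    · simp [Fin.sum_univ_four]; ring
    · rw [sum_smul_point_eq_iff]
      intro j; fin_cases j <;> simp [Fin.sum_univ_four, cubeCell, innerVertex, Function.update] <;> ring
  by_cases c1 : -x 0 - x 1 + x 2 < -1
  · refine ⟨some 1, ![(1 + x 2) / 2, -(1 - x 0 - x 1 + x 2) / 2, (1 - x 0) / 2, (1 - x 1) / 2],
      ?_, ?_, ?_⟩
    · intro k; fin_cases k <;> simp <;> linarith
    · simp [Fin.sum_univ_four]; ring
    · rw [sum_smul_point_eq_iff]
      intro j; fin_cases j <;> simp [Fin.sum_univ_four, cubeCell, innerVertex, Function.update] <;> ring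
  by_cases c2 : -x 0 + x 1 - x 2 < -1
  · refine ⟨some 2, ![(1 + x 1) / 2, (1 - x 0) / 2, -(1 - x 0 + x 1 - x 2) / 2, (1 - x 2) / 2],
      ?_, ?_, ?_⟩
    · intro k; fin_cases k <;> simp <;> linarith
    · simp [Fin.sum_univ_four]; ring
    · rw [sum_smul_point_eq_iff]
      intro j; fin_cases j <;> simp [Fin.sum_univ_four, cubeCell, innerVertex, Function.update] <;> ring
  by_cases c3 : x 0 - x 1 - x 2 < -1
  · refine ⟨some 3, ![(1 + x 0) / 2, (1 - x 1) / 2, (1 - x 2) / 2, -(1 + x 0 - x 1 - x 2) / 2],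
      ?_, ?_, ?_⟩
    · intro k; fin_cases k <;> simp <;> linarith
    · simp [Fin.sum_univ_four]; ring
    · rw [sum_smul_point_eq_iff]
      intro j; fin_cases j <;> simp [Fin.sum_univ_four, cubeCell, innerVertex, Function.update] <;> ring
  · refine ⟨none, ![(1 + x 0 + x 1 + x 2) / 4, (1 - x 0 - x 1 + x 2) / 4,
      (1 - x 0 + x 1 - x 2) / 4, (1 + x 0 - x 1 - x 2) / 4], ?_, ?_, ?_⟩
    · intro k; fin_cases k <;> simp <;> linarith
    · simp [Fin.sum_univ_four]; ring
    · rw [sum_smul_point_eq_iff]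
      intro j; fin_cases j <;> simp [Fin.sum_univ_four, cubeCell, innerVertex] <;> ring

theorem isColouredTriangulation_cube : IsColouredTriangulation cubeCell cube3 := by
  refine ⟨by decide, by decide, ?_, ?_, fun x => ⟨exists_cubeCell, ?_⟩⟩
  · intro i y hy h
    rw [sum_smul_point_eq_iff] at h
    have e0 := h 0
    have e1 := h 1
    have e2 := h 2
    rcases i with _ | i
    · simp [Fin.sum_univ_four, cubeCell, innerVertex] at hy e0 e1 e2
      funext k; fin_cases k <;> simp <;> linarith
    · fin_cases i <;> simp [Fin.sum_univ_four, cubeCell, innerVertex, Function.update] at hy e0 e1 e2 <;>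
        (funext k; fin_cases k <;> simp <;> linarith)
  · intro i j a a' ha ha' h1 h1' he k hk
    have b0 := ha 0
    have b1 := ha 1
    have b2 := ha 2
    have b3 := ha 3
    have b0' := ha' 0
    have b1' := ha' 1
    have b2' := ha' 2
    have b3' := ha' 3
    rw [sum_smul_point_eq_iff] at he
    have e0 := he 0
    have e1 := he 1
    have e2 := he 2
    rw [sum_smul_point_apply] at e0 e1 e2
    clear he ha ha'
    simp only [Fin.sum_univ_four] at h1 h1' e0 e1 e2
    rcases i with _ | i <;> rcases j with _ | j <;> (try fin_cases i) <;> (try fin_cases j) <;>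
      fin_cases k <;> first
        | exact absurd rfl hk
        | (simp [cubeCell, innerVertex, Function.update] at e0 e1 e2 ⊢; linarith)
  · rintro ⟨i, a, ha, h1, rfl⟩ j
    rw [sum_smul_point_apply, abs_le]
    have b0 := ha 0
    have b1 := ha 1
    have b2 := ha 2
    have b3 := ha 3
    simp only [Fin.sum_univ_four] at h1 ⊢
    rcases i with _ | i <;> (try fin_cases i) <;> fin_cases j <;>
      simp [cubeCell, innerVertex, Function.update] <;> constructor <;> linarith

/-- In barycentric coordinates, the Euclidean metric on a 3-simplex of either shape is a diagonal
form on the vectors of coordinate sum `0`. -/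
lemma inner_cubeCell_none (u u' : Fin 4 → ℝ) (hu : ∑ k, u k = 0) :
    inner ℝ (∑ k, u k • point (cubeCell none k)) (∑ k, u' k • point (cubeCell none k)) =
      4 * diagForm (fun _ => 1) u u' := by
  rw [inner_sum_smul_point]
  simp only [Fin.sum_univ_four, Fin.sum_univ_three, diagForm] at hu ⊢
  simp [cubeCell, innerVertex]
  linear_combination (-(u' 0 + u' 1 + u' 2 + u' 3)) * hu

lemma inner_cubeCell_some (i : Fin 4) (u u' : Fin 4 → ℝ) (hu : ∑ k, u k = 0)
    (hu' : ∑ k, u' k = 0) :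
    inner ℝ (∑ k, u k • point (cubeCell (some i) k)) (∑ k, u' k • point (cubeCell (some i) k)) =
      4 * diagForm (fun k => if k = i then 0 else 1) u u' := by
  rw [inner_sum_smul_point]
  simp only [Fin.sum_univ_four, Fin.sum_univ_three, diagForm] at hu hu' ⊢
  fin_cases i <;> simp [cubeCell, innerVertex, Function.update]
  · linear_combination (2 * u' 0 - (u' 0 + u' 1 + u' 2 + u' 3)) * hu + 2 * u 0 * hu'
  · linear_combination (2 * u' 1 - (u' 0 + u' 1 + u' 2 + u' 3)) * hu + 2 * u 1 * hu'
  · linear_combination (2 * u' 2 - (u' 0 + u' 1 + u' 2 + u' 3)) * hu + 2 * u 2 * hu'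
  · linear_combination (2 * u' 3 - (u' 0 + u' 1 + u' 2 + u' 3)) * hu + 2 * u 3 * hu'

/-! ### The coloured triangulation of the octahedron -/

/-- The coloured triangulation of the octahedron into the cones over its faces. -/
def octahedronCell (ε : Fin 3 → ℤˣ) : Fin 4 → Fin 3 → ℤ :=
  Fin.cons 0 fun i => Pi.single i (ε i : ℤ)

lemma octahedronComplex_eq :
    octahedronComplex = generatedComplex {t | ∃ ε, t = Finset.univ.image (octahedronCell ε)} := by
  have h : ∀ ε : Fin 3 → ℤˣ, ({0, Pi.single 0 (ε 0 : ℤ), Pi.single 1 (ε 1 : ℤ),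
      Pi.single 2 (ε 2 : ℤ)} : Finset (Fin 3 → ℤ)) = Finset.univ.image (octahedronCell ε) := by
    intro ε
    ext x
    simp [Fin.exists_fin_succ, octahedronCell, eq_comm]
  unfold octahedronComplex
  congr 1
  ext t
  constructor
  · rintro ⟨ε, hε, rfl⟩
    have hu : ∀ i, IsUnit (ε i) := fun i => Int.isUnit_iff.2 (hε i)
    refine ⟨fun i => (hu i).unit, ?_⟩
    rw [← h]
    rfl
  · rintro ⟨ε, rfl⟩
    exact ⟨fun i => ε i, fun i => Int.isUnit_iff.1 (ε i).isUnit, (h ε).symm⟩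

lemma sum_octahedronCell (a : Fin 4 → ℝ) (ε : Fin 3 → ℤˣ) (j : Fin 3) :
    ∑ k, a k * (octahedronCell ε k j : ℝ) = a j.succ * ((ε j : ℤ) : ℝ) := by
  rw [Fin.sum_univ_succ]
  simp only [octahedronCell, Fin.cons_zero, Fin.cons_succ, Pi.zero_apply, Int.cast_zero, mul_zero,
    zero_add]
  rw [Finset.sum_eq_single j]
  · rw [Pi.single_eq_same]
  · intro i _ hij
    rw [Pi.single_eq_of_ne' hij, Int.cast_zero, mul_zero]
  · simp

lemma units_cast_mul_self (e : ℤˣ) : ((e : ℤ) : ℝ) * ((e : ℤ) : ℝ) = 1 := by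
  rcases Int.units_eq_one_or e with rfl | rfl <;> simp

lemma abs_units_cast (e : ℤˣ) : |((e : ℤ) : ℝ)| = 1 := by
  rcases Int.units_eq_one_or e with rfl | rfl <;> simp

theorem isColouredTriangulation_octahedron :
    IsColouredTriangulation octahedronCell octahedron3 := by
  have hne : ∀ (e : ℤˣ) (i : Fin 3), (Pi.single i (e : ℤ) : Fin 3 → ℤ) ≠ 0 := fun e i h => by
    have := congrFun h i
    simp at this
  refine ⟨?_, ?_, ?_, ?_, fun x => ⟨fun hx => ?_, ?_⟩⟩
  · intro ε ε' k l h
    refine Fin.cases ?_ (fun k => ?_) k h <;> refine Fin.cases ?_ (fun l => ?_) l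
    · simp
    · intro h
      exact absurd h.symm (hne _ _)
    · intro h
      exact absurd h (hne _ _)
    · intro h
      by_contra hkl
      have := congrFun (show (Pi.single k (ε k : ℤ) : Fin 3 → ℤ) = Pi.single l (ε' l : ℤ) from h) k
      rw [Pi.single_eq_same, Pi.single_eq_of_ne (fun e => hkl (by rw [e]))] at this
      exact (ε k).ne_zero this
  · intro ε ε' h
    funext i
    have := congrFun (show (Pi.single i (ε i : ℤ) : Fin 3 → ℤ) = Pi.single i (ε' i : ℤ) from
      congrFun h i.succ) i
    rw [Pi.single_eq_same, Pi.single_eq_same] at this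
    exact Units.ext this
  · intro ε y hy h
    rw [sum_smul_point_eq_iff] at h
    have hs : ∀ j : Fin 3, y j.succ = 0 := fun j => by
      have := h j
      rw [sum_octahedronCell] at this
      rcases mul_eq_zero.1 this with h0 | h0
      · exact h0
      · exact absurd (by exact_mod_cast h0) (ε j).ne_zero
    funext k
    refine Fin.cases ?_ hs k
    rw [Fin.sum_univ_succ, Finset.sum_eq_zero fun j _ => hs j, add_zero] at hy
    exact hy
  · intro ε ε' a a' ha ha' h1 h1' he k
    refine Fin.cases (fun h => absurd rfl h) (fun k hk => ?_) k
    rw [sum_smul_point_eq_iff] at he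
    have e := he k
    rw [sum_smul_point_apply, sum_octahedronCell, sum_octahedronCell] at e
    have hsign : ε k ≠ ε' k := fun h => hk (by simp [octahedronCell, h])
    have h2 := ha k.succ
    have h3 := ha' k.succ
    rcases Int.units_eq_one_or (ε k) with h4 | h4 <;>
      rcases Int.units_eq_one_or (ε' k) with h5 | h5 <;> rw [h4, h5] at e hsign <;>
      first
        | exact absurd rfl hsign
        | (push_cast [Units.val_neg, Units.val_one] at e; linarith)
  · have hx' : ∑ i, |x i| ≤ 1 := hx
    let ε : Fin 3 → ℤˣ := fun i => if 0 ≤ x i then 1 else -1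
    refine ⟨ε, Fin.cons (1 - ∑ i, |x i|) fun i => |x i|, ?_, ?_, ?_⟩
    · intro k
      refine Fin.cases ?_ (fun k => ?_) k
      · simpa using hx'
      · simp
    · rw [Fin.sum_univ_succ]
      simp
    · rw [sum_smul_point_eq_iff]
      intro j
      rw [sum_octahedronCell]
      by_cases h : 0 ≤ x j
      · simp [ε, h, abs_of_nonneg h]
      · simp [ε, h, abs_of_neg (not_le.1 h)]
  · rintro ⟨ε, a, ha, h1, rfl⟩
    change ∑ i, |(∑ k, a k • point (octahedronCell ε k)) i| ≤ 1
    simp only [sum_smul_point_apply, sum_octahedronCell, abs_mul, abs_units_cast, mul_one]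
    rw [Fin.sum_univ_succ] at h1
    rw [Finset.sum_congr rfl fun i _ => abs_of_nonneg (ha (Fin.succ i))]
    linarith [ha 0]

lemma inner_octahedronCell (ε : Fin 3 → ℤˣ) (u u' : Fin 4 → ℝ) :
    inner ℝ (∑ k, u k • point (octahedronCell ε k)) (∑ k, u' k • point (octahedronCell ε k)) =
      1 * diagForm (fun k => if k = 0 then 0 else 1) u u' := by
  rw [inner_sum_smul_point, diagForm, Fin.sum_univ_succ (n := 3), if_pos rfl, zero_mul, zero_mul,
    zero_add, one_mul]
  simp only [sum_octahedronCell]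
  refine Finset.sum_congr rfl fun j _ => ?_
  rw [if_neg (Fin.succ_ne_zero j)]
  linear_combination u j.succ * u' j.succ * units_cast_mul_self (ε j)

/-! ### The complex `X₅₄₃` with numbered vertices -/

/-- A 3-simplex with numbered vertices, listed in the order of a positive orientation. -/
abbrev Cell := ℕ × ℕ × ℕ × ℕ

namespace Cell

/-- The vertices of a cell as a tuple. -/
def vtx (c : Cell) : Fin 4 → ℕ := ![c.1, c.2.1, c.2.2.1, c.2.2.2]

/-- The vertices of a cell as a set. -/
def verts (c : Cell) : Finset ℕ := {c.1, c.2.1, c.2.2.1, c.2.2.2}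

/-- Whether `v` is a vertex of the cell. -/
def has : Cell → ℕ → Bool
  | (a, b, c, d), v => Nat.beq v a || Nat.beq v b || Nat.beq v c || Nat.beq v d

end Cell

/-- The 3-simplices of `X₅₄₃`. The vertices `0, …, 3` are the corners of the subdivided 3-simplex,
`4, …, 9` lie on its edges `01`, `02`, `03`, `12`, `13`, `23`, and `10, …, 21` in its 2-faces `012`,
`013`, `023`, `123`, where the three vertices of a 2-face are next to its corners in this order. -/
def cellList : List Cell :=
  [(0,4,10,69), (0,4,69,13), (0,5,65,10), (0,5,16,65), (0,6,13,23), (0,6,23,16), (0,10,65,69),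
   (0,13,69,23), (0,16,23,65), (0,23,69,65), (1,4,88,11), (1,4,14,88), (1,7,11,33), (1,7,33,19),
   (1,8,76,14), (1,8,19,76), (1,11,88,33), (1,14,76,88), (1,19,33,76), (1,33,88,76), (2,5,12,87),
   (2,5,87,17), (2,7,30,12), (2,7,20,30), (2,9,17,75), (2,9,75,20), (2,12,30,87), (2,17,87,75),
   (2,20,75,30), (2,30,75,87), (3,6,101,15), (3,6,18,101), (3,8,15,98), (3,8,98,21), (3,9,95,18),
   (3,9,21,95), (3,15,101,98), (3,18,95,101), (3,21,98,95), (3,95,98,101), (4,10,110,11),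
   (4,10,69,110), (4,11,110,88), (4,13,14,80), (4,13,80,69), (4,14,88,80), (4,69,80,110),
   (4,80,88,110), (5,10,12,108), (5,10,108,65), (5,12,87,108), (5,16,79,17), (5,16,65,79),
   (5,17,79,87), (5,65,108,79), (5,79,108,87), (6,13,71,15), (6,13,23,71), (6,15,71,101),
   (6,16,18,67), (6,16,67,23), (6,18,101,67), (6,23,67,71), (6,67,101,71), (7,11,102,12),
   (7,11,33,102), (7,12,102,30), (7,19,20,53), (7,19,53,33), (7,20,30,53), (7,30,102,53),
   (7,33,53,102), (8,14,15,90), (8,14,90,76), (8,15,98,90), (8,19,39,21), (8,19,76,39),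
   (8,21,39,98), (8,39,76,90), (8,39,90,98), (9,17,89,18), (9,17,75,89), (9,18,89,95),
   (9,20,21,36), (9,20,36,75), (9,21,95,36), (9,36,89,75), (9,36,95,89), (10,11,12,27),
   (10,11,27,110), (10,12,108,27), (10,27,108,104), (10,27,104,110), (10,65,69,104),
   (10,65,104,108), (10,69,110,104), (11,12,27,102), (11,27,114,102), (11,27,110,114),
   (11,33,114,88), (11,33,102,114), (11,88,114,110), (12,27,102,112), (12,27,112,108),
   (12,30,87,112), (12,30,112,102), (12,87,108,112), (13,14,84,15), (13,14,80,84), (13,15,84,71),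
   (13,23,63,69), (13,23,71,63), (13,63,80,69), (13,63,71,84), (13,63,84,80), (14,15,90,84),
   (14,26,76,88), (14,26,90,76), (14,26,80,84), (14,26,88,80), (14,26,84,90), (15,71,111,84),
   (15,71,101,111), (15,84,111,90), (15,90,111,98), (15,98,111,101), (16,17,18,83), (16,17,83,79),
   (16,18,67,83), (16,23,65,61), (16,23,61,67), (16,61,65,79), (16,61,83,67), (16,61,79,83),
   (17,18,83,89), (17,25,87,75), (17,25,75,89), (17,25,83,79), (17,25,79,87), (17,25,89,83),
   (18,67,83,109), (18,67,109,101), (18,83,89,109), (18,89,95,109), (18,95,101,109),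
   (19,20,56,21), (19,20,53,56), (19,21,56,39), (19,33,60,53), (19,33,76,60), (19,39,56,60),
   (19,39,60,76), (19,53,60,56), (20,21,36,56), (20,30,53,59), (20,30,59,75), (20,36,59,56),
   (20,36,75,59), (20,53,56,59), (21,36,56,103), (21,36,103,95), (21,39,103,56), (21,39,98,103),
   (21,95,103,98), (22,41,49,43), (22,41,43,50), (22,41,47,45), (22,41,45,49), (22,41,50,47),
   (22,42,44,51), (22,42,52,44), (22,42,45,47), (22,42,51,45), (22,42,47,52), (22,43,46,48),
   (22,43,49,46), (22,43,48,50), (22,44,48,46), (22,44,46,51), (22,44,52,48), (22,45,51,49),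
   (22,46,49,51), (22,47,50,52), (22,48,52,50), (23,54,61,57), (23,54,57,63), (23,54,65,61),
   (23,54,63,69), (23,54,69,65), (23,57,61,67), (23,57,71,63), (23,57,67,71), (24,53,59,56),
   (24,53,56,60), (24,53,66,59), (24,53,60,70), (24,53,70,66), (24,55,58,62), (24,55,64,58),
   (24,55,62,66), (24,55,70,64), (24,55,66,70), (24,56,59,68), (24,56,72,60), (24,56,68,72),
   (24,58,68,62), (24,58,64,72), (24,58,72,68), (24,59,66,62), (24,59,62,68), (24,60,64,70),
   (24,60,72,64), (25,73,91,77), (25,73,77,93), (25,73,83,79), (25,73,79,91), (25,73,93,83),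
   (25,75,85,81), (25,75,81,87), (25,75,89,85), (25,77,81,85), (25,77,91,81), (25,77,85,93),
   (25,79,87,91), (25,81,91,87), (25,83,93,89), (25,85,89,93), (26,74,78,92), (26,74,94,78),
   (26,74,80,84), (26,74,92,80), (26,74,84,94), (26,76,82,86), (26,76,88,82), (26,76,86,90),
   (26,78,86,82), (26,78,82,92), (26,78,94,86), (26,80,92,88), (26,82,88,92), (26,84,90,94),
   (26,86,94,90), (27,96,104,99), (27,96,99,106), (27,96,108,104), (27,96,106,112),
   (27,96,112,108), (27,99,104,110), (27,99,114,106), (27,99,110,114), (27,102,112,106),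
   (27,102,106,114), (28,95,101,98), (28,95,98,103), (28,95,109,101), (28,95,103,113),
   (28,95,113,109), (28,97,100,105), (28,97,107,100), (28,97,105,109), (28,97,113,107),
   (28,97,109,113), (28,98,101,111), (28,98,115,103), (28,98,111,115), (28,100,111,105),
   (28,100,107,115), (28,100,115,111), (28,101,109,105), (28,101,105,111), (28,103,107,113),
   (28,103,115,107), (29,41,49,45), (29,41,45,73), (29,41,54,49), (29,41,61,54), (29,41,73,61),
   (29,45,49,96), (29,45,91,73), (29,45,96,91), (29,49,54,104), (29,49,104,96), (29,54,61,65),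
   (29,54,65,104), (29,61,79,65), (29,61,73,79), (29,65,79,108), (29,65,108,104), (29,73,91,79),
   (29,79,91,108), (29,91,96,108), (29,96,104,108), (30,53,59,66), (30,53,66,102), (30,59,81,66),
   (30,59,75,81), (30,66,81,112), (30,66,112,102), (30,75,87,81), (30,81,87,112), (31,42,45,51),
   (31,42,77,45), (31,42,51,55), (31,42,55,62), (31,42,62,77), (31,45,96,51), (31,45,77,91),
   (31,45,91,96), (31,51,106,55), (31,51,96,106), (31,55,66,62), (31,55,106,66), (31,62,66,81),
   (31,62,81,77), (31,66,112,81), (31,66,106,112), (31,77,81,91), (31,81,112,91), (31,91,112,96),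
   (31,96,112,106), (32,43,46,49), (32,43,74,46), (32,43,49,54), (32,43,54,63), (32,43,63,74),
   (32,46,99,49), (32,46,74,92), (32,46,92,99), (32,49,104,54), (32,49,99,104), (32,54,69,63),
   (32,54,104,69), (32,63,69,80), (32,63,80,74), (32,69,110,80), (32,69,104,110), (32,74,80,92),
   (32,80,110,92), (32,92,110,99), (32,99,110,104), (33,53,70,60), (33,53,102,70), (33,60,70,82),
   (33,60,82,76), (33,70,114,82), (33,70,102,114), (33,76,82,88), (33,82,114,88), (34,44,51,46),
   (34,44,46,78), (34,44,55,51), (34,44,64,55), (34,44,78,64), (34,46,51,99), (34,46,92,78),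
   (34,46,99,92), (34,51,55,106), (34,51,106,99), (34,55,64,70), (34,55,70,106), (34,64,82,70),
   (34,64,78,82), (34,70,82,114), (34,70,114,106), (34,78,92,82), (34,82,92,114), (34,92,99,114),
   (34,99,106,114), (35,41,47,50), (35,41,73,47), (35,41,50,57), (35,41,57,61), (35,41,61,73),
   (35,47,97,50), (35,47,73,93), (35,47,93,97), (35,50,105,57), (35,50,97,105), (35,57,67,61),
   (35,57,105,67), (35,61,67,83), (35,61,83,73), (35,67,109,83), (35,67,105,109), (35,73,83,93),
   (35,83,109,93), (35,93,109,97), (35,97,109,105), (36,56,68,59), (36,56,103,68), (36,59,68,85),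
   (36,59,85,75), (36,68,113,85), (36,68,103,113), (36,75,85,89), (36,85,113,89), (36,89,113,95),
   (36,95,113,103), (37,42,52,47), (37,42,47,77), (37,42,58,52), (37,42,62,58), (37,42,77,62),
   (37,47,52,97), (37,47,93,77), (37,47,97,93), (37,52,58,107), (37,52,107,97), (37,58,62,68),
   (37,58,68,107), (37,62,85,68), (37,62,77,85), (37,68,85,113), (37,68,113,107), (37,77,93,85),
   (37,85,93,113), (37,93,97,113), (37,97,107,113), (38,43,50,48), (38,43,48,74), (38,43,57,50),
   (38,43,63,57), (38,43,74,63), (38,48,50,100), (38,48,94,74), (38,48,100,94), (38,50,57,105),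
   (38,50,105,100), (38,57,63,71), (38,57,71,105), (38,63,84,71), (38,63,74,84), (38,71,84,111),
   (38,71,111,105), (38,74,94,84), (38,84,94,111), (38,94,100,111), (38,100,105,111),
   (39,56,60,72), (39,56,72,103), (39,60,86,72), (39,60,76,86), (39,72,86,115), (39,72,115,103),
   (39,76,90,86), (39,86,90,115), (39,90,98,115), (39,98,103,115), (40,44,48,52), (40,44,78,48),
   (40,44,52,58), (40,44,58,64), (40,44,64,78), (40,48,100,52), (40,48,78,94), (40,48,94,100),
   (40,52,107,58), (40,52,100,107), (40,58,72,64), (40,58,107,72), (40,64,72,86), (40,64,86,78),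
   (40,72,115,86), (40,72,107,115), (40,78,86,94), (40,86,115,94), (40,94,115,100),
   (40,100,115,107), (41,43,54,49), (41,43,50,57), (41,43,57,54), (41,45,73,47), (41,54,57,61),
   (42,44,51,55), (42,44,58,52), (42,44,55,58), (42,45,47,77), (42,55,62,58), (43,46,48,74),
   (43,54,63,57), (44,46,78,48), (44,55,58,64), (45,47,77,73), (45,49,96,51), (45,73,77,91),
   (46,48,74,78), (46,49,51,99), (46,74,92,78), (47,50,52,97), (47,73,93,77), (48,50,100,52),
   (48,74,78,94), (49,51,99,96), (49,96,99,104), (50,52,97,100), (50,97,105,100), (51,96,106,99),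
   (52,97,100,107), (53,66,102,70), (54,65,104,69), (55,66,70,106), (56,68,72,103),
   (57,67,71,105), (58,68,107,72), (59,62,81,66), (59,62,68,85), (59,62,85,81), (59,75,81,85),
   (60,64,70,82), (60,64,86,72), (60,64,82,86), (60,76,86,82), (61,73,79,83), (62,77,85,81),
   (63,74,84,80), (64,78,82,86), (66,70,106,102), (66,102,106,112), (67,71,105,101),
   (67,101,105,109), (68,72,103,107), (68,103,113,107), (70,102,114,106), (71,101,111,105),
   (72,103,107,115), (79,87,91,108), (80,88,110,92), (81,87,112,91), (82,88,92,114),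
   (83,89,109,93), (84,90,94,111), (85,89,93,113), (86,90,115,94), (87,91,108,112),
   (88,92,114,110), (89,93,113,109), (89,95,109,113), (90,94,111,115), (90,98,115,111),
   (91,96,108,112), (92,99,114,110), (93,97,113,109), (94,100,111,115)]

/-- For each boundary vertex of `X₅₄₃`, the set of the corners of the smallest face of the
subdivided 3-simplex that contains it, encoded by the bits of a number. -/
def supportCodes : List ℕ :=
  [1, 2, 4, 8, 3, 5, 9, 6, 10, 12, 7, 7, 7, 11, 11, 11, 13, 13, 13, 14, 14, 14]

/-- The code of the smallest face that contains the vertex `v`. -/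
def supportCode (v : ℕ) : ℕ := supportCodes.getD v 15

/-- The corners of the smallest face of the subdivided 3-simplex that contains the vertex `v`. -/
def vertexSupport (v : ℕ) : Finset (Fin 4) :=
  Finset.univ.filter fun k => (supportCode v).testBit k

/-- The complex `X₅₄₃` with numbered vertices. -/
def numberedComplex : PreAbstractSimplicialComplex ℕ :=
  generatedComplex {s | ∃ c ∈ cellList, s = c.verts}

/-! ### Barycentric coordinates -/

/-- The barycentric coordinates of a vertex, multiplied by 1000, followed by its height. -/
abbrev Row := ℕ × ℕ × ℕ × ℕ × ℕ

/-- The positions of the vertices in the regular 3-simplex. The heights are squared distances. -/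
def regularTable : List Row :=
  [(1000,0,0,0,1000000), (0,1000,0,0,1000000), (0,0,1000,0,1000000), (0,0,0,1000,1000000),
   (500,500,0,0,500000), (500,0,500,0,500000), (500,0,0,500,500000), (0,500,500,0,500000),
   (0,500,0,500,500000), (0,0,500,500,500000), (440,280,280,0,350400), (280,440,280,0,350400),
   (280,280,440,0,350400), (440,280,0,280,350400), (280,440,0,280,350400), (280,280,0,440,350400),
   (440,0,280,280,350400), (280,0,440,280,350400), (280,0,280,440,350400), (0,440,280,280,350400),
   (0,280,440,280,350400), (0,280,280,440,350400), (271,243,243,243,250588),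
   (416,157,157,270,295254), (180,286,286,248,257496), (254,154,338,254,266992),
   (254,338,154,254,266992), (294,294,294,118,273232), (219,219,219,343,261532),
   (315,204,277,204,259186), (157,270,416,157,295254), (246,246,297,211,253762),
   (315,277,204,204,259186), (157,416,270,157,295254), (246,297,246,211,253762),
   (286,180,248,286,257496), (123,205,336,336,282946), (225,225,275,275,252500),
   (286,248,180,286,257496), (123,336,205,336,282946), (225,275,225,275,252500),
   (297,211,246,246,253762), (243,243,271,243,250588), (297,246,211,246,253762),
   (243,271,243,243,250588), (275,225,275,225,252500), (275,275,225,225,252500),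
   (262,214,262,262,251728), (262,262,214,262,251728), (297,246,246,211,253762),
   (275,225,225,275,252500), (262,262,262,214,251728), (243,243,243,271,250588),
   (123,336,336,205,282946), (343,219,219,219,261532), (225,275,275,225,252500),
   (118,294,294,294,273232), (315,204,204,277,259186), (214,262,262,262,251728),
   (154,254,338,254,266992), (154,338,254,254,266992), (338,154,254,254,266992),
   (211,246,297,246,253762), (338,254,154,254,266992), (211,297,246,246,253762),
   (416,157,270,157,295254), (204,277,315,204,259186), (336,123,205,336,282946),
   (180,248,286,286,257496), (416,270,157,157,295254), (204,315,277,204,259186),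
   (336,205,123,336,282946), (180,286,248,286,257496), (286,180,286,248,257496),
   (286,286,180,248,257496), (157,157,416,270,295254), (157,416,157,270,295254),
   (246,211,297,246,253762), (246,297,211,246,253762), (336,123,336,205,282946),
   (336,336,123,205,282946), (219,219,343,219,261532), (219,343,219,219,261532),
   (294,118,294,294,273232), (294,294,118,294,273232), (204,204,315,277,259186),
   (204,315,204,277,259186), (270,157,416,157,295254), (270,416,157,157,295254),
   (205,123,336,336,282946), (205,336,123,336,282946), (277,204,315,204,259186),
   (277,315,204,204,259186), (248,180,286,286,257496), (248,286,180,286,257496),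
   (157,157,270,416,295254), (286,248,286,180,257496), (246,211,246,297,253762),
   (157,270,157,416,295254), (286,286,248,180,257496), (246,246,211,297,253762),
   (270,157,157,416,295254), (205,336,336,123,282946), (154,254,254,338,266992),
   (338,254,254,154,266992), (277,204,204,315,259186), (248,286,286,180,257496),
   (211,246,246,297,253762), (336,205,336,123,282946), (254,154,254,338,266992),
   (336,336,205,123,282946), (254,254,154,338,266992), (254,254,338,154,266992),
   (204,204,277,315,259186), (254,338,254,154,266992), (204,277,204,315,259186)]

/-- The positions of the vertices in the corner 3-simplex, three edges of which are orthogonal unit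
vectors that start at the vertex with the colour 0. The heights are squared distances. -/
def cornerTable : List Row :=
  [(1000,0,0,0,0), (0,1000,0,0,1000000), (0,0,1000,0,1000000), (0,0,0,1000,1000000),
   (697,303,0,0,91809), (697,0,303,0,91809), (697,0,0,303,91809), (0,500,500,0,500000),
   (0,500,0,500,500000), (0,0,500,500,500000), (642,179,179,0,64082), (462,340,198,0,154804),
   (462,198,340,0,154804), (642,179,0,179,64082), (462,340,0,198,154804), (462,198,0,340,154804),
   (642,0,179,179,64082), (462,0,340,198,154804), (462,0,198,340,154804), (0,440,280,280,350400),
   (0,280,440,280,350400), (0,280,280,440,350400), (415,195,195,195,114075),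
   (588,116,116,180,59312), (288,248,248,216,169664), (392,132,273,203,133162),
   (392,273,132,203,133162), (456,224,224,96,109568), (342,185,185,288,151394),
   (479,156,209,156,92353), (258,225,370,147,209134), (379,201,246,174,131193),
   (479,209,156,156,92353), (258,370,225,147,209134), (379,246,201,174,131193),
   (439,144,193,224,108161), (216,186,299,299,213398), (349,189,231,231,142443),
   (439,193,144,224,108161), (216,299,186,299,213398), (349,231,189,231,142443),
   (452,166,191,191,100518), (375,201,223,201,130531), (452,191,166,191,100518),
   (375,223,201,201,130531), (421,180,219,180,112761), (421,219,180,180,112761),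
   (402,174,212,212,120164), (402,212,174,212,120164), (452,191,191,166,100518),
   (421,180,180,219,112761), (402,212,212,174,120164), (375,201,201,223,130531),
   (216,299,299,186,213398), (505,165,165,165,81675), (349,231,231,189,142443),
   (193,269,269,269,217083), (479,156,156,209,92353), (331,223,223,223,149187),
   (257,222,299,222,187969), (257,299,222,222,187969), (506,122,186,186,84076),
   (328,209,254,209,151878), (506,186,122,186,84076), (328,254,209,209,151878),
   (588,116,180,116,59312), (322,235,271,172,158250), (493,107,158,242,94977),
   (288,216,248,248,169664), (588,180,116,116,59312), (322,271,235,172,158250),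
   (493,158,107,242,94977), (288,248,216,248,169664), (439,144,224,193,108161),
   (439,224,144,193,108161), (258,147,370,225,209134), (258,370,147,225,209134),
   (379,174,246,201,131193), (379,246,174,201,131193), (493,107,242,158,94977),
   (493,242,107,158,94977), (342,185,288,185,151394), (342,288,185,185,151394),
   (456,96,224,224,109568), (456,224,96,224,109568), (322,172,271,235,158250),
   (322,271,172,235,158250), (401,129,341,129,149563), (401,341,129,129,149563),
   (337,115,274,274,163377), (337,274,115,274,163377), (423,162,253,162,116497),
   (423,253,162,162,116497), (385,149,233,233,130779), (385,233,149,233,130779),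
   (258,147,225,370,209134), (439,193,224,144,108161), (379,174,201,246,131193),
   (258,225,147,370,209134), (439,224,193,144,108161), (379,201,174,246,131193),
   (401,129,129,341,149563), (337,274,274,115,163377), (257,222,222,299,187969),
   (506,186,186,122,84076), (423,162,162,253,116497), (385,233,233,149,130779),
   (328,209,209,254,151878), (493,158,242,107,94977), (392,132,203,273,133162),
   (493,242,158,107,94977), (392,203,132,273,133162), (392,203,273,132,133162),
   (322,172,235,271,158250), (392,273,203,132,133162), (322,235,172,271,158250)]

/-! ### Verification of the combinatorial structure -/

/-- The cells that contain the vertex `v`. -/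
def cellsAt (v : ℕ) : List Cell := cellList.filter fun c => c.has v

/-- Whether the three vertices lie in a common proper face of the subdivided 3-simplex. -/
def onBoundary (x y z : ℕ) : Bool :=
  (Nat.lor (supportCode x) (Nat.lor (supportCode y) (supportCode z))).blt 15

/-- Whether a cell other than `xyzw` contains the triangle `xyz`. -/
def hasNeighbour (x y z w : ℕ) : Bool :=
  (cellsAt x).any fun c => c.has y && c.has z && !c.has w

/-- Whether each triangle of the cell either lies on the boundary or has a neighbouring cell, but
not both. -/
def facetsCheck : Cell → Bool
  | (a, b, c, d) =>
    (onBoundary b c d != hasNeighbour b c d a) && (onBoundary a c d != hasNeighbour a c d b) &&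
    (onBoundary a b d != hasNeighbour a b d c) && (onBoundary a b c != hasNeighbour a b c d)

/-- Whether the vertices of the cell are distinct and smaller than 116. -/
def rangeCheck : Cell → Bool
  | (a, b, c, d) => a.blt 116 && b.blt 116 && c.blt 116 && d.blt 116 &&
    !(a.beq b || a.beq c || a.beq d || b.beq c || b.beq d || c.beq d)

/-- The vertex in the interior of the edge `kl` of the subdivided 3-simplex. -/
def edgeVertex : Fin 4 → Fin 4 → ℕ :=
  ![![0, 4, 5, 6], ![4, 1, 7, 8], ![5, 7, 2, 9], ![6, 8, 9, 3]]

/-- The vertex in the interior of the 2-face opposite to the corner `o` which is next to the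
corner `k`. -/
def nearVertex : Fin 4 → Fin 4 → ℕ :=
  ![![0, 19, 20, 21], ![16, 1, 17, 18], ![13, 14, 2, 15], ![10, 11, 12, 3]]

/-- The corner that is not among the distinct corners `a`, `b`, `c`: the sum of all corners is `2`
modulo 4. -/
def otherCorner (a b c : Fin 4) : Fin 4 := -(a + b + c) + 2

/-- The ten triangles that subdivide the 2-face `abc`. -/
def faceTriangles (a b c : Fin 4) : List (List ℕ) :=
  let mab := edgeVertex a b
  let mbc := edgeVertex b c
  let mca := edgeVertex c a
  let qa := nearVertex (otherCorner a b c) a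
  let qb := nearVertex (otherCorner a b c) b
  let qc := nearVertex (otherCorner a b c) c
  [[a, mab, qa], [a, mca, qa], [b, mab, qb], [b, mbc, qb], [c, mbc, qc], [c, mca, qc],
    [mab, qa, qb], [mbc, qb, qc], [mca, qc, qa], [qa, qb, qc]]

/-- Whether the vertex `v` lies in the face with the code `J`. -/
def inFace (J v : ℕ) : Bool := (Nat.lor (supportCode v) J).beq J

/-- Whether the part of the complex in the face with the code `J` is generated by `F`. -/
def faceCheck (J : ℕ) (F : List (List ℕ)) : Bool :=
  (F.all fun t => t.all (inFace J) && cellList.any fun c => t.all c.has) &&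
  cellList.all fun c =>
    let s := [c.1, c.2.1, c.2.2.1, c.2.2.2].filter (inFace J)
    s.isEmpty || F.any fun t => s.all fun v => t.any fun w => v.beq w

/-- The code of a set of corners. -/
def codeOf (J : Finset (Fin 4)) : ℕ := ∑ k ∈ J, 2 ^ (k : ℕ)

lemma cellList_rangeCheck : cellList.all rangeCheck = true := by decide +kernel

lemma cellList_facetsCheck : cellList.all facetsCheck = true := by decide +kernel

lemma faceCheck_vertex : ∀ k : Fin 4, faceCheck (codeOf {k}) [[(k : ℕ)]] = true := by
  decide +kernel

lemma faceCheck_edge : ∀ k l : Fin 4, k ≠ l →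
    faceCheck (codeOf {k, l}) [[(k : ℕ), edgeVertex k l], [edgeVertex k l, (l : ℕ)]] = true := by
  decide +kernel

/-- The corners other than `o` in increasing order. -/
def faceCorners : Fin 4 → Fin 4 × Fin 4 × Fin 4 :=
  ![(1, 2, 3), (0, 2, 3), (0, 1, 3), (0, 1, 2)]

lemma faceCheck_triangle : ∀ o : Fin 4, faceCheck (codeOf (Finset.univ.erase o))
    (faceTriangles (faceCorners o).1 (faceCorners o).2.1 (faceCorners o).2.2) = true := by
  decide +kernel

/-- The subdivision of a 2-face does not depend on the order of its corners. -/
lemma faceTriangles_perm : ∀ a b c : Fin 4, a ≠ b → b ≠ c → a ≠ c →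
    ((faceTriangles (faceCorners (otherCorner a b c)).1 (faceCorners (otherCorner a b c)).2.1
      (faceCorners (otherCorner a b c)).2.2).map List.toFinset).toFinset =
    ((faceTriangles a b c).map List.toFinset).toFinset ∧
    Finset.univ.erase (otherCorner a b c) = {a, b, c} := by
  decide +kernel

/-! ### The numbered complex is a special subdivision of the 3-simplex -/

namespace Cell

lemma has_iff (c : Cell) (v : ℕ) : c.has v = true ↔ v ∈ c.verts := by
  obtain ⟨a, b, c, d⟩ := c
  simp [has, verts, or_assoc]

lemma verts_eq_image (c : Cell) : c.verts = Finset.univ.image c.vtx := by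
  obtain ⟨a, b, c, d⟩ := c
  ext v
  simp [verts, vtx, Fin.exists_fin_succ, eq_comm]

lemma vtx_mem (c : Cell) (i : Fin 4) : c.vtx i ∈ c.verts := by
  rw [verts_eq_image]
  exact Finset.mem_image_of_mem _ (Finset.mem_univ i)

lemma coe_verts (c : Cell) : (c.verts : Set ℕ) = Set.range c.vtx := by
  rw [verts_eq_image]
  simp

end Cell

lemma rangeCheck_of_mem {c : Cell} (hc : c ∈ cellList) : rangeCheck c = true :=
  List.all_eq_true.1 cellList_rangeCheck c hc

lemma vtx_lt {c : Cell} (hc : c ∈ cellList) (i : Fin 4) : c.vtx i < 116 := by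
  have h := rangeCheck_of_mem hc
  obtain ⟨a, b, c, d⟩ := c
  simp only [rangeCheck, Bool.and_eq_true, Nat.blt_eq] at h
  fin_cases i
  · exact h.1.1.1.1
  · exact h.1.1.1.2
  · exact h.1.1.2
  · exact h.1.2

lemma vtx_injective {c : Cell} (hc : c ∈ cellList) : Function.Injective c.vtx := by
  have h := rangeCheck_of_mem hc
  obtain ⟨a, b, c, d⟩ := c
  simp only [rangeCheck, Bool.and_eq_true, Bool.not_eq_eq_eq_not, Bool.not_true,
    Bool.or_eq_false_iff] at h
  have hne : ∀ {x y : ℕ}, x.beq y = false → x ≠ y := fun h e => by simp [e] at h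
  obtain ⟨-, ⟨⟨⟨⟨h1, h2⟩, h3⟩, h4⟩, h5⟩, h6⟩ := h
  have h1 := hne h1
  have h2 := hne h2
  have h3 := hne h3
  have h4 := hne h4
  have h5 := hne h5
  have h6 := hne h6
  intro i j e
  fin_cases i <;> fin_cases j <;> simp_all [Cell.vtx]

lemma card_verts {c : Cell} (hc : c ∈ cellList) : c.verts.card = 4 := by
  rw [Cell.verts_eq_image, Finset.card_image_of_injective _ (vtx_injective hc)]
  simp

lemma mem_numberedComplex {s : Finset ℕ} :
    s ∈ numberedComplex.faces ↔ s.Nonempty ∧ ∃ c ∈ cellList, s ⊆ c.verts := by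
  constructor
  · rintro ⟨hs, _, ⟨c, hc, rfl⟩, h⟩
    exact ⟨hs, c, hc, h⟩
  · rintro ⟨hs, c, hc, h⟩
    exact ⟨hs, _, ⟨c, hc, rfl⟩, h⟩

lemma verts_mem {c : Cell} (hc : c ∈ cellList) : c.verts ∈ numberedComplex.faces :=
  mem_numberedComplex.2 ⟨⟨_, c.vtx_mem 0⟩, c, hc, subset_rfl⟩

lemma lt_of_mem_numberedComplex {v : ℕ} (hv : {v} ∈ numberedComplex.faces) : v < 116 := by
  obtain ⟨-, c, hc, h⟩ := mem_numberedComplex.1 hv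
  rw [Finset.singleton_subset_iff, Cell.verts_eq_image] at h
  obtain ⟨i, -, rfl⟩ := Finset.mem_image.1 h
  exact vtx_lt hc i

lemma supportCode_lt (v : ℕ) : supportCode v < 16 := by
  have h : ∀ x ∈ supportCodes, x < 16 := by decide
  unfold supportCode
  rw [List.getD_eq_getElem?_getD]
  rcases hv : supportCodes[v]? with _ | x
  · simp
  · exact h x (List.mem_of_getElem? hv)

lemma inFace_iff (J : Finset (Fin 4)) (v : ℕ) :
    inFace (codeOf J) v = true ↔ vertexSupport v ⊆ J := by
  have h : ∀ s < 16, ∀ J : Finset (Fin 4), (Nat.lor s (codeOf J)).beq (codeOf J) = true ↔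
      (Finset.univ.filter fun k : Fin 4 => s.testBit k) ⊆ J := by decide +kernel
  exact h _ (supportCode_lt v) J

lemma vertexSupport_nonempty (v : ℕ) : (vertexSupport v).Nonempty := by
  have h : ∀ x ∈ supportCodes, (Finset.univ.filter fun k : Fin 4 => x.testBit k).Nonempty := by
    decide
  unfold vertexSupport supportCode
  rw [List.getD_eq_getElem?_getD]
  rcases hv : supportCodes[v]? with _ | x
  · decide
  · exact h x (List.mem_of_getElem? hv)

lemma onBoundary_iff (x y z : ℕ) : onBoundary x y z = true ↔
    ∃ k, k ∉ vertexSupport x ∧ k ∉ vertexSupport y ∧ k ∉ vertexSupport z := by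
  have h : ∀ s < 16, ∀ t < 16, ∀ u < 16, (Nat.lor s (Nat.lor t u)).blt 15 = true ↔
      ∃ k : Fin 4, s.testBit k = false ∧ t.testBit k = false ∧ u.testBit k = false := by
    decide +kernel
  have := h _ (supportCode_lt x) _ (supportCode_lt y) _ (supportCode_lt z)
  simpa [vertexSupport, onBoundary] using this

lemma hasNeighbour_iff (x y z w : ℕ) : hasNeighbour x y z w = true ↔
    ∃ c ∈ cellList, x ∈ c.verts ∧ y ∈ c.verts ∧ z ∈ c.verts ∧ w ∉ c.verts := by
  simp only [hasNeighbour, cellsAt, List.any_eq_true, List.mem_filter, Bool.and_eq_true,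
    Bool.not_eq_true', Cell.has_iff, ← Bool.not_eq_true]
  constructor
  · rintro ⟨c, ⟨hc, hx⟩, ⟨hy, hz⟩, hw⟩
    exact ⟨c, hc, hx, hy, hz, hw⟩
  · rintro ⟨c, hc, hx, hy, hz, hw⟩
    exact ⟨c, ⟨hc, hx⟩, ⟨hy, hz⟩, hw⟩

/-- Each triangle of a cell either lies in the boundary, or in another cell, but not both. -/
lemma facet_iff {c : Cell} (hc : c ∈ cellList) (i : Fin 4) :
    (∃ k, ∀ j, j ≠ i → k ∉ vertexSupport (c.vtx j)) ↔
      ¬ ∃ c' ∈ cellList, (∀ j, j ≠ i → c.vtx j ∈ c'.verts) ∧ c.vtx i ∉ c'.verts := by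
  have h := List.all_eq_true.1 cellList_facetsCheck c hc
  have key : ∀ x y z w, (onBoundary x y z != hasNeighbour x y z w) = true →
      ((∃ k, k ∉ vertexSupport x ∧ k ∉ vertexSupport y ∧ k ∉ vertexSupport z) ↔
        ¬ ∃ c ∈ cellList, x ∈ c.verts ∧ y ∈ c.verts ∧ z ∈ c.verts ∧ w ∉ c.verts) := by
    intro x y z w h
    rw [← onBoundary_iff, ← hasNeighbour_iff]
    cases h1 : onBoundary x y z <;> cases h2 : hasNeighbour x y z w <;> simp_all
  obtain ⟨a, b, c, d⟩ := c
  simp only [facetsCheck, Bool.and_eq_true] at h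
  obtain ⟨⟨⟨h0, h1⟩, h2⟩, h3⟩ := h
  fin_cases i
  · simpa [Cell.vtx, Fin.forall_fin_succ, and_assoc] using key _ _ _ _ h0
  · simpa [Cell.vtx, Fin.forall_fin_succ, and_assoc] using key _ _ _ _ h1
  · simpa [Cell.vtx, Fin.forall_fin_succ, and_assoc] using key _ _ _ _ h2
  · simpa [Cell.vtx, Fin.forall_fin_succ, and_assoc] using key _ _ _ _ h3

lemma subdivisionOf_numberedComplex {J : Finset (Fin 4)} {F : List (List ℕ)}
    (h : faceCheck (codeOf J) F = true) :
    subdivisionOf numberedComplex vertexSupport J =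
      generatedComplex {s | s ∈ (F.map List.toFinset).toFinset} := by
  simp only [faceCheck, Bool.and_eq_true, List.all_eq_true, List.any_eq_true, inFace_iff,
    Cell.has_iff, Bool.or_eq_true, List.isEmpty_iff, Nat.beq_eq] at h
  obtain ⟨h1, h2⟩ := h
  apply PreAbstractSimplicialComplex.ext
  ext s
  constructor
  · rintro ⟨hs, hJ⟩
    obtain ⟨hne, c, hc, hsc⟩ := mem_numberedComplex.1 hs
    have hmem : ∀ v ∈ s, v ∈ [c.1, c.2.1, c.2.2.1, c.2.2.2].filter
        (inFace (codeOf J)) := fun v hv => by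
      have := hsc hv
      rw [List.mem_filter, inFace_iff]
      exact ⟨by simpa [Cell.verts] using this, hJ v hv⟩
    rcases h2 c hc with h0 | ⟨t, ht, h3⟩
    · obtain ⟨v, hv⟩ := hne
      rw [h0] at hmem
      exact absurd (hmem v hv) List.not_mem_nil
    · refine ⟨hne, t.toFinset, ?_, fun v hv => ?_⟩
      · exact List.mem_toFinset.2 (List.mem_map_of_mem ht)
      · obtain ⟨w, hw, rfl⟩ := h3 v (hmem v hv)
        exact List.mem_toFinset.2 hw
  · rintro ⟨hne, t, ht, hst⟩
    obtain ⟨t, ht', rfl⟩ := List.mem_map.1 (List.mem_toFinset.1 ht)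
    obtain ⟨h3, c, hc, h4⟩ := h1 t ht'
    exact ⟨mem_numberedComplex.2 ⟨hne, c, hc, fun v hv => h4 v (List.mem_toFinset.1 (hst hv))⟩,
      fun v hv => h3 v (List.mem_toFinset.1 (hst hv))⟩

lemma subdivisionOf_vertex (k : Fin 4) :
    subdivisionOf numberedComplex vertexSupport {k} = generatedComplex {{(k : ℕ)}} := by
  rw [subdivisionOf_numberedComplex (faceCheck_vertex k)]
  congr 1
  ext s
  simp

lemma subdivisionOf_edge {k l : Fin 4} (h : k ≠ l) :
    subdivisionOf numberedComplex vertexSupport {k, l} =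
      generatedComplex {{(k : ℕ), edgeVertex k l}, {edgeVertex k l, (l : ℕ)}} := by
  rw [subdivisionOf_numberedComplex (faceCheck_edge k l h)]
  congr 1
  ext s
  simp

lemma subdivisionOf_triangle {a b c : Fin 4} (hab : a ≠ b) (hbc : b ≠ c) (hac : a ≠ c) :
    subdivisionOf numberedComplex vertexSupport {a, b, c} =
      generatedComplex {s | s ∈ ((faceTriangles a b c).map List.toFinset).toFinset} := by
  obtain ⟨h1, h2⟩ := faceTriangles_perm a b c hab hbc hac
  rw [← h1, ← h2]
  exact subdivisionOf_numberedComplex (faceCheck_triangle _)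

lemma subdivisionOf_univ : subdivisionOf numberedComplex vertexSupport Finset.univ =
    numberedComplex := by
  apply PreAbstractSimplicialComplex.ext
  ext s
  exact ⟨fun h => h.1, fun h => ⟨h, fun _ _ => Finset.subset_univ _⟩⟩

lemma vertexSupport_corner : ∀ k : Fin 4, vertexSupport k = {k} := by decide

lemma vertexSupport_edgeVertex : ∀ k l : Fin 4, vertexSupport (edgeVertex k l) = {k, l} := by decide

lemma vertexSupport_nearVertex : ∀ a b c : Fin 4, a ≠ b → b ≠ c → a ≠ c →
    vertexSupport (nearVertex (otherCorner a b c) a) = {a, b, c} ∧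
    vertexSupport (nearVertex (otherCorner a b c) b) = {a, b, c} ∧
    vertexSupport (nearVertex (otherCorner a b c) c) = {a, b, c} ∧
    nearVertex (otherCorner a b c) a ≠ nearVertex (otherCorner a b c) b ∧
    nearVertex (otherCorner a b c) b ≠ nearVertex (otherCorner a b c) c ∧
    nearVertex (otherCorner a b c) a ≠ nearVertex (otherCorner a b c) c := by decide +kernel

/-- The triangles of a subdivided 2-face have three vertices. -/
lemma card_faceTriangles : ∀ a b c : Fin 4, a ≠ b → b ≠ c → a ≠ c →
    ∀ t ∈ faceTriangles a b c, t.toFinset.card = 3 := by decide +kernel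

/-- A triangle that lies in a proper face of the subdivided 3-simplex is contained in exactly one
3-simplex. -/
lemma existsUnique_cell {r : Finset ℕ} (hr : r ∈ numberedComplex.faces) (hcard : r.card = 3) :
    (∃! t : Finset ℕ, t ∈ numberedComplex.faces ∧ t.card = 4 ∧ r ⊆ t) ↔
      ∃ k, ∀ v ∈ r, k ∉ vertexSupport v := by
  obtain ⟨-, c, hc, hrc⟩ := mem_numberedComplex.1 hr
  have hcell : ∀ t ∈ numberedComplex.faces, t.card = 4 → ∃ c ∈ cellList, t = c.verts := by
    intro t ht h4
    obtain ⟨-, c, hc, htc⟩ := mem_numberedComplex.1 ht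
    exact ⟨c, hc, Finset.eq_of_subset_of_card_le htc (by rw [card_verts hc, h4])⟩
  obtain ⟨w, hw, hwr⟩ : ∃ w ∈ c.verts, w ∉ r := by
    by_contra! h
    have := Finset.card_le_card (show c.verts ⊆ r from h)
    rw [card_verts hc, hcard] at this
    omega
  have hr' : r = c.verts.erase w := by
    refine Finset.eq_of_subset_of_card_le (fun v hv => Finset.mem_erase.2 ⟨fun e => hwr (e ▸ hv),
      hrc hv⟩) ?_
    rw [Finset.card_erase_of_mem hw, card_verts hc, hcard]
  rw [Cell.verts_eq_image] at hw
  obtain ⟨i, -, rfl⟩ := Finset.mem_image.1 hw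
  have hmem : ∀ v, v ∈ r ↔ ∃ j, j ≠ i ∧ c.vtx j = v := by
    intro v
    rw [hr', Finset.mem_erase, Cell.verts_eq_image]
    simp only [Finset.mem_image, Finset.mem_univ, true_and]
    constructor
    · rintro ⟨hne, j, rfl⟩
      exact ⟨j, fun e => hne (by rw [e]), rfl⟩
    · rintro ⟨j, hj, rfl⟩
      exact ⟨(vtx_injective hc).ne hj, j, rfl⟩
  have h1 : (∃ k, ∀ v ∈ r, k ∉ vertexSupport v) ↔
      ∃ k, ∀ j, j ≠ i → k ∉ vertexSupport (c.vtx j) := by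
    refine exists_congr fun k => ⟨fun h j hj => h _ ((hmem _).2 ⟨j, hj, rfl⟩), fun h v hv => ?_⟩
    obtain ⟨j, hj, rfl⟩ := (hmem v).1 hv
    exact h j hj
  rw [h1, facet_iff hc i]
  constructor
  · rintro ⟨t, -, hu⟩ ⟨c', hc', hj, hi⟩
    have e1 := hu c.verts ⟨verts_mem hc, card_verts hc, hrc⟩
    have e2 := hu c'.verts ⟨verts_mem hc', card_verts hc', fun v hv => by
      obtain ⟨j, hji, rfl⟩ := (hmem v).1 hv
      exact hj j hji⟩
    rw [e2, ← e1] at hi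
    exact hi (c.vtx_mem i)
  · intro h
    refine ⟨c.verts, ⟨verts_mem hc, card_verts hc, hrc⟩, ?_⟩
    rintro t ⟨ht, h4, hrt⟩
    obtain ⟨c', hc', rfl⟩ := hcell t ht h4
    by_contra hne
    refine h ⟨c', hc', fun j hj => hrt ((hmem _).2 ⟨j, hj, rfl⟩), fun hi => hne ?_⟩
    refine (Finset.eq_of_subset_of_card_le (fun v hv => ?_) ?_).symm
    · rw [Cell.verts_eq_image] at hv
      obtain ⟨j, -, rfl⟩ := Finset.mem_image.1 hv
      by_cases hj : j = i
      · rw [hj]; exact hi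
      · exact hrt ((hmem _).2 ⟨j, hj, rfl⟩)
    · rw [card_verts hc, card_verts hc']

lemma boundaryFaces_numberedComplex :
    boundaryFaces numberedComplex =
      ⋃ f ∈ {f | f ⊂ Finset.univ}, (subdivisionOf numberedComplex vertexSupport f).faces := by
  ext s
  simp only [Set.mem_iUnion, Set.mem_ofPred_eq]
  constructor
  · rintro ⟨hs, r, hr, hcard, hsr, hu⟩
    obtain ⟨k, hk⟩ := (existsUnique_cell hr hcard).1 hu
    refine ⟨Finset.univ.erase k, Finset.erase_ssubset (Finset.mem_univ k), hs, fun v hv l hl => ?_⟩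
    exact Finset.mem_erase.2 ⟨fun e => hk v (hsr hv) (e ▸ hl), Finset.mem_univ l⟩
  · rintro ⟨J, hJ, hs, hsJ⟩
    obtain ⟨k, -, hk⟩ := Finset.exists_of_ssubset hJ
    have hfc : ∀ k : Fin 4, (faceCorners k).1 ≠ (faceCorners k).2.1 ∧
        (faceCorners k).2.1 ≠ (faceCorners k).2.2 ∧ (faceCorners k).1 ≠ (faceCorners k).2.2 := by
      decide
    have heq := subdivisionOf_numberedComplex (faceCheck_triangle k)
    have hmem : s ∈ (subdivisionOf numberedComplex vertexSupport (Finset.univ.erase k)).faces :=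
      ⟨hs, fun v hv l hl => Finset.mem_erase.2 ⟨fun e => hk (e ▸ hsJ v hv hl), Finset.mem_univ l⟩⟩
    rw [heq] at hmem
    obtain ⟨hne, r, hr, hsr⟩ := hmem
    have hr' : r ∈ (subdivisionOf numberedComplex vertexSupport (Finset.univ.erase k)).faces := by
      rw [heq]
      exact ⟨hne.mono hsr, r, hr, subset_rfl⟩
    obtain ⟨t, ht, rfl⟩ := List.mem_map.1 (List.mem_toFinset.1 hr)
    have hcard := card_faceTriangles _ _ _ (hfc k).1 (hfc k).2.1 (hfc k).2.2 t ht
    refine ⟨hs, _, hr'.1, hcard, hsr, (existsUnique_cell hr'.1 hcard).2 ⟨k, fun v hv hk => ?_⟩⟩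
    exact (Finset.mem_erase.1 (hr'.2 v hv hk)).1 rfl

/-- The combinatorial part of the statement that `numberedComplex` is the special subdivision of a
3-simplex. What remains is its identification with `X₅₄₃`. -/
theorem isSpecialSubdivisionWith_numberedComplex
    (h : ∃ σ ∈ X600.faces, σ.card = 4 ∧ CombinatoriallyEquivalent numberedComplex (X543 σ)) :
    IsSpecialSubdivisionWith (generatedComplex {(Finset.univ : Finset (Fin 4))}) numberedComplex
      vertexSupport := by
  have huniv : ∀ t : Finset (Fin 4), t.card = 4 → t = Finset.univ := fun t ht =>
    Finset.eq_univ_of_card t (by rw [ht]; rfl)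
  refine ⟨?_, ?_, ?_, ?_, ?_, ?_, ?_, ?_⟩
  · exact fun t _ => t.card_le_univ
  · exact fun v _ => ⟨vertexSupport_nonempty v, _, rfl, Finset.subset_univ _⟩
  · exact fun s _ => ⟨Finset.univ, ⟨Finset.univ_nonempty, _, rfl, subset_rfl⟩,
      fun v _ => Finset.subset_univ _⟩
  · intro k _
    refine ⟨(k : ℕ), ?_⟩
    rw [subdivisionOf_vertex]
    ext s
    simp only [generatedComplex, Set.mem_singleton_iff, exists_eq_left, Set.mem_ofPred_eq,
      Finset.subset_singleton_iff]
    constructor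
    · rintro ⟨hne, rfl | h⟩
      · exact absurd hne Finset.not_nonempty_empty
      · exact h
    · rintro rfl
      exact ⟨Finset.singleton_nonempty _, Or.inr rfl⟩
  · intro a b hab _
    exact ⟨a, edgeVertex a b, b, vertexSupport_corner a, vertexSupport_corner b,
      vertexSupport_edgeVertex a b, subdivisionOf_edge hab⟩
  · intro a b c hab hbc hac _
    obtain ⟨h1, h2, h3, h4, h5, h6⟩ := vertexSupport_nearVertex a b c hab hbc hac
    refine ⟨a, b, c, edgeVertex a b, edgeVertex b c, edgeVertex c a,
      nearVertex (otherCorner a b c) a, nearVertex (otherCorner a b c) b,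
      nearVertex (otherCorner a b c) c, vertexSupport_corner a, vertexSupport_corner b,
      vertexSupport_corner c, vertexSupport_edgeVertex a b, vertexSupport_edgeVertex b c,
      vertexSupport_edgeVertex c a, h1, h2, h3, h4, h5, h6, ?_⟩
    rw [subdivisionOf_triangle hab hbc hac, subdividedTriangle]
    congr 1
    ext s
    simp [faceTriangles]
  · intro t _ ht
    rw [huniv t ht, subdivisionOf_univ]
    exact h
  · intro t _ ht
    rw [huniv t ht, subdivisionOf_univ]
    exact boundaryFaces_numberedComplex

lemma finite_numberedComplex : numberedComplex.faces.Finite := by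
  refine (Finset.finite_toSet ((Finset.range 116).powerset)).subset fun s hs => ?_
  rw [Finset.mem_coe, Finset.mem_powerset]
  exact fun v hv => Finset.mem_range.2 (lt_of_mem_numberedComplex (singleton_mem_faces hs hv))

lemma pure_numberedComplex : ∀ s ∈ numberedComplex.faces, ∃ t ∈ numberedComplex.faces,
    s ⊆ t ∧ t.card = 4 := by
  intro s hs
  obtain ⟨-, c, hc, hsc⟩ := mem_numberedComplex.1 hs
  exact ⟨c.verts, verts_mem hc, hsc, card_verts hc⟩

/-! ### The vertices of the 600-cell -/

/-- A number `a + b φ` with integers `a` and `b`, where `φ` is the golden ratio. -/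
abbrev GoldenInt := ℤ × ℤ

namespace GoldenInt

/-- Half of the real number that is represented by `z`. -/
noncomputable def half (z : GoldenInt) : ℝ := (z.1 + z.2 * Real.goldenRatio) / 2

/-- The product, by `φ² = φ + 1`. -/
def mul : GoldenInt → GoldenInt → GoldenInt
  | (a, b), (c, d) => (a * c + b * d, a * d + b * c + b * d)

def add : GoldenInt → GoldenInt → GoldenInt
  | (a, b), (c, d) => (a + c, b + d)

end GoldenInt

/-- Twice the coordinates of a vertex of the 600-cell. -/
abbrev GoldenRow := GoldenInt × GoldenInt × GoldenInt × GoldenInt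

namespace GoldenRow

/-- The row as a vector. -/
def coord (r : GoldenRow) : Fin 4 → GoldenInt := ![r.1, r.2.1, r.2.2.1, r.2.2.2]

/-- The scalar product of two rows. -/
def dot : GoldenRow → GoldenRow → GoldenInt
  | (a, b, c, d), (a', b', c', d') =>
    ((a.mul a').add (b.mul b')).add ((c.mul c').add (d.mul d'))

/-- The row with the eight decimal digits of `n`, each diminished by 2. -/
def ofDigits (n : ℕ) : GoldenRow :=
  let d := fun k : ℕ => ((n / 10 ^ k % 10 : ℕ) : ℤ) - 2
  ((d 7, d 6), (d 5, d 4), (d 3, d 2), (d 1, d 0))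

end GoldenRow

/-- The vertices of the 600-cell, multiplied by 2 and encoded by decimal digits. The first 116 ones
are the vertices of `numberedComplex`, and the last four ones span the 3-simplex whose neighbourhood
is removed. -/
def goldenCodes : List ℕ :=
  [32232213, 23221213, 23223213, 23132212, 32321232, 32323232, 32232231, 23312232, 23221231,
   23223231, 13322223, 32223123, 32221323, 13231222, 32132122, 32321212, 13233222, 32132322,
   32323212, 23123122, 23121322, 23312212, 02222222, 22422222, 22022222, 22224222, 22220222,
   22222242, 22222202, 12323232, 32123232, 12123232, 12321232, 32121232, 12121232, 12323212,
   32123212, 12123212, 12321212, 32121212, 12121212, 21321322, 21121322, 21323122, 21123122,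
   21223213, 21221213, 21223231, 21221231, 21132232, 21132212, 21312232, 21312212, 32212213,
   12232213, 12212213, 32212231, 12232231, 12212231, 13213222, 13211222, 31233222, 31213222,
   31231222, 31211222, 22231332, 22211332, 22231312, 22211312, 22233132, 22213132, 22233112,
   22213112, 12132322, 12132122, 32312322, 32312122, 12312322, 12312122, 22322313, 22322113,
   22122313, 22122113, 22322331, 22322131, 22122331, 22122131, 13222332, 13222132, 13222312,
   13222112, 31222332, 31222132, 31222312, 31222112, 32221321, 12221323, 12221321, 32223121,
   12223123, 12223121, 13322221, 13122223, 13122221, 31322223, 31322221, 31122223, 31122221,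
   22133223, 22133221, 22131223, 22131221, 22313223, 22313221, 22311223, 22311221, 42222222,
   23321322, 23323122, 23132232]

/-- The vertices of the 600-cell, multiplied by 2. -/
def goldenTable : List GoldenRow := goldenCodes.map GoldenRow.ofDigits

/-- The 3-simplices of the 600-cell that intersect the removed 3-simplex. -/
def removedCells : List Cell :=
  [(0,4,10,119), (0,4,13,118), (0,4,118,119), (0,5,10,119), (0,5,16,117), (0,5,117,119),
   (0,6,13,118), (0,6,16,117), (0,6,117,118), (0,117,118,119), (1,4,11,119), (1,4,14,118),
   (1,4,118,119), (1,7,11,119), (1,7,19,116), (1,7,116,119), (1,8,14,118), (1,8,19,116),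
   (1,8,116,118), (1,116,118,119), (2,5,12,119), (2,5,17,117), (2,5,117,119), (2,7,12,119),
   (2,7,20,116), (2,7,116,119), (2,9,17,117), (2,9,20,116), (2,9,116,117), (2,116,117,119),
   (3,6,15,118), (3,6,18,117), (3,6,117,118), (3,8,15,118), (3,8,21,116), (3,8,116,118),
   (3,9,18,117), (3,9,21,116), (3,9,116,117), (3,116,117,118), (4,10,11,119), (4,13,14,118),
   (5,10,12,119), (5,16,17,117), (6,13,15,118), (6,16,18,117), (7,11,12,119), (7,19,20,116),
   (8,14,15,118), (8,19,21,116), (9,17,18,117), (9,20,21,116), (10,11,12,119), (13,14,15,118),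
   (16,17,18,117), (19,20,21,116), (116,117,118,119)]

/-- The row of a vertex of the 600-cell. -/
def goldenRow (v : ℕ) : GoldenRow := goldenTable.getD v ((0, 0), (0, 0), (0, 0), (0, 0))

/-- The list of the 600 cells of the 600-cell. -/
def allCells : List Cell := cellList ++ removedCells

/-- A sufficient criterion for the scalar product of two rows to be at most `2φ`. -/
def smallDot (r s : GoldenRow) : Bool :=
  match r.dot s with
  | (a, b) => decide (a + b ≤ 2) && decide (b ≤ 2)

/-- Whether the test holds for all pairs of entries of a list. -/
def pairsCheck (p : GoldenRow → GoldenRow → Bool) : List GoldenRow → Bool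
  | [] => true
  | r :: l => l.all (p r) && pairsCheck p l

/-- Whether the vertices of a cell are pairwise adjacent: then the scalar product of their rows is
`2φ`. -/
def adjacentCheck : Cell → Bool
  | (a, b, c, d) =>
    let p := fun v w : ℕ => v.blt 120 && w.blt 120 && (goldenRow v).dot (goldenRow w) == (0, 2)
    p a b && p a c && p a d && p b c && p b d && p c d

/-- Whether a removed cell contains the triangle `xyz` without the vertex `w`. -/
def hasRemovedNeighbour (x y z w : ℕ) : Bool :=
  removedCells.any fun c => c.has x && c.has y && c.has z && !c.has w

/-- Whether the boundary triangles of the cell lie in removed cells. -/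
def outerFacetsCheck : Cell → Bool
  | (a, b, c, d) =>
    (!onBoundary b c d || hasRemovedNeighbour b c d a) &&
    (!onBoundary a c d || hasRemovedNeighbour a c d b) &&
    (!onBoundary a b d || hasRemovedNeighbour a b d c) &&
    (!onBoundary a b c || hasRemovedNeighbour a b c d)

/-- Whether each triangle of a removed cell lies in another cell. -/
def removedFacetsCheck : Cell → Bool
  | (a, b, c, d) =>
    (hasRemovedNeighbour b c d a || hasNeighbour b c d a) &&
    (hasRemovedNeighbour a c d b || hasNeighbour a c d b) &&
    (hasRemovedNeighbour a b d c || hasNeighbour a b d c) &&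
    (hasRemovedNeighbour a b c d || hasNeighbour a b c d)

/-- Whether the face of the removed cell that is disjoint from the removed 3-simplex lies in a cell
of `numberedComplex`. -/
def remainderCheck (c : Cell) : Bool :=
  let s := [c.1, c.2.1, c.2.2.1, c.2.2.2].filter fun v => v.blt 116
  s.isEmpty || cellList.any fun c' => s.all c'.has

lemma goldenTable_pairsCheck : pairsCheck smallDot goldenTable = true := by decide +kernel

lemma goldenTable_norm : goldenTable.all (fun r => r.dot r == (4, 0)) = true := by decide +kernel

lemma allCells_adjacentCheck : allCells.all adjacentCheck = true := by decide +kernel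

lemma cellList_outerFacetsCheck : cellList.all outerFacetsCheck = true := by decide +kernel

lemma removedCells_facetsCheck : removedCells.all removedFacetsCheck = true := by decide +kernel

lemma removedCells_remainderCheck : removedCells.all remainderCheck = true := by decide +kernel

/-- Each row of the table has one of the three types of `cell600Vertices`. -/
lemma goldenTable_type : ∀ r ∈ goldenTable,
    (∃ i : Fin 4, (r.coord i = (2, 0) ∨ r.coord i = (-2, 0)) ∧
      ∀ j, j ≠ i → r.coord j = (0, 0)) ∨
    (∀ i : Fin 4, r.coord i = (1, 0) ∨ r.coord i = (-1, 0)) ∨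
    (∃ p : Equiv.Perm (Fin 4), Equiv.Perm.sign p = 1 ∧
      (r.coord (p 0) = (0, 1) ∨ r.coord (p 0) = (0, -1)) ∧
      (r.coord (p 1) = (1, 0) ∨ r.coord (p 1) = (-1, 0)) ∧
      (r.coord (p 2) = (-1, 1) ∨ r.coord (p 2) = (1, -1)) ∧ r.coord (p 3) = (0, 0)) := by
  decide +kernel

lemma goldenTable_axis : ∀ i : Fin 4, ∀ e ∈ [((2 : ℤ), (0 : ℤ)), (-2, 0)],
    ∃ r ∈ goldenTable, ∀ k, r.coord k = if k = i then e else (0, 0) := by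
  decide +kernel

lemma goldenTable_cube : ∀ e₀ ∈ [((1 : ℤ), (0 : ℤ)), (-1, 0)], ∀ e₁ ∈ [((1 : ℤ), (0 : ℤ)), (-1, 0)],
    ∀ e₂ ∈ [((1 : ℤ), (0 : ℤ)), (-1, 0)], ∀ e₃ ∈ [((1 : ℤ), (0 : ℤ)), (-1, 0)],
    (e₀, e₁, e₂, e₃) ∈ goldenTable := by
  decide +kernel

lemma goldenTable_even : ∀ p : Equiv.Perm (Fin 4), Equiv.Perm.sign p = 1 →
    ∀ e₀ ∈ [((0 : ℤ), (1 : ℤ)), (0, -1)], ∀ e₁ ∈ [((1 : ℤ), (0 : ℤ)), (-1, 0)],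
    ∀ e₂ ∈ [((-1 : ℤ), (1 : ℤ)), (1, -1)],
    ∃ r ∈ goldenTable, r.coord (p 0) = e₀ ∧ r.coord (p 1) = e₁ ∧ r.coord (p 2) = e₂ ∧
      r.coord (p 3) = (0, 0) := by
  decide +kernel

/-! ### The boundary complex of the 600-cell -/

/-- In dimension 4, the coordinates with respect to four vectors are determined by duality. -/
lemma sum_smul_eq_of_dual {V : Type*} [AddCommGroup V] [Module ℝ V]
    (hV : Module.finrank ℝ V = 4) {e : Fin 4 → V} {L : Fin 4 → V →ₗ[ℝ] ℝ}
    (h : ∀ i j, L i (e j) = if i = j then 1 else 0) (y : V) : ∑ i, L i y • e i = y := by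
  have : FiniteDimensional ℝ V := Module.finite_of_finrank_pos (by omega)
  have hli : LinearIndependent ℝ e := by
    rw [Fintype.linearIndependent_iff]
    intro g hg i
    have := congrArg (L i) hg
    simpa [h] using this
  have hy : y ∈ Submodule.span ℝ (Set.range e) := by
    rw [hli.span_eq_top_of_card_eq_finrank' (by simp [hV])]
    trivial
  obtain ⟨g, rfl⟩ := (Submodule.mem_span_range_iff_exists_fun ℝ).1 hy
  refine Finset.sum_congr rfl fun i _ => ?_
  simp [h]

lemma GoldenInt.half_add (z w : GoldenInt) : (z.add w).half = z.half + w.half := by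
  obtain ⟨a, b⟩ := z
  obtain ⟨c, d⟩ := w
  simp only [add, half]
  push_cast
  ring

lemma GoldenInt.half_mul (z w : GoldenInt) : (z.mul w).half = 2 * (z.half * w.half) := by
  obtain ⟨a, b⟩ := z
  obtain ⟨c, d⟩ := w
  simp only [mul, half]
  push_cast
  linear_combination (- (b * d : ℝ) / 2) * Real.goldenRatio_sq

/-- The vertex of the 600-cell with the number `v`. -/
noncomputable def goldenVertex (v : ℕ) : EuclideanSpace ℝ (Fin 4) :=
  WithLp.toLp 2 fun i => ((goldenRow v).coord i).half

lemma goldenVertex_apply (v : ℕ) (i : Fin 4) :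
    goldenVertex v i = ((goldenRow v).coord i).half := rfl

lemma inner_goldenVertex (v w : ℕ) : inner ℝ (goldenVertex v) (goldenVertex w) =
    ((goldenRow v).dot (goldenRow w)).half / 2 := by
  rw [PiLp.inner_apply]
  simp only [goldenVertex_apply, Fin.sum_univ_four]
  rcases goldenRow v with ⟨a, b, c, d⟩
  rcases goldenRow w with ⟨a', b', c', d'⟩
  simp only [GoldenRow.dot, GoldenInt.half_add, GoldenInt.half_mul, GoldenRow.coord,
    RCLike.inner_apply, conj_trivial]
  simp
  ring

lemma length_goldenTable : goldenTable.length = 120 := by decide +kernel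

lemma goldenRow_eq {v : ℕ} (hv : v < 120) :
    goldenRow v = goldenTable[v]'(by rw [length_goldenTable]; exact hv) := by
  rw [goldenRow, List.getD_eq_getElem]

lemma goldenRow_mem {v : ℕ} (hv : v < 120) : goldenRow v ∈ goldenTable := by
  rw [goldenRow_eq hv]
  exact List.getElem_mem _

lemma exists_goldenRow {r : GoldenRow} (hr : r ∈ goldenTable) : ∃ v < 120, goldenRow v = r := by
  obtain ⟨v, hv, rfl⟩ := List.getElem_of_mem hr
  rw [length_goldenTable] at hv
  exact ⟨v, hv, goldenRow_eq hv⟩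

lemma inner_goldenVertex_self {v : ℕ} (hv : v < 120) :
    inner ℝ (goldenVertex v) (goldenVertex v) = (1 : ℝ) := by
  have h := List.all_eq_true.1 goldenTable_norm _ (goldenRow_mem hv)
  rw [inner_goldenVertex, eq_of_beq h]
  norm_num [GoldenInt.half]

lemma half_le_of_smallDot {r s : GoldenRow} (h : smallDot r s = true) :
    (r.dot s).half ≤ Real.goldenRatio := by
  unfold smallDot at h
  generalize r.dot s = z at h ⊢
  obtain ⟨a, b⟩ := z
  simp only [Bool.and_eq_true, decide_eq_true_eq] at h
  have h1 : (a + b : ℝ) ≤ 2 := by exact_mod_cast h.1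
  have h2 : (b : ℝ) ≤ 2 := by exact_mod_cast h.2
  have h3 := mul_le_mul_of_nonneg_left Real.one_lt_goldenRatio.le (sub_nonneg.2 h2)
  simp only [GoldenInt.half]
  linarith

lemma pairwise_of_pairsCheck (p : GoldenRow → GoldenRow → Bool) : ∀ l : List GoldenRow,
    pairsCheck p l = true → l.Pairwise fun r s => p r s = true
  | [], _ => List.Pairwise.nil
  | r :: l, h => by
    simp only [pairsCheck, Bool.and_eq_true, List.all_eq_true] at h
    exact List.Pairwise.cons h.1 (pairwise_of_pairsCheck p l h.2)

lemma inner_goldenVertex_le {v w : ℕ} (hv : v < 120) (hw : w < 120) (hne : v ≠ w) :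
    inner ℝ (goldenVertex v) (goldenVertex w) ≤ Real.goldenRatio / 2 := by
  have hp := List.pairwise_iff_getElem.1
    (pairwise_of_pairsCheck _ _ goldenTable_pairsCheck)
  wlog hlt : v < w generalizing v w
  · rw [real_inner_comm]
    exact this hw hv hne.symm (by omega)
  have := hp v w (by rw [length_goldenTable]; exact hv) (by rw [length_goldenTable]; exact hw) hlt
  rw [← goldenRow_eq hv, ← goldenRow_eq hw] at this
  rw [inner_goldenVertex]
  linarith [half_le_of_smallDot this]

lemma half_goldenRatio_lt_one : Real.goldenRatio / 2 < 1 := by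
  linarith [Real.goldenRatio_lt_two]

lemma goldenVertex_injOn : Set.InjOn goldenVertex {v | v < 120} := by
  intro v hv w hw h
  by_contra hne
  have h1 := inner_goldenVertex_le hv hw hne
  rw [← h, inner_goldenVertex_self hv] at h1
  linarith [half_goldenRatio_lt_one]

lemma inv_goldenRatio_eq : Real.goldenRatio⁻¹ = Real.goldenRatio - 1 := by
  rw [Real.inv_goldenRatio, ← Real.one_sub_goldenRatio]
  ring

lemma goldenVertex_mem {v : ℕ} (hv : v < 120) : goldenVertex v ∈ cell600Vertices := by
  rcases goldenTable_type _ (goldenRow_mem hv) with ⟨i, h1, h2⟩ | h | ⟨p, hp, h0, h1, h2, h3⟩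
  · refine Or.inl ⟨i, ?_, fun j hj => ?_⟩
    · rw [goldenVertex_apply]
      rcases h1 with h | h <;> rw [h] <;> norm_num [GoldenInt.half]
    · rw [goldenVertex_apply, h2 j hj]
      norm_num [GoldenInt.half]
  · refine Or.inr (Or.inl fun i => ?_)
    rw [goldenVertex_apply]
    rcases h i with h | h <;> rw [h] <;> norm_num [GoldenInt.half]
  · refine Or.inr (Or.inr ⟨p, hp, ?_, ?_, ?_, ?_⟩)
    · rw [goldenVertex_apply]
      rcases h0 with h | h <;> rw [h] <;> norm_num [GoldenInt.half, neg_div]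
    · rw [goldenVertex_apply]
      rcases h1 with h | h <;> rw [h] <;> norm_num [GoldenInt.half]
    · rw [goldenVertex_apply, inv_goldenRatio_eq]
      rcases h2 with h | h <;> rw [h] <;> [left; right] <;> simp [GoldenInt.half] <;> ring
    · rw [goldenVertex_apply, h3]
      norm_num [GoldenInt.half]

lemma exists_goldenVertex {x : EuclideanSpace ℝ (Fin 4)} (hx : x ∈ cell600Vertices) :
    ∃ v < 120, goldenVertex v = x := by
  suffices h : ∃ r ∈ goldenTable, ∀ i, x i = (r.coord i).half by
    obtain ⟨r, hr, hx⟩ := h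
    obtain ⟨v, hv, rfl⟩ := exists_goldenRow hr
    refine ⟨v, hv, ?_⟩
    ext i
    rw [hx, goldenVertex_apply]
  rcases hx with ⟨i, h1, h2⟩ | h | ⟨p, hp, h0, h1, h2, h3⟩
  · have key : ∃ e ∈ [((2 : ℤ), (0 : ℤ)), (-2, 0)], x i = GoldenInt.half e := by
      rcases h1 with h | h <;> rw [h] <;> norm_num [GoldenInt.half]
    obtain ⟨e, he, hxe⟩ := key
    obtain ⟨r, hr, hc⟩ := goldenTable_axis i e he
    refine ⟨r, hr, fun k => ?_⟩
    rw [hc]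
    split_ifs with hk
    · rw [hk, hxe]
    · rw [h2 k hk]
      norm_num [GoldenInt.half]
  · have key : ∀ i, ∃ e ∈ [((1 : ℤ), (0 : ℤ)), (-1, 0)], x i = GoldenInt.half e := by
      intro i
      rcases h i with h | h <;> rw [h] <;> norm_num [GoldenInt.half]
    choose e he hxe using key
    refine ⟨_, goldenTable_cube _ (he 0) _ (he 1) _ (he 2) _ (he 3), fun i => ?_⟩
    rw [hxe]
    fin_cases i <;> rfl
  · have k0 : ∃ e ∈ [((0 : ℤ), (1 : ℤ)), (0, -1)], x (p 0) = GoldenInt.half e := by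
      rcases h0 with h | h <;> rw [h] <;> norm_num [GoldenInt.half, neg_div]
    have k1 : ∃ e ∈ [((1 : ℤ), (0 : ℤ)), (-1, 0)], x (p 1) = GoldenInt.half e := by
      rcases h1 with h | h <;> rw [h] <;> norm_num [GoldenInt.half]
    have k2 : ∃ e ∈ [((-1 : ℤ), (1 : ℤ)), (1, -1)], x (p 2) = GoldenInt.half e := by
      rw [inv_goldenRatio_eq] at h2
      rcases h2 with h | h
      · refine ⟨_, List.mem_cons_self, ?_⟩
        rw [h]
        simp [GoldenInt.half]
        ring
      · refine ⟨_, List.mem_cons_of_mem _ List.mem_cons_self, ?_⟩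
        rw [h]
        simp [GoldenInt.half]
        ring
    obtain ⟨e0, he0, hx0⟩ := k0
    obtain ⟨e1, he1, hx1⟩ := k1
    obtain ⟨e2, he2, hx2⟩ := k2
    obtain ⟨r, hr, c0, c1, c2, c3⟩ := goldenTable_even p hp e0 he0 e1 he1 e2 he2
    refine ⟨r, hr, fun i => ?_⟩
    obtain ⟨j, rfl⟩ := p.surjective i
    fin_cases j
    · exact hx0.trans (by rw [← c0]; rfl)
    · exact hx1.trans (by rw [← c1]; rfl)
    · exact hx2.trans (by rw [← c2]; rfl)
    · refine h3.trans ?_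
      have : r.coord (p 3) = (0, 0) := c3
      simp [this, GoldenInt.half]

lemma allCells_vtx {c : Cell} (hc : c ∈ allCells) : (∀ i, c.vtx i < 120) ∧
    ∀ i j, i ≠ j → inner ℝ (goldenVertex (c.vtx i)) (goldenVertex (c.vtx j)) =
      Real.goldenRatio / 2 := by
  have h := List.all_eq_true.1 allCells_adjacentCheck c hc
  obtain ⟨a, b, c, d⟩ := c
  simp only [adjacentCheck, Bool.and_eq_true, Nat.blt_eq, beq_iff_eq] at h
  obtain ⟨⟨⟨⟨⟨⟨⟨ha, hb⟩, hab⟩, ⟨⟨-, hc⟩, hac⟩⟩, ⟨⟨-, hd⟩, had⟩⟩, ⟨-, hbc⟩⟩, ⟨-, hbd⟩⟩, ⟨-, hcd⟩⟩ := h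
  have key : ∀ v w, (goldenRow v).dot (goldenRow w) = (0, 2) →
      inner ℝ (goldenVertex v) (goldenVertex w) = Real.goldenRatio / 2 ∧
      inner ℝ (goldenVertex w) (goldenVertex v) = Real.goldenRatio / 2 := by
    intro v w h
    have e : inner ℝ (goldenVertex v) (goldenVertex w) = Real.goldenRatio / 2 := by
      rw [inner_goldenVertex, h]
      norm_num [GoldenInt.half]
    exact ⟨e, (real_inner_comm _ _).trans e⟩
  replace hab := key _ _ hab
  replace hac := key _ _ hac
  replace had := key _ _ had
  replace hbc := key _ _ hbc
  replace hbd := key _ _ hbd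
  replace hcd := key _ _ hcd
  constructor
  · intro i
    fin_cases i <;> assumption
  · intro i j hij
    fin_cases i <;> fin_cases j <;> simp_all [Cell.vtx]

lemma hasRemovedNeighbour_iff (x y z w : ℕ) : hasRemovedNeighbour x y z w = true ↔
    ∃ c ∈ removedCells, x ∈ c.verts ∧ y ∈ c.verts ∧ z ∈ c.verts ∧ w ∉ c.verts := by
  simp only [hasRemovedNeighbour, List.any_eq_true, Bool.and_eq_true,
    Bool.not_eq_true', Cell.has_iff, ← Bool.not_eq_true, and_assoc]

/-- The boundary complex of the 600-cell has no boundary. -/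
lemma allCells_neighbour {c : Cell} (hc : c ∈ allCells) (i : Fin 4) :
    ∃ c' ∈ allCells, (∀ j, j ≠ i → c.vtx j ∈ c'.verts) ∧ c.vtx i ∉ c'.verts := by
  have key : ∀ x y z w, (hasRemovedNeighbour x y z w = true ∨ hasNeighbour x y z w = true) →
      ∃ c ∈ allCells, x ∈ c.verts ∧ y ∈ c.verts ∧ z ∈ c.verts ∧ w ∉ c.verts := by
    rintro x y z w (h | h)
    · obtain ⟨c, hc, h⟩ := (hasRemovedNeighbour_iff ..).1 h
      exact ⟨c, List.mem_append_right _ hc, h⟩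
    · obtain ⟨c, hc, h⟩ := (hasNeighbour_iff ..).1 h
      exact ⟨c, List.mem_append_left _ hc, h⟩
  rcases List.mem_append.1 hc with hc | hc
  · by_cases hb : ∃ k, ∀ j, j ≠ i → k ∉ vertexSupport (c.vtx j)
    · have h := List.all_eq_true.1 cellList_outerFacetsCheck c hc
      have k2 : ∀ x y z w, (!onBoundary x y z || hasRemovedNeighbour x y z w) = true →
          (∃ k, k ∉ vertexSupport x ∧ k ∉ vertexSupport y ∧ k ∉ vertexSupport z) →
          ∃ c ∈ allCells, x ∈ c.verts ∧ y ∈ c.verts ∧ z ∈ c.verts ∧ w ∉ c.verts := by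
        intro x y z w h hb
        refine key x y z w (Or.inl ?_)
        rw [(onBoundary_iff x y z).2 hb] at h
        simpa using h
      obtain ⟨a, b, c, d⟩ := c
      simp only [outerFacetsCheck] at h
      rw [Bool.and_eq_true, Bool.and_eq_true, Bool.and_eq_true] at h
      obtain ⟨⟨⟨h0, h1⟩, h2⟩, h3⟩ := h
      fin_cases i
      · simpa [Cell.vtx, Fin.forall_fin_succ, and_assoc] using
          k2 _ _ _ _ h0 (by simpa [Cell.vtx, Fin.forall_fin_succ] using hb)
      · simpa [Cell.vtx, Fin.forall_fin_succ, and_assoc] using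
          k2 _ _ _ _ h1 (by simpa [Cell.vtx, Fin.forall_fin_succ] using hb)
      · simpa [Cell.vtx, Fin.forall_fin_succ, and_assoc] using
          k2 _ _ _ _ h2 (by simpa [Cell.vtx, Fin.forall_fin_succ] using hb)
      · simpa [Cell.vtx, Fin.forall_fin_succ, and_assoc] using
          k2 _ _ _ _ h3 (by simpa [Cell.vtx, Fin.forall_fin_succ] using hb)
    · rw [facet_iff hc i, not_not] at hb
      obtain ⟨c', hc', h⟩ := hb
      exact ⟨c', List.mem_append_left _ hc', h⟩
  · have h := List.all_eq_true.1 removedCells_facetsCheck c hc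
    obtain ⟨a, b, c, d⟩ := c
    simp only [removedFacetsCheck] at h
    rw [Bool.and_eq_true, Bool.and_eq_true, Bool.and_eq_true] at h
    simp only [Bool.or_eq_true] at h
    obtain ⟨⟨⟨h0, h1⟩, h2⟩, h3⟩ := h
    fin_cases i
    · simpa [Cell.vtx, Fin.forall_fin_succ, and_assoc] using key _ _ _ _ h0
    · simpa [Cell.vtx, Fin.forall_fin_succ, and_assoc] using key _ _ _ _ h1
    · simpa [Cell.vtx, Fin.forall_fin_succ, and_assoc] using key _ _ _ _ h2
    · simpa [Cell.vtx, Fin.forall_fin_succ, and_assoc] using key _ _ _ _ h3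

/-- The coordinates with respect to four unit vectors with pairwise scalar products `φ / 2`. -/
noncomputable def goldenCoordinate (c : Fin 4 → ℕ) (i : Fin 4) :
    EuclideanSpace ℝ (Fin 4) →ₗ[ℝ] ℝ :=
  (1 - Real.goldenRatio / 2)⁻¹ • ((innerₛₗ ℝ (goldenVertex (c i))) -
    (Real.goldenRatio / 2 / (1 + 3 * (Real.goldenRatio / 2))) •
      innerₛₗ ℝ (∑ j, goldenVertex (c j)))

lemma goldenCoordinate_apply (c : Fin 4 → ℕ) (i : Fin 4) (y : EuclideanSpace ℝ (Fin 4)) :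
    goldenCoordinate c i y = (1 - Real.goldenRatio / 2)⁻¹ * (inner ℝ (goldenVertex (c i)) y -
      Real.goldenRatio / 2 / (1 + 3 * (Real.goldenRatio / 2)) *
        ∑ j, inner ℝ (goldenVertex (c j)) y) := by
  simp [goldenCoordinate]

lemma sum_inner_goldenVertex {c : Cell} (hc : c ∈ allCells) (j : Fin 4) :
    ∑ i, inner ℝ (goldenVertex (c.vtx i)) (goldenVertex (c.vtx j)) =
      1 + 3 * (Real.goldenRatio / 2) := by
  obtain ⟨h1, h2⟩ := allCells_vtx hc
  rw [← Finset.add_sum_erase _ _ (Finset.mem_univ j), inner_goldenVertex_self (h1 j),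
    Finset.sum_congr rfl fun i hi => h2 i j (Finset.ne_of_mem_erase hi)]
  simp

lemma sum_inner_goldenVertex_lt {c : Cell} (hc : c ∈ allCells) {w : ℕ} (hw : w < 120)
    (hr : w ∉ Set.range c.vtx) :
    ∑ i, inner ℝ (goldenVertex (c.vtx i)) (goldenVertex w) < 1 + 3 * (Real.goldenRatio / 2) := by
  have : ∑ i, inner ℝ (goldenVertex (c.vtx i)) (goldenVertex w) ≤
      ∑ i : Fin 4, Real.goldenRatio / 2 :=
    Finset.sum_le_sum fun i _ => inner_goldenVertex_le ((allCells_vtx hc).1 i) hw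
      fun e => hr ⟨i, e⟩
  simp at this
  linarith [half_goldenRatio_lt_one]

lemma sum_goldenCoordinate (c : Fin 4 → ℕ) (y : EuclideanSpace ℝ (Fin 4)) :
    ∑ i, goldenCoordinate c i y =
      (∑ i, inner ℝ (goldenVertex (c i)) y) / (1 + 3 * (Real.goldenRatio / 2)) := by
  have h1 : 1 - Real.goldenRatio / 2 ≠ 0 := by linarith [half_goldenRatio_lt_one]
  have h2 : 1 + 3 * (Real.goldenRatio / 2) ≠ 0 := by linarith [Real.goldenRatio_pos]
  simp only [goldenCoordinate_apply, ← Finset.mul_sum, Finset.sum_sub_distrib]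
  simp only [Finset.sum_const, Finset.card_univ, Fintype.card_fin, nsmul_eq_mul]
  generalize Real.goldenRatio / 2 = a at h1 h2 ⊢
  have h3 : a / (1 + 3 * a) * (1 + 3 * a) = a := div_mul_cancel₀ _ h2
  rw [eq_div_iff h2, mul_assoc, inv_mul_eq_iff_eq_mul₀ h1]
  push_cast
  linear_combination (-4 * ∑ i, inner ℝ (goldenVertex (c i)) y) * h3

/-- The cones over the cells of the 600-cell form a regular fan, with all heights equal to 1. -/
lemma isRegularFan_goldenVertex : IsRegularFan {c | ∃ c' ∈ allCells, c = c'.vtx} {v | v < 120}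
    goldenVertex (fun _ => 1) goldenCoordinate := by
  have h1 : 1 - Real.goldenRatio / 2 ≠ 0 := by linarith [half_goldenRatio_lt_one]
  have h2 : 0 < 1 + 3 * (Real.goldenRatio / 2) := by linarith [Real.goldenRatio_pos]
  have dual : ∀ c ∈ allCells, ∀ i j, goldenCoordinate c.vtx i (goldenVertex (c.vtx j)) =
      if i = j then 1 else 0 := by
    intro c hc i j
    rw [goldenCoordinate_apply, sum_inner_goldenVertex hc, div_mul_cancel₀ _ h2.ne']
    split_ifs with hij
    · rw [hij, inner_goldenVertex_self ((allCells_vtx hc).1 j), inv_mul_cancel₀ h1]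
    · rw [(allCells_vtx hc).2 i j hij, sub_self, mul_zero]
  refine ⟨?_, ?_, ?_, ?_⟩
  · rintro _ ⟨c, hc, rfl⟩ i
    exact (allCells_vtx hc).1 i
  · rintro _ ⟨c, hc, rfl⟩
    exact dual c hc
  · rintro _ ⟨c, hc, rfl⟩ y
    exact sum_smul_eq_of_dual (by simp) (dual c hc) y
  · rintro _ ⟨c, hc, rfl⟩ w hw hr
    simp only [one_mul]
    rw [sum_goldenCoordinate, div_lt_one h2]
    exact sum_inner_goldenVertex_lt hc hw hr

/-- A supporting hyperplane of the 600-cell does not pass through its center. -/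
lemma pos_of_supporting {u : EuclideanSpace ℝ (Fin 4)} {r : ℝ} (hu : u ≠ 0)
    (h : ∀ x ∈ cell600, inner ℝ u x ≤ r) : 0 < r := by
  obtain ⟨i, hi⟩ : ∃ i, u i ≠ 0 := by
    by_contra! h0
    exact hu (by ext i; simpa using h0 i)
  have key : ∀ s : ℝ, s = 1 ∨ s = -1 → u i * s ≤ r := by
    intro s hs
    have := h (EuclideanSpace.single i s) (subset_convexHull ℝ _ (Or.inl ⟨i, by simpa using hs,
      fun j hj => by simp [hj]⟩))
    simpa [EuclideanSpace.inner_single_right, mul_comm] using this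
  have h1 := key 1 (Or.inl rfl)
  have h2 := key (-1) (Or.inr rfl)
  rcases lt_or_gt_of_ne hi with h | h <;> linarith

lemma finite_allCells : {c | ∃ c' ∈ allCells, c = c'.vtx}.Finite :=
  (allCells.toFinset.finite_toSet.image Cell.vtx).subset (by
    rintro _ ⟨c, hc, rfl⟩
    exact ⟨c, by simpa using hc, rfl⟩)

/-- The 3-simplices of `X₆₀₀` are the listed cells. If a supporting hyperplane contains a set of
vertices, then the sum of these lies in the cone over a cell, and the support functional of this
cell shows that the vertices belong to the cell. -/
lemma mem_X600 {s : Finset (EuclideanSpace ℝ (Fin 4))} :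
    s ∈ X600.faces ↔ s.Nonempty ∧ ∃ c ∈ allCells, s ⊆ c.verts.image goldenVertex := by
  have F := isRegularFan_goldenVertex
  constructor
  · rintro ⟨hne, hV, u, r, hu, hle, heq⟩
    refine ⟨hne, ?_⟩
    have hr := pos_of_supporting hu hle
    obtain ⟨_, ⟨c, hc, rfl⟩, hy⟩ := F.exists_nonneg finite_allCells
      ⟨_, _, List.mem_append_left _ (List.mem_cons_self ..), rfl⟩ (∑ x ∈ s, x) (by
        rintro _ ⟨c, hc, rfl⟩ i
        obtain ⟨c', hc', h1, h2⟩ := allCells_neighbour hc i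
        refine Or.inr ⟨_, ⟨c', hc', rfl⟩, fun j hj => ?_, ?_⟩
        · rw [← c'.coe_verts]; exact h1 j hj
        · rw [← c'.coe_verts]; exact h2)
    refine ⟨c, hc, ?_⟩
    have hcC : c.vtx ∈ {c | ∃ c' ∈ allCells, c = c'.vtx} := ⟨c, hc, rfl⟩
    -- the support functional is at most 1 on `s`, and on average at least 1
    have e1 : ∀ x ∈ s, IsRegularFan.support (fun _ => 1) goldenCoordinate c.vtx x ≤ 1 := by
      intro x hx
      obtain ⟨v, hv, rfl⟩ := exists_goldenVertex (hV x hx)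
      exact F.support_le hcC hv
    have e2 : ∑ x ∈ s, (1 : ℝ) ≤
        ∑ x ∈ s, IsRegularFan.support (fun _ => 1) goldenCoordinate c.vtx x := by
      rw [← map_sum, IsRegularFan.support_apply]
      simp only [one_mul]
      refine le_of_mul_le_mul_right ?_ hr
      have e3 : inner ℝ u (∑ x ∈ s, x) = (∑ x ∈ s, (1 : ℝ)) * r := by
        rw [inner_sum, Finset.sum_congr rfl heq, Finset.sum_mul]
        simp
      rw [← e3]
      conv_lhs => rw [← F.expand _ hcC (∑ x ∈ s, x)]
      rw [inner_sum, Finset.sum_mul]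
      refine Finset.sum_le_sum fun i _ => ?_
      rw [inner_smul_right]
      exact mul_le_mul_of_nonneg_left (hle _ (subset_convexHull ℝ _
        (goldenVertex_mem ((allCells_vtx hc).1 i)))) (hy i)
    have e4 := (Finset.sum_eq_sum_iff_of_le e1).1 (le_antisymm (Finset.sum_le_sum e1) e2)
    intro x hx
    obtain ⟨v, hv, rfl⟩ := exists_goldenVertex (hV x hx)
    refine Finset.mem_image_of_mem _ ?_
    have e5 := e4 _ hx
    rw [IsRegularFan.support_apply] at e5
    by_contra hr
    rw [← Finset.mem_coe, c.coe_verts] at hr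
    exact (F.lt _ hcC v hv hr).ne e5
  · rintro ⟨hne, c, hc, hs⟩
    have e1 : ∀ x ∈ s, ∃ i, goldenVertex (c.vtx i) = x := by
      intro x hx
      obtain ⟨v, hv, rfl⟩ := Finset.mem_image.1 (hs hx)
      rw [← Finset.mem_coe, c.coe_verts] at hv
      obtain ⟨i, rfl⟩ := hv
      exact ⟨i, rfl⟩
    refine ⟨hne, fun x hx => ?_, ∑ i, goldenVertex (c.vtx i), 1 + 3 * (Real.goldenRatio / 2),
      fun h0 => ?_, fun x hx => ?_, fun x hx => ?_⟩
    · obtain ⟨i, rfl⟩ := e1 x hx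
      exact goldenVertex_mem ((allCells_vtx hc).1 i)
    · have := sum_inner_goldenVertex hc 0
      rw [← sum_inner, h0, inner_zero_left] at this
      linarith [Real.goldenRatio_pos]
    · refine convexHull_min (t := {x | inner ℝ (∑ i, goldenVertex (c.vtx i)) x ≤
        1 + 3 * (Real.goldenRatio / 2)}) (fun x hx => ?_)
        (convex_halfSpace_le (innerₛₗ ℝ (∑ i, goldenVertex (c.vtx i))).isLinear _) hx
      obtain ⟨v, hv, rfl⟩ := exists_goldenVertex hx
      rw [Set.mem_ofPred_eq, sum_inner]
      by_cases hr : v ∈ Set.range c.vtx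
      · obtain ⟨i, rfl⟩ := hr
        exact (sum_inner_goldenVertex hc i).le
      · exact (sum_inner_goldenVertex_lt hc hv hr).le
    · obtain ⟨i, rfl⟩ := e1 x hx
      rw [sum_inner]
      exact sum_inner_goldenVertex hc i

/-- The numbers of the vertices of the removed 3-simplex. -/
def removedSimplex : Finset ℕ := {116, 117, 118, 119}

lemma mem_X543 {s : Finset (EuclideanSpace ℝ (Fin 4))} :
    s ∈ (X543 (removedSimplex.image goldenVertex)).faces ↔
      ∃ r ∈ numberedComplex.faces, r.image goldenVertex = s := by
  have hσ : ∀ v < 120, v ∉ removedSimplex → v < 116 := by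
    intro v hv h
    simp only [removedSimplex, Finset.mem_insert, Finset.mem_singleton] at h
    omega
  constructor
  · rintro ⟨hs, hd⟩
    obtain ⟨hne, c, hc, hsc⟩ := mem_X600.1 hs
    have himg : (c.verts.filter fun v => goldenVertex v ∈ s).image goldenVertex = s := by
      ext x
      simp only [Finset.mem_image, Finset.mem_filter]
      constructor
      · rintro ⟨v, ⟨-, h⟩, rfl⟩
        exact h
      · intro hx
        obtain ⟨v, hv, rfl⟩ := Finset.mem_image.1 (hsc hx)
        exact ⟨v, ⟨hv, hx⟩, rfl⟩
    have hne' : (c.verts.filter fun v => goldenVertex v ∈ s).Nonempty := by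
      rw [← Finset.image_nonempty (f := goldenVertex), himg]
      exact hne
    refine ⟨_, mem_numberedComplex.2 ⟨hne', ?_⟩, himg⟩
    rcases List.mem_append.1 hc with hc' | hc'
    · exact ⟨c, hc', Finset.filter_subset _ _⟩
    · have h := List.all_eq_true.1 removedCells_remainderCheck c hc'
      have hmem : ∀ v ∈ c.verts.filter fun v => goldenVertex v ∈ s,
          v ∈ [c.1, c.2.1, c.2.2.1, c.2.2.2].filter fun v => v.blt 116 := by
        intro v hv
        obtain ⟨hv, hvs⟩ := Finset.mem_filter.1 hv
        refine List.mem_filter.2 ⟨by simpa [Cell.verts] using hv, ?_⟩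
        rw [Nat.blt_eq]
        refine hσ v ?_ fun h => Finset.disjoint_left.1 hd hvs (Finset.mem_image_of_mem _ h)
        rw [← Finset.mem_coe, c.coe_verts] at hv
        obtain ⟨i, rfl⟩ := hv
        exact (allCells_vtx hc).1 i
      simp only [remainderCheck, Bool.or_eq_true, List.isEmpty_iff, List.any_eq_true,
        List.all_eq_true, Cell.has_iff] at h
      rcases h with h | ⟨c', hc', h⟩
      · obtain ⟨v, hv⟩ := hne'
        have := hmem v hv
        rw [h] at this
        exact absurd this List.not_mem_nil
      · exact ⟨c', hc', fun v hv => h v (hmem v hv)⟩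
  · rintro ⟨r, hr, rfl⟩
    obtain ⟨hne, c, hc, hrc⟩ := mem_numberedComplex.1 hr
    refine ⟨mem_X600.2 ⟨hne.image _, c, List.mem_append_left _ hc, Finset.image_subset_image hrc⟩,
      Finset.disjoint_left.2 fun x hx hx' => ?_⟩
    obtain ⟨v, hv, rfl⟩ := Finset.mem_image.1 hx
    obtain ⟨w, hw, h⟩ := Finset.mem_image.1 hx'
    have hv' : v < 116 := lt_of_mem_numberedComplex (singleton_mem_faces hr hv)
    have hw' : 116 ≤ w ∧ w < 120 := by
      simp only [removedSimplex, Finset.mem_insert, Finset.mem_singleton] at hw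
      omega
    have := goldenVertex_injOn (show w < 120 from hw'.2) (show v < 120 by omega) h
    omega

/-- The numbered complex is isomorphic to `X₅₄₃`. -/
lemma exists_X543 : ∃ σ ∈ X600.faces, σ.card = 4 ∧
    CombinatoriallyEquivalent numberedComplex (X543 σ) := by
  have hmem : ((116, 117, 118, 119) : Cell) ∈ allCells :=
    List.mem_append_right _ (by decide +kernel)
  refine ⟨removedSimplex.image goldenVertex, mem_X600.2 ⟨⟨goldenVertex 116, ?_⟩, _, hmem, ?_⟩, ?_,
    combinatoriallyEquivalent_of_image (f := goldenVertex) ?_ ?_⟩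
  · exact Finset.mem_image_of_mem _ (by decide)
  · exact subset_rfl
  · rw [Finset.card_image_of_injOn]
    · rfl
    · refine goldenVertex_injOn.mono fun v hv => ?_
      simp only [removedSimplex, Finset.coe_insert, Finset.coe_singleton, Set.mem_insert_iff,
        Set.mem_singleton_iff] at hv
      change v < 120
      omega
  · exact goldenVertex_injOn.mono fun v hv =>
      (lt_of_mem_numberedComplex hv).trans (by norm_num)
  · ext s
    rw [mem_X543]
    rfl

/-! ### Verification of the positions of the vertices -/

/-- An integral vector, or an integral linear functional, in dimension 4. -/
abbrev IntVector := ℤ × ℤ × ℤ × ℤ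

namespace IntVector

def dot : IntVector → IntVector → ℤ
  | (a, b, c, d), (a', b', c', d') => a * a' + b * b' + c * c' + d * d'

def add : IntVector → IntVector → IntVector
  | (a, b, c, d), (a', b', c', d') => (a + a', b + b', c + c', d + d')

def sub : IntVector → IntVector → IntVector
  | (a, b, c, d), (a', b', c', d') => (a - a', b - b', c - c', d - d')

def smul (t : ℤ) : IntVector → IntVector
  | (a, b, c, d) => (t * a, t * b, t * c, t * d)

/-- The triple cross product. -/
def cross : IntVector → IntVector → IntVector → IntVector
  | (a₁, a₂, a₃, a₄), (b₁, b₂, b₃, b₄), (c₁, c₂, c₃, c₄) =>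
    (a₂ * (b₃ * c₄ - b₄ * c₃) - a₃ * (b₂ * c₄ - b₄ * c₂) + a₄ * (b₂ * c₃ - b₃ * c₂),
      -(a₁ * (b₃ * c₄ - b₄ * c₃) - a₃ * (b₁ * c₄ - b₄ * c₁) + a₄ * (b₁ * c₃ - b₃ * c₁)),
      a₁ * (b₂ * c₄ - b₄ * c₂) - a₂ * (b₁ * c₄ - b₄ * c₁) + a₄ * (b₁ * c₂ - b₂ * c₁),
      -(a₁ * (b₂ * c₃ - b₃ * c₂) - a₂ * (b₁ * c₃ - b₃ * c₁) + a₃ * (b₁ * c₂ - b₂ * c₁)))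

/-- The diagonal bilinear form with the entries `e, 1, 1, 1`. -/
def form (e : ℤ) : IntVector → IntVector → ℤ
  | (a, b, c, d), (a', b', c', d') => e * a * a' + b * b' + c * c' + d * d'

end IntVector

namespace Row

/-- The barycentric coordinates, multiplied by 1000. -/
def position : Row → IntVector
  | (a, b, c, d, _) => (a, b, c, d)

def height : Row → ℕ
  | (_, _, _, _, h) => h

end Row

/-- The row of the vertex `v` in the table `t`. -/
def rowAt (t : List Row) (v : ℕ) : Row := t.getD v (0, 0, 0, 0, 0)

/-- The value `f n`. By the case distinction, the kernel evaluates the argument `n` only once. -/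
def applyForced (n : ℕ) (f : ℕ → Bool) : Bool :=
  match n with
  | 0 => f 0
  | m + 1 => f (m + 1)

/-- Whether the rows of the list, which are numbered from `n` on, except for the numbers `a`, `b`,
`c`, `d`, satisfy `l₀ b₀ + l₁ b₁ + l₂ b₂ + l₃ b₃ < m h + k`. -/
def aboveCheck (l₀ l₁ l₂ l₃ m k a b c d : ℕ) : ℕ → List Row → Bool
  | _, [] => true
  | n, (b₀, b₁, b₂, b₃, h) :: r =>
    (Nat.ble (Nat.succ (Nat.add (Nat.add (Nat.mul l₀ b₀) (Nat.mul l₁ b₁))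
      (Nat.add (Nat.mul l₂ b₂) (Nat.mul l₃ b₃)))) (Nat.add (Nat.mul m h) k) ||
      Nat.beq n a || Nat.beq n b || Nat.beq n c || Nat.beq n d) &&
    aboveCheck l₀ l₁ l₂ l₃ m k a b c d (Nat.succ n) r

/-- Whether the cell is positively oriented, and the linear functional that takes the prescribed
heights at its vertices is smaller than the height at the other vertices. A shift by a multiple of
the coordinate sum makes all numbers nonnegative. -/
def regularityCheck (t : List Row) : Cell → Bool
  | (a, b, c, d) =>
    let r₀ := rowAt t a
    let r₁ := rowAt t b
    let r₂ := rowAt t c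
    let r₃ := rowAt t d
    let n₀ := IntVector.cross r₁.position r₂.position r₃.position
    let n₁ := (IntVector.cross r₀.position r₂.position r₃.position).smul (-1)
    let n₂ := IntVector.cross r₀.position r₁.position r₃.position
    let n₃ := (IntVector.cross r₀.position r₁.position r₂.position).smul (-1)
    let m := n₀.dot r₀.position
    let l := ((n₀.smul r₀.height).add (n₁.smul r₁.height)).add
      ((n₂.smul r₂.height).add (n₃.smul r₃.height))
    decide (0 < m) &&
    applyForced (l.1 + 100000000000000000000).toNat fun l₀ =>
    applyForced (l.2.1 + 100000000000000000000).toNat fun l₁ =>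
    applyForced (l.2.2.1 + 100000000000000000000).toNat fun l₂ =>
    applyForced (l.2.2.2 + 100000000000000000000).toNat fun l₃ =>
    applyForced m.toNat fun m =>
    aboveCheck l₀ l₁ l₂ l₃ m 100000000000000000000000 a b c d 0 t

/-- Whether the dihedral angle at the edge `xy` of the 3-simplex `xyzw` is acute. -/
def acuteEdgeCheck (e : ℤ) (x y z w : IntVector) : Bool :=
  let u := y.sub x
  let p := z.sub x
  let q := w.sub x
  decide (u.form e p * u.form e q < u.form e u * p.form e q)

/-- Whether the dihedral angles of the cell are acute. -/
def acuteCheck (e : ℤ) (t : List Row) : Cell → Bool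
  | (a, b, c, d) =>
    let x := (rowAt t a).position
    let y := (rowAt t b).position
    let z := (rowAt t c).position
    let w := (rowAt t d).position
    acuteEdgeCheck e x y z w && acuteEdgeCheck e x z y w && acuteEdgeCheck e x w y z &&
    acuteEdgeCheck e y z x w && acuteEdgeCheck e y w x z && acuteEdgeCheck e z w x y

/-- Whether the coordinates of the vertex `v` have the sum 1000, and are nonzero for the corners in
its support only. -/
def positionCheck (t : List Row) (v : ℕ) : Bool :=
  let r := rowAt t v
  (r.1 + r.2.1 + r.2.2.1 + r.2.2.2.1).beq 1000 &&
  ((supportCode v).testBit 0 == !r.1.beq 0) && ((supportCode v).testBit 1 == !r.2.1.beq 0) &&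
  ((supportCode v).testBit 2 == !r.2.2.1.beq 0) && ((supportCode v).testBit 3 == !r.2.2.2.1.beq 0)

lemma regularTable_regularityCheck : cellList.all (regularityCheck regularTable) = true := by
  decide +kernel

lemma cornerTable_regularityCheck : cellList.all (regularityCheck cornerTable) = true := by
  decide +kernel

lemma regularTable_acuteCheck : cellList.all (acuteCheck 1 regularTable) = true := by
  decide +kernel

lemma cornerTable_acuteCheck : cellList.all (acuteCheck 0 cornerTable) = true := by
  decide +kernel

lemma regularTable_positionCheck : ∀ v < 116, positionCheck regularTable v = true := by
  decide +kernel

lemma cornerTable_positionCheck : ∀ v < 116, positionCheck cornerTable v = true := by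
  decide +kernel

/-! ### The two blocks -/

/-- The real linear functional with the given integral coefficients. -/
def IntVector.toLinear (n : IntVector) : (Fin 4 → ℝ) →ₗ[ℝ] ℝ :=
  (n.1 : ℝ) • LinearMap.proj 0 + (n.2.1 : ℝ) • LinearMap.proj 1 +
    (n.2.2.1 : ℝ) • LinearMap.proj 2 + (n.2.2.2 : ℝ) • LinearMap.proj 3

/-- The barycentric coordinates of the vertices in the table `t`. -/
noncomputable def barycentric (t : List Row) (v : ℕ) : Fin 4 → ℝ :=
  ![((rowAt t v).1 : ℝ) / 1000, ((rowAt t v).2.1 : ℝ) / 1000, ((rowAt t v).2.2.1 : ℝ) / 1000,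
    ((rowAt t v).2.2.2.1 : ℝ) / 1000]

lemma toLinear_barycentric (n : IntVector) (t : List Row) (v : ℕ) :
    n.toLinear (barycentric t v) = (n.dot (rowAt t v).position : ℝ) / 1000 := by
  rcases n with ⟨a, b, c, d⟩
  simp only [IntVector.toLinear, barycentric]
  rcases rowAt t v with ⟨a', b', c', d', h⟩
  simp [Row.position, IntVector.dot]
  ring

/-- The functionals that are proportional to the dual basis of four vectors. -/
def facetNormal (w : Fin 4 → IntVector) : Fin 4 → IntVector :=
  ![IntVector.cross (w 1) (w 2) (w 3), (IntVector.cross (w 0) (w 2) (w 3)).smul (-1),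
    IntVector.cross (w 0) (w 1) (w 3), (IntVector.cross (w 0) (w 1) (w 2)).smul (-1)]

/-- The determinant of four vectors. -/
def orientation (w : Fin 4 → IntVector) : ℤ := (facetNormal w 0).dot (w 0)

lemma facetNormal_dot (w : Fin 4 → IntVector) (i j : Fin 4) :
    (facetNormal w i).dot (w j) = if i = j then orientation w else 0 := by
  obtain ⟨a, a', a'', a''', ha⟩ : ∃ a a' a'' a''', w 0 = (a, a', a'', a''') := ⟨_, _, _, _, rfl⟩
  obtain ⟨b, b', b'', b''', hb⟩ : ∃ a a' a'' a''', w 1 = (a, a', a'', a''') := ⟨_, _, _, _, rfl⟩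
  obtain ⟨c, c', c'', c''', hc⟩ : ∃ a a' a'' a''', w 2 = (a, a', a'', a''') := ⟨_, _, _, _, rfl⟩
  obtain ⟨d, d', d'', d''', hd⟩ : ∃ a a' a'' a''', w 3 = (a, a', a'', a''') := ⟨_, _, _, _, rfl⟩
  fin_cases i <;> fin_cases j <;>
    simp [orientation, facetNormal, IntVector.cross, IntVector.smul, IntVector.dot, ha, hb, hc,
      hd] <;> ring

/-- The vectors of a tuple of vertices. -/
def positions (t : List Row) (c : Fin 4 → ℕ) (i : Fin 4) : IntVector := (rowAt t (c i)).position

/-- The coordinate functionals of a tuple of vertices. -/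
noncomputable def blockCoordinate (t : List Row) (c : Fin 4 → ℕ) (i : Fin 4) :
    (Fin 4 → ℝ) →ₗ[ℝ] ℝ :=
  (1000 / (orientation (positions t c) : ℝ)) • (facetNormal (positions t c) i).toLinear

lemma blockCoordinate_barycentric (t : List Row) (c : Fin 4 → ℕ) (i : Fin 4) (v : ℕ) :
    blockCoordinate t c i (barycentric t v) =
      ((facetNormal (positions t c) i).dot (rowAt t v).position : ℝ) /
        orientation (positions t c) := by
  simp only [blockCoordinate, LinearMap.smul_apply, toLinear_barycentric, smul_eq_mul]
  ring

lemma applyForced_eq (n : ℕ) (f : ℕ → Bool) : applyForced n f = f n := by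
  cases n <;> rfl

lemma aboveCheck_getElem {l₀ l₁ l₂ l₃ m k a b c d : ℕ} : ∀ {t : List Row} {n : ℕ},
    aboveCheck l₀ l₁ l₂ l₃ m k a b c d n t = true → ∀ (i : ℕ) (hi : i < t.length),
    l₀ * t[i].1 + l₁ * t[i].2.1 + (l₂ * t[i].2.2.1 + l₃ * t[i].2.2.2.1) < m * t[i].height + k ∨
      n + i = a ∨ n + i = b ∨ n + i = c ∨ n + i = d
  | [], _, _, i, hi => absurd hi (Nat.not_lt_zero _)
  | (b₀, b₁, b₂, b₃, h) :: r, n, H, i, hi => by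
    simp only [aboveCheck, Bool.and_eq_true, Bool.or_eq_true, Nat.beq_eq, Nat.ble_eq] at H
    rcases i with _ | i
    · have := H.1
      simp only [or_assoc] at this
      exact this
    · have := aboveCheck_getElem H.2 i (by simpa using hi)
      simpa [Nat.succ_eq_add_one, add_assoc, add_comm 1] using this

lemma regularityCheck_spec {t : List Row} (ht : t.length = 116)
    (hsum : ∀ v < 116, positionCheck t v = true) {c : Cell}
    (h : regularityCheck t c = true) :
    0 < orientation (positions t c.vtx) ∧ ∀ w < 116, w ∉ Set.range c.vtx →
      ∑ i, ((rowAt t (c.vtx i)).height : ℤ) *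
          (facetNormal (positions t c.vtx) i).dot (rowAt t w).position <
        orientation (positions t c.vtx) * (rowAt t w).height := by
  obtain ⟨a, b, c, d⟩ := c
  simp only [regularityCheck, applyForced_eq, Bool.and_eq_true, decide_eq_true_eq] at h
  obtain ⟨h1, h2⟩ := h
  refine ⟨h1, fun w hw hr => ?_⟩
  have h3 := aboveCheck_getElem h2 w (by omega)
  rw [zero_add] at h3
  have hrow : t[w] = rowAt t w := by rw [rowAt, List.getD_eq_getElem]
  have h4 := h3.resolve_right (fun e => hr (by
    rcases e with e | e | e | e
    · exact ⟨0, e.symm⟩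
    · exact ⟨1, e.symm⟩
    · exact ⟨2, e.symm⟩
    · exact ⟨3, e.symm⟩))
  rw [hrow] at h4
  have h5 := hsum w hw
  simp only [positionCheck, Bool.and_eq_true, Nat.beq_eq] at h5
  have h5 := h5.1.1.1.1
  generalize hn₀ : IntVector.cross (rowAt t b).position (rowAt t c).position
    (rowAt t d).position = n₀ at h1 h4
  generalize hn₁ : (IntVector.cross (rowAt t a).position (rowAt t c).position
    (rowAt t d).position).smul (-1) = n₁ at h4
  generalize hn₂ : IntVector.cross (rowAt t a).position (rowAt t b).position
    (rowAt t d).position = n₂ at h4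
  generalize hn₃ : (IntVector.cross (rowAt t a).position (rowAt t b).position
    (rowAt t c).position).smul (-1) = n₃ at h4
  have e₀ : facetNormal (positions t (Cell.vtx (a, b, c, d))) 0 = n₀ := hn₀
  have e₁ : facetNormal (positions t (Cell.vtx (a, b, c, d))) 1 = n₁ := hn₁
  have e₂ : facetNormal (positions t (Cell.vtx (a, b, c, d))) 2 = n₂ := hn₂
  have e₃ : facetNormal (positions t (Cell.vtx (a, b, c, d))) 3 = n₃ := hn₃
  have e : orientation (positions t (Cell.vtx (a, b, c, d))) = n₀.dot (rowAt t a).position := by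
    rw [← hn₀]
    rfl
  rw [Fin.sum_univ_four, e₀, e₁, e₂, e₃, e]
  change (rowAt t a).height * n₀.dot _ + (rowAt t b).height * n₁.dot _ +
    (rowAt t c).height * n₂.dot _ + (rowAt t d).height * n₃.dot _ < _
  generalize (rowAt t a).height = ha, (rowAt t b).height = hb, (rowAt t c).height = hc,
    (rowAt t d).height = hd at h4 ⊢
  generalize n₀.dot (rowAt t a).position = m at h1 h4 ⊢
  generalize rowAt t w = r at h4 h5 ⊢
  obtain ⟨r₀, r₁, r₂, r₃, h⟩ := r
  obtain ⟨x, x', x'', x'''⟩ := n₀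
  obtain ⟨y, y', y'', y'''⟩ := n₁
  obtain ⟨z, z', z'', z'''⟩ := n₂
  obtain ⟨u, u', u'', u'''⟩ := n₃
  simp only [IntVector.add, IntVector.smul, IntVector.dot, Row.position, Row.height] at h4 h5 ⊢
  zify at h4 h5
  rw [Int.toNat_of_nonneg h1.le] at h4
  -- truncation at `0` can only enlarge the left side of `h4`
  have b₀ := mul_le_mul_of_nonneg_right (Int.self_le_toNat (ha * x + hb * y + (hc * z + hd * u) +
    100000000000000000000)) (Int.natCast_nonneg r₀)
  have b₁ := mul_le_mul_of_nonneg_right (Int.self_le_toNat (ha * x' + hb * y' + (hc * z' + hd * u') +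
    100000000000000000000)) (Int.natCast_nonneg r₁)
  have b₂ := mul_le_mul_of_nonneg_right (Int.self_le_toNat (ha * x'' + hb * y'' + (hc * z'' + hd * u'') +
    100000000000000000000)) (Int.natCast_nonneg r₂)
  have b₃ := mul_le_mul_of_nonneg_right (Int.self_le_toNat (ha * x''' + hb * y''' +
    (hc * z''' + hd * u''') + 100000000000000000000)) (Int.natCast_nonneg r₃)
  linarith

lemma acuteEdgeCheck_iff {e : ℤ} {x y z w : IntVector} : acuteEdgeCheck e x y z w = true ↔
    (y.sub x).form e (z.sub x) * (y.sub x).form e (w.sub x) <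
      (y.sub x).form e (y.sub x) * (z.sub x).form e (w.sub x) := by
  simp [acuteEdgeCheck]

lemma acuteEdgeCheck_swap {e : ℤ} {x y z w : IntVector} (h : acuteEdgeCheck e x y z w = true) :
    acuteEdgeCheck e x y w z = true := by
  rw [acuteEdgeCheck_iff] at h ⊢
  obtain ⟨x, x', x'', x'''⟩ := x
  obtain ⟨y, y', y'', y'''⟩ := y
  obtain ⟨z, z', z'', z'''⟩ := z
  obtain ⟨w, w', w'', w'''⟩ := w
  simp only [IntVector.sub, IntVector.form] at h ⊢
  linarith

lemma acuteEdgeCheck_reverse {e : ℤ} {x y z w : IntVector} (h : acuteEdgeCheck e x y z w = true) :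
    acuteEdgeCheck e y x z w = true := by
  rw [acuteEdgeCheck_iff] at h ⊢
  obtain ⟨x, x', x'', x'''⟩ := x
  obtain ⟨y, y', y'', y'''⟩ := y
  obtain ⟨z, z', z'', z'''⟩ := z
  obtain ⟨w, w', w'', w'''⟩ := w
  simp only [IntVector.sub, IntVector.form] at h ⊢
  linarith

/-- A statement about the dihedral angles of a 3-simplex has to be proved for one order of the
vertices at each edge. -/
lemma forall_of_edges {P : Fin 4 → Fin 4 → Fin 4 → Fin 4 → Prop}
    (swap : ∀ i j k l, P i j k l → P i j l k) (reverse : ∀ i j k l, P i j k l → P j i k l)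
    (h01 : P 0 1 2 3) (h02 : P 0 2 1 3) (h03 : P 0 3 1 2) (h12 : P 1 2 0 3) (h13 : P 1 3 0 2)
    (h23 : P 2 3 0 1) {i j k l : Fin 4} (hij : i ≠ j) (hik : i ≠ k) (hil : i ≠ l) (hjk : j ≠ k)
    (hjl : j ≠ l) (hkl : k ≠ l) : P i j k l := by
  wlog hlt : i < j generalizing i j
  · exact reverse _ _ _ _ (this hij.symm hjk hjl hik hil (lt_of_le_of_ne (not_lt.1 hlt) hij.symm))
  wlog hlt' : k < l generalizing k l
  · exact swap _ _ _ _ (this hkl.symm hil hik hjl hjk (lt_of_le_of_ne (not_lt.1 hlt') hkl.symm))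
  have : (i, j, k, l) ∈ [((0 : Fin 4), (1 : Fin 4), (2 : Fin 4), (3 : Fin 4)), (0, 2, 1, 3),
      (0, 3, 1, 2), (1, 2, 0, 3), (1, 3, 0, 2), (2, 3, 0, 1)] := by
    revert i j k l
    decide
  simp only [List.mem_cons, Prod.mk.injEq, List.not_mem_nil, or_false] at this
  rcases this with ⟨rfl, rfl, rfl, rfl⟩ | ⟨rfl, rfl, rfl, rfl⟩ | ⟨rfl, rfl, rfl, rfl⟩ |
    ⟨rfl, rfl, rfl, rfl⟩ | ⟨rfl, rfl, rfl, rfl⟩ | ⟨rfl, rfl, rfl, rfl⟩ <;> assumption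

lemma acuteCheck_spec {e : ℤ} {t : List Row} {c : Cell} (h : acuteCheck e t c = true)
    {i j k l : Fin 4} (hij : i ≠ j) (hik : i ≠ k) (hil : i ≠ l) (hjk : j ≠ k) (hjl : j ≠ l)
    (hkl : k ≠ l) : acuteEdgeCheck e (positions t c.vtx i) (positions t c.vtx j)
      (positions t c.vtx k) (positions t c.vtx l) = true := by
  obtain ⟨a, b, c, d⟩ := c
  simp only [acuteCheck, Bool.and_eq_true] at h
  obtain ⟨⟨⟨⟨⟨h1, h2⟩, h3⟩, h4⟩, h5⟩, h6⟩ := h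
  exact forall_of_edges (P := fun i j k l => acuteEdgeCheck e (positions t (Cell.vtx (a, b, c, d)) i)
    (positions t (Cell.vtx (a, b, c, d)) j) (positions t (Cell.vtx (a, b, c, d)) k)
    (positions t (Cell.vtx (a, b, c, d)) l) = true) (fun _ _ _ _ => acuteEdgeCheck_swap)
    (fun _ _ _ _ => acuteEdgeCheck_reverse) h1 h2 h3 h4 h5 h6 hij hik hil hjk hjl hkl

lemma diagForm_barycentric (e : ℤ) (t : List Row) (v w x : ℕ) :
    diagForm (fun k => if k = 0 then (e : ℝ) else 1) (barycentric t v - barycentric t x)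
      (barycentric t w - barycentric t x) =
      (((rowAt t v).position.sub (rowAt t x).position).form e
        ((rowAt t w).position.sub (rowAt t x).position) : ℝ) / 1000 ^ 2 := by
  simp only [diagForm, barycentric, Fin.sum_univ_four, Pi.sub_apply]
  rcases rowAt t v with ⟨a, b, c, d, h⟩
  rcases rowAt t w with ⟨a', b', c', d', h'⟩
  rcases rowAt t x with ⟨a'', b'', c'', d'', h''⟩
  simp [Row.position, IntVector.form, IntVector.sub]
  ring

lemma positionCheck_spec {t : List Row} {v : ℕ} (h : positionCheck t v = true) :
    (∀ k, 0 ≤ barycentric t v k) ∧ ∑ k, barycentric t v k = 1 ∧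
      ∀ k, barycentric t v k ≠ 0 ↔ k ∈ vertexSupport v := by
  have h0 : ∀ a : ℕ, (a : ℝ) / 1000 ≠ 0 ↔ Nat.beq a 0 = false := by
    intro a
    rcases Nat.eq_zero_or_pos a with rfl | ha
    · simp
    · have e : Nat.beq a 0 = false := by
        rw [← Bool.not_eq_true, Nat.beq_eq]
        omega
      simp [e, ha.ne']
  simp only [positionCheck, Bool.and_eq_true, beq_iff_eq] at h
  obtain ⟨⟨⟨⟨h1, h2⟩, h3⟩, h4⟩, h5⟩ := h
  replace h1 := Nat.eq_of_beq_eq_true h1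
  refine ⟨fun k => ?_, ?_, fun k => ?_⟩
  · fin_cases k <;> simp [barycentric] <;> positivity
  · simp only [barycentric, Fin.sum_univ_four]
    simp
    rw [← add_div, ← add_div, ← add_div]
    have : ((rowAt t v).1 + (rowAt t v).2.1 + (rowAt t v).2.2.1 + (rowAt t v).2.2.2.1 : ℝ) =
      1000 := by exact_mod_cast h1
    rw [this]
    norm_num
  · simp only [vertexSupport, Finset.mem_filter, Finset.mem_univ, true_and]
    fin_cases k
    · exact (h0 _).trans (by simp [h2])
    · exact (h0 _).trans (by simp [h3])
    · exact (h0 _).trans (by simp [h4])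
    · exact (h0 _).trans (by simp [h5])

section

variable {t : List Row} (ht : t.length = 116) (hpos : ∀ v < 116, positionCheck t v = true)
  (hreg : cellList.all (regularityCheck t) = true)
include ht hpos hreg

/-- The cones over the cells of a block form a regular fan. -/
lemma isRegularFan_barycentric : IsRegularFan {c | ∃ c' ∈ cellList, c = c'.vtx} {v | v < 116}
    (barycentric t) (fun v => (rowAt t v).height) (blockCoordinate t) := by
  have spec := fun c hc => regularityCheck_spec ht hpos (List.all_eq_true.1 hreg c hc)
  have pos : ∀ c ∈ cellList, (0 : ℝ) < orientation (positions t c.vtx) := fun c hc => by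
    exact_mod_cast (spec c hc).1
  have dual : ∀ c ∈ cellList, ∀ i j, blockCoordinate t c.vtx i (barycentric t (c.vtx j)) =
      if i = j then 1 else 0 := by
    intro c hc i j
    have := facetNormal_dot (positions t c.vtx) i j
    rw [blockCoordinate_barycentric, show (rowAt t (c.vtx j)).position = positions t c.vtx j from rfl,
      this]
    split_ifs
    · exact div_self (pos c hc).ne'
    · simp
  refine ⟨?_, ?_, ?_, ?_⟩
  · rintro _ ⟨c, hc, rfl⟩ i
    exact vtx_lt hc i
  · rintro _ ⟨c, hc, rfl⟩
    exact dual c hc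
  · rintro _ ⟨c, hc, rfl⟩ y
    exact sum_smul_eq_of_dual (by simp) (dual c hc) y
  · rintro _ ⟨c, hc, rfl⟩ w hw hr
    simp only [blockCoordinate_barycentric, mul_div_assoc']
    rw [← Finset.sum_div, div_lt_iff₀ (pos c hc), mul_comm]
    exact_mod_cast (spec c hc).2 w hw hr

lemma isBlock_barycentric {e : ℤ} (hacute : cellList.all (acuteCheck e t) = true) :
    IsBlock numberedComplex vertexSupport (barycentric t)
      (fun k => if k = 0 then (e : ℝ) else 1) := by
  have F := isRegularFan_barycentric ht hpos hreg
  have hp := fun v (hv : {v} ∈ numberedComplex.faces) =>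
    positionCheck_spec (hpos v (lt_of_mem_numberedComplex hv))
  have hface : ∀ s ∈ numberedComplex.faces, ∃ c ∈ cellList, (s : Set ℕ) ⊆ Set.range c.vtx := by
    intro s hs
    obtain ⟨-, c, hc, hsc⟩ := mem_numberedComplex.1 hs
    exact ⟨c, hc, by rw [← c.coe_verts]; exact hsc⟩
  refine ⟨fun v hv => (hp v hv).1, fun v hv => (hp v hv).2.1, fun v hv => (hp v hv).2.2, ?_, ?_,
    ?_, ?_⟩
  · intro s hs
    obtain ⟨c, hc, hsc⟩ := hface s hs
    refine LinearIndepOn.mono ?_ hsc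
    rw [linearIndepOn_range_iff (vtx_injective hc)]
    exact F.linearIndependent ⟨c, hc, rfl⟩
  · intro s hs s' hs' a a' ha ha' heq
    obtain ⟨c, hc, hsc⟩ := hface s hs
    obtain ⟨c', hc', hsc'⟩ := hface s' hs'
    exact F.mem_of_sum_eq ⟨c, hc, rfl⟩ ⟨c', hc', rfl⟩ hsc hsc' ha ha' heq
  · intro y hy
    have hfin : {c | ∃ c' ∈ cellList, c = c'.vtx}.Finite :=
      (cellList.toFinset.finite_toSet.image Cell.vtx).subset (by
        rintro _ ⟨c, hc, rfl⟩
        exact ⟨c, by simpa using hc, rfl⟩)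
    obtain ⟨_, ⟨c, hc, rfl⟩, h⟩ := F.exists_nonneg hfin
      ⟨_, _, List.mem_cons_self .., rfl⟩ y (by
        rintro _ ⟨c, hc, rfl⟩ i
        by_cases hb : ∃ k, ∀ j, j ≠ i → k ∉ vertexSupport (c.vtx j)
        · obtain ⟨k, hk⟩ := hb
          left
          -- on a facet in the boundary, the coordinate functional is a positive multiple of `y k`
          have hb := fun j => hp (c.vtx j) (singleton_mem_faces (verts_mem hc) (c.vtx_mem j))
          have e : ∀ y : Fin 4 → ℝ, blockCoordinate t c.vtx i y * barycentric t (c.vtx i) k =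
              y k := by
            intro y
            have := congrFun (F.expand _ ⟨c, hc, rfl⟩ y) k
            rw [Finset.sum_apply, Finset.sum_eq_single i] at this
            · exact this
            · intro j _ hj
              have : barycentric t (c.vtx j) k = 0 := by
                by_contra h
                exact hk j hj (((hb j).2.2 k).1 h)
              simp [this]
            · simp
          have hne : barycentric t (c.vtx i) k ≠ 0 := fun h => by
            have := e (fun _ => 1)
            simp [h] at this
          have hpos := lt_of_le_of_ne ((hb i).1 k) hne.symm
          exact nonneg_of_mul_nonneg_left ((hy k).trans_eq (e y).symm) hpos
        · rw [facet_iff hc i, not_not] at hb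
          obtain ⟨c', hc', h1, h2⟩ := hb
          refine Or.inr ⟨_, ⟨c', hc', rfl⟩, fun j hj => ?_, ?_⟩
          · rw [← c'.coe_verts]; exact h1 j hj
          · rw [← c'.coe_verts]; exact h2)
    have hinj := vtx_injective hc
    refine ⟨c.verts, verts_mem hc, Function.extend c.vtx (fun i => blockCoordinate t c.vtx i y) 0,
      fun v hv => ?_, ?_⟩
    · rw [Cell.verts_eq_image] at hv
      obtain ⟨i, -, rfl⟩ := Finset.mem_image.1 hv
      rw [hinj.extend_apply]
      exact h i
    · rw [Cell.verts_eq_image, Finset.sum_image fun i _ j _ => @hinj i j]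
      simp only [hinj.extend_apply]
      exact F.expand _ ⟨c, hc, rfl⟩ y
  · intro s hs x hx y hy z hz w hw hxy hxz hxw hyz hyw hzw
    obtain ⟨c, hc, hsc⟩ := hface s hs
    obtain ⟨i, rfl⟩ := hsc hx
    obtain ⟨j, rfl⟩ := hsc hy
    obtain ⟨k, rfl⟩ := hsc hz
    obtain ⟨l, rfl⟩ := hsc hw
    have := acuteCheck_spec (List.all_eq_true.1 hacute c hc) (ne_of_apply_ne _ hxy)
      (ne_of_apply_ne _ hxz) (ne_of_apply_ne _ hxw) (ne_of_apply_ne _ hyz) (ne_of_apply_ne _ hyw)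
      (ne_of_apply_ne _ hzw)
    rw [acuteEdgeCheck_iff] at this
    simp only [diagForm_barycentric, positions] at this ⊢
    rw [div_mul_div_comm, div_mul_div_comm]
    refine div_lt_div_of_pos_right ?_ (by norm_num)
    exact_mod_cast this

end

/-- The subdivision of the regular 3-simplex. -/
lemma isBlock_regularTable : IsBlock numberedComplex vertexSupport (barycentric regularTable)
    (fun _ => 1) := by
  simpa using isBlock_barycentric (by decide +kernel) regularTable_positionCheck
    regularTable_regularityCheck regularTable_acuteCheck

/-- The subdivision of the corner 3-simplex. -/
lemma isBlock_cornerTable : IsBlock numberedComplex vertexSupport (barycentric cornerTable)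
    (fun k => if k = 0 then 0 else 1) := by
  simpa using isBlock_barycentric (by decide +kernel) cornerTable_positionCheck
    cornerTable_regularityCheck cornerTable_acuteCheck

/-! ### Symmetries of the numbered complex, and the assembly -/

/-- The involution of the vertices of `numberedComplex` which corresponds to the transposition of
the corners `0` and `i`. -/
def cornerSymmetry (i : Fin 4) (v : ℕ) : ℕ :=
  (![[],
    [1, 0, 2, 3, 4, 7, 8, 5, 6, 9, 11, 10, 12, 14, 13, 15, 19, 20, 21, 16, 17, 18, 44, 76, 73,
      59, 63, 27, 28, 70, 87, 31, 92, 65, 49, 72, 89, 37, 94, 67, 50, 64, 42, 78, 22, 55, 46,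
      58, 48, 34, 40, 51, 52, 79, 82, 45, 83, 86, 47, 25, 61, 60, 77, 26, 41, 33, 91, 39, 93,
      88, 29, 90, 35, 24, 74, 75, 23, 62, 43, 53, 80, 81, 54, 56, 84, 85, 57, 30, 69, 36, 71,
      66, 32, 68, 38, 95, 106, 107, 101, 99, 100, 98, 108, 109, 114, 115, 96, 97, 102, 103, 110,
      111, 112, 113, 104, 105],
    [2, 1, 0, 3, 7, 5, 9, 4, 8, 6, 12, 11, 10, 20, 19, 21, 17, 16, 18, 14, 13, 15, 42, 75, 74,
      61, 60, 27, 28, 91, 69, 49, 66, 88, 34, 93, 71, 50, 68, 90, 40, 77, 22, 62, 44, 45, 55,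
      47, 58, 31, 37, 51, 52, 80, 81, 46, 84, 85, 48, 63, 26, 25, 43, 59, 78, 87, 32, 89, 38,
      30, 92, 36, 94, 73, 24, 23, 76, 41, 64, 79, 53, 54, 82, 83, 56, 57, 86, 65, 33, 67, 39,
      29, 70, 35, 72, 101, 96, 97, 98, 106, 107, 95, 110, 111, 112, 113, 99, 100, 108, 109, 102,
      103, 104, 105, 114, 115],
    [3, 1, 2, 0, 8, 9, 6, 7, 4, 5, 21, 19, 20, 15, 14, 13, 18, 17, 16, 11, 12, 10, 52, 101,
      106, 25, 26, 56, 54, 113, 30, 62, 115, 33, 64, 35, 108, 45, 38, 110, 46, 97, 42, 100, 44,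
      37, 40, 47, 48, 107, 50, 58, 22, 102, 28, 55, 27, 105, 51, 112, 114, 109, 31, 111, 34, 95,
      66, 67, 96, 98, 70, 71, 99, 93, 94, 87, 88, 77, 78, 89, 90, 81, 82, 83, 84, 91, 92, 75,
      76, 79, 80, 85, 86, 73, 74, 65, 68, 41, 69, 72, 43, 23, 53, 104, 103, 57, 24, 49, 36, 61,
      39, 63, 59, 29, 60, 32]] i).getD v v

/-- Whether the image of the cell under the involution is a cell. -/
def symmetryCheck (i : Fin 4) : Cell → Bool
  | (a, b, c, d) =>
    applyForced (cornerSymmetry i a) fun a => applyForced (cornerSymmetry i b) fun b =>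
    applyForced (cornerSymmetry i c) fun c => applyForced (cornerSymmetry i d) fun d =>
    (cellsAt a).any fun c' => c'.has b && c'.has c && c'.has d

/-- The barycentric coordinates, multiplied by 1000. -/
def Row.coordinate (r : Row) : Fin 4 → ℕ := ![r.1, r.2.1, r.2.2.1, r.2.2.2.1]

lemma cornerSymmetry_involutive : ∀ i, ∀ v < 116, cornerSymmetry i (cornerSymmetry i v) = v := by
  decide +kernel

lemma cornerSymmetry_supportCode : ∀ i, ∀ v < 116, ∀ k : Fin 4, (supportCode v).testBit k =
    (supportCode (cornerSymmetry i v)).testBit (Equiv.swap 0 i k : Fin 4) := by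
  decide +kernel

lemma cellList_symmetryCheck : ∀ i, cellList.all (symmetryCheck i) = true := by
  decide +kernel

/-- In the face opposite to the corner `i`, the positions in the regular 3-simplex agree with the
positions in the corner 3-simplex whose right angles are at the corner `i`. -/
lemma coordinate_cornerTable : ∀ i, ∀ v < 116, (supportCode v).testBit (i : Fin 4) = false →
    ∀ k, (rowAt cornerTable (cornerSymmetry i v)).coordinate (Equiv.swap 0 i k) =
      (rowAt regularTable v).coordinate k := by
  decide +kernel

lemma barycentric_apply (t : List Row) (v : ℕ) (k : Fin 4) :
    barycentric t v k = ((rowAt t v).coordinate k : ℝ) / 1000 := by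
  fin_cases k <;> rfl

/-- The subdivision of the corner 3-simplex whose right angles are at the corner `i`. -/
lemma isBlock_cornerSymmetry (i : Fin 4) : IsBlock numberedComplex vertexSupport
    (fun v k => barycentric cornerTable (cornerSymmetry i v) (Equiv.swap 0 i k))
    (fun k => if k = i then 0 else 1) := by
  have h := isBlock_cornerTable.comp (cornerSymmetry i) (Equiv.swap 0 i)
    (fun v hv => cornerSymmetry_involutive i v (lt_of_mem_numberedComplex hv)) ?_ ?_
  · convert h using 1
    funext k
    simp only [Function.comp_apply, Equiv.swap_apply_eq_iff, Equiv.swap_apply_left]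
  · intro s hs
    obtain ⟨hne, c, hc, hsc⟩ := mem_numberedComplex.1 hs
    have hcheck := List.all_eq_true.1 (cellList_symmetryCheck i) c hc
    refine mem_numberedComplex.2 ⟨hne.image _, ?_⟩
    obtain ⟨a, b, c, d⟩ := c
    simp only [symmetryCheck, applyForced_eq, cellsAt, List.any_eq_true, List.mem_filter, Bool.and_eq_true,
      Cell.has_iff] at hcheck
    obtain ⟨c', ⟨hc', h1⟩, ⟨h2, h3⟩, h4⟩ := hcheck
    refine ⟨c', hc', fun w hw => ?_⟩
    obtain ⟨v, hv, rfl⟩ := Finset.mem_image.1 hw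
    have := hsc hv
    simp only [Cell.verts, Finset.mem_insert, Finset.mem_singleton] at this
    rcases this with rfl | rfl | rfl | rfl <;> assumption
  · intro v hv k
    simp only [vertexSupport, Finset.mem_filter, Finset.mem_univ, true_and]
    rw [cornerSymmetry_supportCode i v (lt_of_mem_numberedComplex hv) k]

/-- The positions of the vertices in the five 3-simplices of the cube. -/
noncomputable def cubeBlock : Option (Fin 4) → ℕ → Fin 4 → ℝ
  | none => barycentric regularTable
  | some i => fun v k => barycentric cornerTable (cornerSymmetry i v) (Equiv.swap 0 i k)

lemma cubeBlock_some_eq {i : Fin 4} {v : ℕ} (hv : {v} ∈ numberedComplex.faces)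
    (hi : i ∉ vertexSupport v) : cubeBlock (some i) v = cubeBlock none v := by
  have h : (supportCode v).testBit i = false := by simpa [vertexSupport] using hi
  funext k
  simp only [cubeBlock, barycentric_apply,
    coordinate_cornerTable i v (lt_of_mem_numberedComplex hv) h k]

lemma cubeCell_ne_none : ∀ i : Fin 4, cubeCell (some i) i ≠ cubeCell none i := by decide

lemma cubeCell_ne_some : ∀ i j : Fin 4, i ≠ j → cubeCell (some i) i ≠ cubeCell (some j) i := by
  decide

lemma isAssembly_cube : IsAssembly cubeCell cube3 numberedComplex vertexSupport cubeBlock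
    (fun o k => if o = some k then 0 else 1) := by
  refine ⟨isColouredTriangulation_cube, ?_, ?_, ?_⟩
  · rintro (_ | i)
    · simpa [cubeBlock] using isBlock_regularTable
    · simpa [cubeBlock, eq_comm] using isBlock_cornerSymmetry i
  · rintro (_ | i) (_ | j) v hv h
    · rfl
    · exact (cubeBlock_some_eq hv fun hj => cubeCell_ne_none j (h j hj).symm).symm
    · exact cubeBlock_some_eq hv fun hi => cubeCell_ne_none i (h i hi)
    · rcases eq_or_ne i j with rfl | hij
      · rfl
      · rw [cubeBlock_some_eq hv fun hi => cubeCell_ne_some i j hij (h i hi),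
          cubeBlock_some_eq hv fun hj => cubeCell_ne_some j i hij.symm (h j hj).symm]
  · rintro (_ | i)
    · exact ⟨4, by norm_num, fun u u' hu _ => by simpa using inner_cubeCell_none u u' hu⟩
    · exact ⟨4, by norm_num, fun u u' hu hu' => by
        simpa [eq_comm] using inner_cubeCell_some i u u' hu hu'⟩

lemma isAssembly_octahedron : IsAssembly octahedronCell octahedron3 numberedComplex vertexSupport
    (fun _ => barycentric cornerTable) (fun _ k => if k = 0 then 0 else 1) :=
  ⟨isColouredTriangulation_octahedron, fun _ => isBlock_cornerTable, fun _ _ _ _ _ => rfl,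
    fun ε => ⟨1, one_pos, fun u u' _ _ => inner_octahedronCell ε u u'⟩⟩

theorem theorem2p5 :
    (∃ K : Geometry.SimplicialComplex ℝ (EuclideanSpace ℝ (Fin 3)),
      IsAcuteTriangulation K cube3 ∧
      ∃ (V : Type) (_ : DecidableEq V) (Wstar : PreAbstractSimplicialComplex V),
        IsSpecialSubdivision cubeComplex Wstar ∧
        CombinatoriallyEquivalent K.toPreAbstractSimplicialComplex Wstar) ∧
    (∃ K : Geometry.SimplicialComplex ℝ (EuclideanSpace ℝ (Fin 3)),
      IsAcuteTriangulation K octahedron3 ∧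
      ∃ (V : Type) (_ : DecidableEq V) (Ystar : PreAbstractSimplicialComplex V),
        IsSpecialSubdivision octahedronComplex Ystar ∧
        CombinatoriallyEquivalent K.toPreAbstractSimplicialComplex Ystar) := by
  have hX := isSpecialSubdivisionWith_numberedComplex exists_X543
  rw [cubeComplex_eq, octahedronComplex_eq]
  exact ⟨isAssembly_cube.exists_acuteTriangulation hX finite_numberedComplex pure_numberedComplex,
    isAssembly_octahedron.exists_acuteTriangulation hX finite_numberedComplex
      pure_numberedComplex⟩
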